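/- Let $\Bbbk$ be a field of characteristic $0$, $A$ a commutative $\Bbbk$-algebra, and let $0\to\mathfrak n\xrightarrow{\iota}\mathfrak g\xrightarrow{\pi}\mathfrak h\to 0$ be a short exact sequence of Lie-Rinehart algebras over $A$ (morphisms over $\mathrm{id}_A$), each of them projective as an $A$-module. *Notation.* For a Lie-Rinehart algebra $L$ over $A$ let $\mathcal U_A(L)$ be its universal enveloping algebra, with canonical maps $\iota_A\colon A\to\mathcal U_A(L)$ and $L\to\mathcal U_A(L)$; we write $a$ for $\iota_A(a)$. It is a left bialgebroid over $A$ with source and target $\iota_A$: the tensor product $\otimes_A$ is taken with respect to left multiplication by $A$ on both factors, $\Delta(X)=X\otimes_A1+1\otimes_AX$ for $X\in L$, and $\varepsilon(uX)=0$, $\varepsilon(1)=1$, both maps being left $A$-linear; write $\Delta(u)=u_{(1)}\otimes_Au_{(2)}$. Let $\otimes_{A^{op}}$ be the tensor product in which $ua\otimes v=u\otimes av$. Write $I=\mathcal U_A(\iota)$ and $\Pi=\mathcal U_A(\pi)$. Since the anchor of $\mathfrak n$ is zero, $A$ is central in $U_A(\mathfrak n):=\mathcal U_A(\mathfrak n)$.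 Then the following holds. 1. There are an $A$-linear section $\gamma$ of $\pi$ and a dual basis $\{\chi_i,\varphi_i\}_{i\in I_0}$ of the $A$-module $\mathfrak g$. The map $\beta(u\otimes_{A^{op}}v)=u_{(1)}\otimes_Au_{(2)}v$ from $\mathcal U_A(\mathfrak g)\otimes_{A^{op}}\mathcal U_A(\mathfrak g)$ to $\mathcal U_A(\mathfrak g)\otimes_A\mathcal U_A(\mathfrak g)$ is bijective; write $u_+\otimes_{A^{op}}u_-=\beta^{-1}(u\otimes_A1)$. The map $I$ is injective, with image the left Hopf kernel $\{u: u_{(1)}\otimes_A\Pi(u_{(2)})=u\otimes_A1\}$ of $\Pi$. 2. Let $\gamma$ be any $A$-linear section of $\pi$ and $\{\chi_i,\varphi_i\}$ any dual basis of $\mathfrak g$; then $\{\pi(\chi_i),\varphi_i\circ\gamma\}$ is a dual basis of $\mathfrak h$. For $L=\mathfrak g,\mathfrak h$ with these dual bases $\{\chi^L_i,\varphi^L_i\}$, let $\mathrm S_L\colon\mathcal S_A(L)\to\mathcal U_A(L)$ be the symmetrisation map, i.e. the $A$-linear map $$\mathrm S_L(X_1\cdots X_m)=\frac1{m!}\sum_{j_1,\dots,j_m}\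 \sum_{\tau\in\mathfrak S_m}\varphi^L_{j_1}(X_1)\cdots\varphi^L_{j_m}(X_m)\,\chi^L_{j_{\tau(1)}}\cdots\chi^L_{j_{\tau(m)}} .$$ Then $\mathrm S_{\mathfrak h}$ is bijective, and $\Gamma:=\mathrm S_{\mathfrak g}\circ\mathcal S_A(\gamma)\circ\mathrm S_{\mathfrak h}^{-1}\colon\mathcal U_A(\mathfrak h)\to\mathcal U_A(\mathfrak g)$ is a left and right $A$-linear morphism of $A$-corings with $\Gamma(1)=1$ and $\Pi\circ\Gamma=\mathrm{id}$. 3. Identify $U_A(\mathfrak n)$ with its image under $I$. The formulas $$v\rightharpoonup b=\Gamma(v)_+\,b\,\Gamma(v)_-,\qquad \sigma(v,w)=\varepsilon\big(\Gamma(v_{(2)}w_{(2)})_+\big)\,\Gamma(v_{(1)})\,\Gamma(w_{(1)})\,\Gamma(v_{(2)}w_{(2)})_-$$ for $v,w\in\mathcal U_A(\mathfrak h)$, $b\in U_A(\mathfrak n)$ give well-defined elements of $U_A(\mathfrak n)$. (The second is the value at $\Gamma(v_{(1)})\Gamma(w_{(1)})\otimes_A\Gamma(v_{(2)}w_{(2)})_+\otimes_{A^{op}}\Gamma(v_{(2)}w_{(2)})_-$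 of the map $x\otimes y\otimes q\mapsto\varepsilon(y)xq$ on $(\mathcal U_A(\mathfrak g)\times_A\mathcal U_A(\mathfrak g))\otimes_{A^{op}}\mathcal U_A(\mathfrak g)$, where $\times_A$ is the Sweedler-Takeuchi product, consisting of the $\sum x_i\otimes_Ay_i$ with $\sum x_ia\otimes_Ay_i=\sum x_i\otimes_Ay_ia$ for all $a\in A$.) They make $U_A(\mathfrak n)$ a $\mathcal U_A(\mathfrak h)$-measured $A$-ring: $(aa'u)\rightharpoonup b=a(u\rightharpoonup b)a'$, $u\rightharpoonup1=\varepsilon(u)$, $u\rightharpoonup(bb')=(u_{(1)}\rightharpoonup b)(u_{(2)}\rightharpoonup b')$. The map $\sigma$ is a $U_A(\mathfrak n)$-valued Hopf $2$-cocycle: $\sigma(aa'u,v)=a\,\sigma(u,v)\,a'$, $\sigma(ua,v)=\sigma(u,av)=(u_{(1)}\rightharpoonup a)\sigma(u_{(2)},v)$, $\sigma(1,u)=\varepsilon(u)=\sigma(u,1)$ and $$\big(u_{(1)}\rightharpoonup\sigma(v_{(1)},w_{(1)})\big)\,\sigma(u_{(2)},v_{(2)}w_{(2)})=\sigma(u_{(1)},v_{(1)})\,\sigma(u_{(2)}v_{(2)},w).$$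 And $U_A(\mathfrak n)$ is a $\sigma$-twisted left $\mathcal U_A(\mathfrak h)$-module: $1\rightharpoonup b=b$ and $\big(u_{(1)}\rightharpoonup(v_{(1)}\rightharpoonup b)\big)\sigma(u_{(2)},v_{(2)})=\sigma(u_{(1)},v_{(1)})\,(u_{(2)}v_{(2)}\rightharpoonup b)$. 4. Hence the crossed product $U_A(\mathfrak n)\#_\sigma\mathcal U_A(\mathfrak h)$, that is $U_A(\mathfrak n)\otimes_A\mathcal U_A(\mathfrak h)$ with $$(b\# u)(b'\# v)=b\,(u_{(1)}\rightharpoonup b')\,\sigma(u_{(2)},v_{(1)})\,\#\,u_{(3)}v_{(2)},$$ is a well-defined associative $\Bbbk$-algebra with unit $1\#1$; it is an $A$-ring via $a\mapsto a\#1$ and a right $\mathcal U_A(\mathfrak h)$-comodule algebra via $b\# v\mapsto(b\# v_{(1)})\otimes_Av_{(2)}$. Likewise $\mathcal U_A(\mathfrak g)$ is a right $\mathcal U_A(\mathfrak h)$-comodule algebra via $u\mapsto u_{(1)}\otimes_A\Pi(u_{(2)})$. The map $$\Phi\colon U_A(\mathfrak n)\#_\sigma\mathcal U_A(\mathfrak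 h)\longrightarrow\mathcal U_A(\mathfrak g),\qquad b\# v\mapsto b\,\Gamma(v)$$ is an isomorphism of $A$-rings and of right $\mathcal U_A(\mathfrak h)$-comodule algebras. -/

import Mathlib

open scoped TensorProduct LieRinehartAlgebra

noncomputable section

namespace LieRinehart

universe uk uA uL uM uN uR uI

/-! ## The universal enveloping algebra of a Lie-Rinehart algebra -/

section Env

variable (k : Type uk) (A : Type uA) (L : Type uL)
variable [Field k] [CommRing A] [Algebra k A]
variable [LieRing L] [LieAlgebra k L] [Module A L] [LieRingModule L A]

/-- The relations of the universal enveloping algebra, on the tensor `k`-algebra of `A × L`. -/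
inductive EnvRel : TensorAlgebra k (A × L) → TensorAlgebra k (A × L) → Prop
  | one : EnvRel (TensorAlgebra.ι k ((1 : A), (0 : L))) 1
  | mul (a b : A) : EnvRel (TensorAlgebra.ι k (a * b, (0 : L)))
      (TensorAlgebra.ι k (a, (0 : L)) * TensorAlgebra.ι k (b, (0 : L)))
  | smul (a : A) (X : L) : EnvRel (TensorAlgebra.ι k ((0 : A), a • X))
      (TensorAlgebra.ι k (a, (0 : L)) * TensorAlgebra.ι k ((0 : A), X))
  | lie (X Y : L) : EnvRel
      (TensorAlgebra.ι k ((0 : A), ⁅X, Y⁆)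
        + TensorAlgebra.ι k ((0 : A), Y) * TensorAlgebra.ι k ((0 : A), X))
      (TensorAlgebra.ι k ((0 : A), X) * TensorAlgebra.ι k ((0 : A), Y))
  | anchor (X : L) (a : A) : EnvRel
      (TensorAlgebra.ι k ((0 : A), X) * TensorAlgebra.ι k (a, (0 : L)))
      (TensorAlgebra.ι k (a, (0 : L)) * TensorAlgebra.ι k ((0 : A), X)
        + TensorAlgebra.ι k (⁅X, a⁆, (0 : L)))

/-- The universal enveloping algebra `𝒰_A(L)` of a Lie-Rinehart algebra `L` over `A`. Its universal
property is given by `Env.lift`, `Env.lift_base`, `Env.lift_gen` and `Env.hom_ext` below. -/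
def Env : Type (max uk uA uL) := RingQuot (EnvRel k A L)

instance : Ring (Env k A L) := inferInstanceAs (Ring (RingQuot (EnvRel k A L)))

instance : Algebra k (Env k A L) := inferInstanceAs (Algebra k (RingQuot (EnvRel k A L)))

namespace Env

/-- The quotient map from the tensor algebra. -/
def mk : TensorAlgebra k (A × L) →ₐ[k] Env k A L := RingQuot.mkAlgHom k (EnvRel k A L)

variable {k A L} in
theorem mk_rel {x y : TensorAlgebra k (A × L)} (h : EnvRel k A L x y) :
    mk k A L x = mk k A L y :=
  RingQuot.mkAlgHom_rel k h

/-- The canonical map `ι_A : A → 𝒰_A(L)`. -/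
def base : A →ₐ[k] Env k A L :=
  AlgHom.ofLinearMap
    ((mk k A L).toLinearMap ∘ₗ TensorAlgebra.ι k ∘ₗ LinearMap.inl k A L)
    (by simpa using mk_rel (EnvRel.one (k := k) (A := A) (L := L)))
    (fun a b => by simpa using mk_rel (EnvRel.mul (k := k) (A := A) (L := L) a b))

/-- The canonical map `ι_L : L → 𝒰_A(L)`. -/
def gen : L →ₗ[k] Env k A L :=
  (mk k A L).toLinearMap ∘ₗ TensorAlgebra.ι k ∘ₗ LinearMap.inr k A L

variable {A L}

theorem gen_smul (a : A) (X : L) : gen k A L (a • X) = base k A L a * gen k A L X := by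
  simpa [gen, base] using mk_rel (EnvRel.smul (k := k) a X)

theorem gen_lie (X Y : L) : gen k A L ⁅X, Y⁆ =
    gen k A L X * gen k A L Y - gen k A L Y * gen k A L X := by
  have := mk_rel (EnvRel.lie (k := k) (A := A) X Y)
  rw [map_add, map_mul, map_mul] at this
  exact eq_sub_of_add_eq this

theorem gen_mul_base (X : L) (a : A) : gen k A L X * base k A L a =
    base k A L a * gen k A L X + base k A L ⁅X, a⁆ := by
  simpa [gen, base] using mk_rel (EnvRel.anchor (k := k) X a)

variable {k}
variable {R : Type uR} [Ring R] [Algebra k R]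

/-- The universal property: existence of the induced algebra morphism. -/
def lift (φ : A →ₐ[k] R) (ψ : L →ₗ[k] R) (hsmul : ∀ a X, ψ (a • X) = φ a * ψ X)
    (hlie : ∀ X Y, ψ ⁅X, Y⁆ = ψ X * ψ Y - ψ Y * ψ X)
    (hanchor : ∀ X a, ψ X * φ a - φ a * ψ X = φ ⁅X, a⁆) : Env k A L →ₐ[k] R :=
  RingQuot.liftAlgHom k
    ⟨TensorAlgebra.lift k (φ.toLinearMap.coprod ψ), by
      intro x y h
      induction h with
      | one => simp
      | mul a b => simp
      | smul a X => simp [hsmul]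
      | lie X Y => simp [hlie]
      | anchor X a => simp [← hanchor]⟩

theorem lift_base (φ : A →ₐ[k] R) (ψ : L →ₗ[k] R) (hsmul hlie hanchor) (a : A) :
    lift φ ψ hsmul hlie hanchor (base k A L a) = φ a := by
  change RingQuot.liftAlgHom k _ (RingQuot.mkAlgHom k _ _) = _
  rw [RingQuot.liftAlgHom_mkAlgHom_apply]
  simp

theorem lift_gen (φ : A →ₐ[k] R) (ψ : L →ₗ[k] R) (hsmul hlie hanchor) (X : L) :
    lift φ ψ hsmul hlie hanchor (gen k A L X) = ψ X := by
  change RingQuot.liftAlgHom k _ (RingQuot.mkAlgHom k _ _) = _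
  rw [RingQuot.liftAlgHom_mkAlgHom_apply]
  simp

/-- The universal property: uniqueness of the induced algebra morphism. -/
theorem hom_ext {f f' : Env k A L →ₐ[k] R} (h₁ : ∀ a, f (base k A L a) = f' (base k A L a))
    (h₂ : ∀ X, f (gen k A L X) = f' (gen k A L X)) : f = f' := by
  apply RingQuot.ringQuot_ext'
  apply TensorAlgebra.hom_ext
  apply LinearMap.prod_ext
  · ext a
    exact h₁ a
  · ext X
    exact h₂ X

/-- Induction along left multiplication by generators. -/
theorem induction_left {p : Env k A L → Prop} (one : p 1)
    (add : ∀ u v, p u → p v → p (u + v)) (base_mul : ∀ a u, p u → p (base k A L a * u))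
    (gen_mul : ∀ X u, p u → p (gen k A L X * u)) (u : Env k A L) : p u := by
  have key : ∀ (t : TensorAlgebra k (A × L)) (v : Env k A L), p v → p (mk k A L t * v) := by
    intro t
    induction t using TensorAlgebra.induction with
    | algebraMap r =>
      intro v hv
      have h : mk k A L (algebraMap k _ r) = base k A L (algebraMap k A r) := by simp
      rw [h]
      exact base_mul _ _ hv
    | ι x =>
      intro v hv
      have h : mk k A L (TensorAlgebra.ι k x) = base k A L x.1 + gen k A L x.2 := by
        change _ = mk k A L (TensorAlgebra.ι k (x.1, 0)) + mk k A L (TensorAlgebra.ι k (0, x.2))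
        rw [← map_add, ← map_add]
        simp
      rw [h, add_mul]
      exact add _ _ (base_mul _ _ hv) (gen_mul _ _ hv)
    | mul x y hx hy =>
      intro v hv
      rw [map_mul, mul_assoc]
      exact hx _ (hy _ hv)
    | add x y hx hy =>
      intro v hv
      rw [map_add, add_mul]
      exact add _ _ (hx _ hv) (hy _ hv)
  obtain ⟨t, rfl⟩ := RingQuot.mkAlgHom_surjective k (EnvRel k A L) u
  have := key t 1 one
  rwa [mul_one] at this

/-- The left `A`-module structure `a • u = ι_A(a) u`. For `𝒰_A(L)`, source and target maps both
equal `ι_A`, and this is the structure used on both sides of the coproduct. -/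
instance : Module A (Env k A L) := Module.compHom _ (base k A L).toRingHom

theorem smul_def (a : A) (u : Env k A L) : a • u = base k A L a * u := rfl

instance : IsScalarTower A (Env k A L) (Env k A L) :=
  ⟨fun a u v => by simp only [smul_eq_mul, smul_def, mul_assoc]⟩

instance : IsScalarTower k A (Env k A L) :=
  ⟨fun c a u => by simp only [smul_def, map_smul, smul_mul_assoc]⟩

instance : SMulCommClass A k (Env k A L) :=
  ⟨fun a c u => by simp only [smul_def, mul_smul_comm]⟩

/-- The right `A`-module structure `u · a = u ι_A(a)`, as a module over the opposite ring. -/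
instance : Module Aᵐᵒᵖ (Env k A L) :=
  Module.compHom _ (RingHom.op (base k A L).toRingHom)

theorem op_smul_def (a : Aᵐᵒᵖ) (u : Env k A L) : a • u = u * base k A L a.unop := rfl

instance : SMulCommClass Aᵐᵒᵖ A (Env k A L) :=
  ⟨fun a b u => by simp only [smul_def, op_smul_def, mul_assoc]⟩

variable (k A L) in
/-- A copy of `𝒰_A(L)` on which `Aᵐᵒᵖ` acts by left multiplication `u ↦ ι_A(a) u`. -/
def LeftOp : Type (max uk uA uL) := Env k A L

instance : AddCommGroup (LeftOp k A L) := inferInstanceAs (AddCommGroup (Env k A L))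

instance : Module Aᵐᵒᵖ (LeftOp k A L) :=
  Module.compHom (Env k A L) ((base k A L).toRingHom.comp (RingEquiv.toOpposite A).symm.toRingHom)

/-- The identity map to the copy. -/
def toLeftOp : Env k A L ≃+ LeftOp k A L := AddEquiv.refl _

theorem smul_toLeftOp (a : Aᵐᵒᵖ) (u : Env k A L) :
    a • toLeftOp u = toLeftOp (base k A L a.unop * u) := rfl

/-- Right multiplication by `v`, as a left `A`-linear map. -/
def mulRight (v : Env k A L) : Env k A L →ₗ[A] Env k A L where
  toFun u := u * v
  map_add' x y := add_mul x y v
  map_smul' a x := smul_mul_assoc a x v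

@[simp] theorem mulRight_apply (u v : Env k A L) : mulRight v u = u * v := rfl

/-- If the anchor of `L` is zero then `ι_A(A)` is central, so that the left and right `A`-module
structures of the enveloping algebra agree. -/
theorem base_central (h : ∀ (X : L) (a : A), ⁅X, a⁆ = 0) (a : A) (u : Env k A L) :
    u * base k A L a = base k A L a * u := by
  induction u using induction_left with
  | one => simp
  | add u v hu hv => rw [add_mul, mul_add, hu, hv]
  | base_mul b u hu => rw [mul_assoc, hu, ← mul_assoc, ← mul_assoc, ← map_mul, ← map_mul, mul_comm]
  | gen_mul X u hu =>
    have := gen_mul_base k X a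
    rw [h, map_zero, add_zero] at this
    rw [mul_assoc, hu, ← mul_assoc, this, mul_assoc]

end Env
end Env

/-! ## Functoriality -/

section Functor

variable {k : Type uk} {A : Type uA} {L : Type uL} {M : Type uM}
variable [Field k] [CommRing A] [Algebra k A]
variable [LieRing L] [LieAlgebra k L] [Module A L] [LieRingModule L A]
variable [LieRing M] [LieAlgebra k M] [Module A M] [LieRingModule M A]

/-- The `A`-linear map underlying a morphism of Lie-Rinehart algebras over `A`. -/
def homLin (f : L →ₗ⁅AlgHom.id k A⁆ M) : L →ₗ[A] M where
  toFun := f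
  map_add' := f.map_add'
  map_smul' := f.map_smul_apply

/-- The algebra morphism `𝒰_A(f)`. -/
def Env.map (f : L →ₗ⁅AlgHom.id k A⁆ M) : Env k A L →ₐ[k] Env k A M :=
  Env.lift (Env.base k A M) (Env.gen k A M ∘ₗ (f.toLieHom : L →ₗ[k] M))
    (fun a X => by
      change Env.gen k A M (f (a • X)) = _ * Env.gen k A M (f X)
      rw [f.map_smul_apply]
      exact Env.gen_smul k a _)
    (fun X Y => by
      change Env.gen k A M (f.toLieHom ⁅X, Y⁆) = _
      rw [LieHom.map_lie]
      exact Env.gen_lie k _ _)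
    (fun X a => by
      change Env.gen k A M (f X) * _ - _ * Env.gen k A M (f X) = _
      have h : ⁅X, a⁆ = ⁅f X, a⁆ := f.apply_lie a X
      rw [Env.gen_mul_base, add_sub_cancel_left, h])

/-- `𝒰_A(f)` as a left `A`-linear map. -/
def Env.mapLin (f : L →ₗ⁅AlgHom.id k A⁆ M) : Env k A L →ₗ[A] Env k A M where
  toFun := Env.map f
  map_add' := map_add _
  map_smul' a u := by
    rw [Env.smul_def, map_mul, RingHom.id_apply, Env.smul_def]
    congr 1
    exact Env.lift_base _ _ _ _ _ a

end Functor

/-! ## The left bialgebroid structure -/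

section Bialgebroid

set_option linter.unusedSectionVars false

variable {k : Type uk} {A : Type uA} {L : Type uL}
variable [Field k] [CommRing A] [Algebra k A]
variable [LieRing L] [LieAlgebra k L] [Module A L] [LieRingModule L A] [LieRinehartRing A L]
variable [LieRinehartAlgebra k A L]

namespace Env

variable (k A L) in
/-- The action of `𝒰_A(L)` on `A` given by the anchor and by multiplication. -/
def actBase : Env k A L →ₐ[k] Module.End k A :=
  lift (Algebra.lmul k A) (LieModule.toEnd k L A : L →ₗ[k] Module.End k A)
    (fun a X => by ext b; simp)
    (fun X Y => by ext b; simp)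
    (fun X a => by ext b; simp)

theorem actBase_base (a b : A) : actBase k A L (base k A L a) b = a * b := by
  simp [actBase, lift_base]

theorem actBase_gen (X : L) (b : A) : actBase k A L (gen k A L X) b = ⁅X, b⁆ := by
  simp [actBase, lift_gen]

variable (k A L) in
/-- The counit: the left `A`-linear map with `ε(1) = 1` and `ε(uX) = 0` for `X ∈ L`
(equivalently, `ε(X₁ ⋯ Xₙ) = 0` for `n ≥ 1`), defined by letting `u` act on `1 ∈ A`. -/
def counit : Env k A L →ₗ[A] A where
  toFun u := actBase k A L u 1
  map_add' u v := by simp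
  map_smul' a u := by simp [smul_def, actBase_base]

theorem counit_one : counit k A L 1 = 1 := by
  simp [counit]

theorem counit_mul_gen (u : Env k A L) (X : L) : counit k A L (u * gen k A L X) = 0 := by
  have h : ⁅X, (1 : A)⁆ = 0 := by
    have := LieRinehartRing.leibniz_mul_right X (1 : A) 1
    simpa using this
  simp [counit, actBase_gen, h]

/-- The operator `X ⊗ 1 + 1 ⊗ X` on `𝒰_A(L) ⊗_A 𝒰_A(L)`. -/
def primOp (X : L) : Env k A L ⊗[A] Env k A L →+ Env k A L ⊗[A] Env k A L :=
  TensorProduct.liftAddHom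
    { toFun := fun u =>
        { toFun := fun v => (gen k A L X * u) ⊗ₜ v + u ⊗ₜ (gen k A L X * v)
          map_zero' := by simp
          map_add' := fun v w => by simp only [mul_add, TensorProduct.tmul_add]; abel }
      map_zero' := by ext; simp
      map_add' := fun u u' => by
        ext v
        simp only [mul_add, TensorProduct.add_tmul, AddMonoidHom.coe_mk, ZeroHom.coe_mk,
          AddMonoidHom.add_apply]
        abel }
    (fun a u v => by
      simp only [AddMonoidHom.coe_mk, ZeroHom.coe_mk, smul_def]
      rw [← mul_assoc, ← mul_assoc, gen_mul_base, add_mul, add_mul, mul_assoc, mul_assoc,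
        ← smul_def a (gen k A L X * u), ← smul_def a u, ← smul_def a v,
        ← smul_def a (gen k A L X * v), ← smul_def ⁅X, a⁆ u, ← smul_def ⁅X, a⁆ v]
      simp only [TensorProduct.tmul_add, TensorProduct.add_tmul, TensorProduct.smul_tmul]
      abel)

@[simp] theorem primOp_tmul (X : L) (u v : Env k A L) :
    primOp X (u ⊗ₜ[A] v) = (gen k A L X * u) ⊗ₜ v + u ⊗ₜ (gen k A L X * v) := rfl

theorem primOp_smul (X : L) (a : A) (t : Env k A L ⊗[A] Env k A L) :
    primOp X (a • t) = a • primOp X t + ⁅X, a⁆ • t := by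
  induction t with
  | zero => simp
  | add x y hx hy => rw [smul_add, map_add, hx, hy, map_add, smul_add, smul_add]; abel
  | tmul u v =>
    rw [TensorProduct.smul_tmul', primOp_tmul, primOp_tmul, smul_add, smul_def, ← mul_assoc,
      gen_mul_base, add_mul, mul_assoc, ← smul_def, ← smul_def, ← smul_def,
      TensorProduct.add_tmul]
    simp only [TensorProduct.smul_tmul']
    abel

variable (k A L) in
/-- `X ↦ X ⊗ 1 + 1 ⊗ X` as a `k`-linear map to endomorphisms. -/
def primLin : L →ₗ[k] Module.End k (Env k A L ⊗[A] Env k A L) where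
  toFun X :=
    { toFun := primOp X
      map_add' := map_add _
      map_smul' := fun c t => by
        induction t with
        | zero => simp
        | add x y hx hy => rw [smul_add, map_add, map_add, hx, hy, smul_add]
        | tmul u v => simp [TensorProduct.smul_tmul', smul_add] }
  map_add' X Y := by
    refine LinearMap.ext fun t => ?_
    change primOp (X + Y) t = primOp X t + primOp Y t
    induction t with
    | zero => simp
    | add x y hx hy => rw [map_add, map_add, map_add, hx, hy]; abel
    | tmul u v =>
      simp only [primOp_tmul, map_add, add_mul, TensorProduct.add_tmul, TensorProduct.tmul_add]
      abel
  map_smul' c X := by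
    refine LinearMap.ext fun t => ?_
    change primOp (c • X) t = c • primOp X t
    induction t with
    | zero => simp
    | add x y hx hy => rw [map_add, map_add, hx, hy, smul_add]
    | tmul u v => simp [TensorProduct.smul_tmul', smul_add]

theorem primOp_smul_left (a : A) (X : L) (t : Env k A L ⊗[A] Env k A L) :
    primOp (a • X) t = a • primOp X t := by
  induction t with
  | zero => simp
  | add x y hx hy => rw [map_add, map_add, hx, hy, smul_add]
  | tmul u v =>
    simp only [primOp_tmul, gen_smul, ← smul_def, smul_mul_assoc, smul_add,
      TensorProduct.tmul_smul]
    rw [TensorProduct.smul_tmul', TensorProduct.smul_tmul']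

theorem primOp_lie (X Y : L) (t : Env k A L ⊗[A] Env k A L) :
    primOp ⁅X, Y⁆ t = primOp X (primOp Y t) - primOp Y (primOp X t) := by
  induction t with
  | zero => simp
  | add x y hx hy => simp only [map_add, hx, hy]; abel
  | tmul u v =>
    simp only [primOp_tmul, gen_lie, sub_mul, map_add, mul_assoc, TensorProduct.sub_tmul,
      TensorProduct.tmul_sub]
    abel

variable (k A L) in
/-- The tensor product action of `𝒰_A(L)` on `𝒰_A(L) ⊗_A 𝒰_A(L)`, in which `a ∈ A` acts by scalar
multiplication and `X ∈ L` by `X ⊗ 1 + 1 ⊗ X`. -/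
def actTensor : Env k A L →ₐ[k] Module.End k (Env k A L ⊗[A] Env k A L) :=
  lift (R := Module.End k (Env k A L ⊗[A] Env k A L))
    (Algebra.lsmul k k (Env k A L ⊗[A] Env k A L)) (primLin k A L)
    (fun a X => LinearMap.ext (primOp_smul_left a X))
    (fun X Y => LinearMap.ext (primOp_lie X Y))
    (fun X a => LinearMap.ext fun t => by
      change primOp X (a • t) - a • primOp X t = ⁅X, a⁆ • t
      rw [primOp_smul, add_sub_cancel_left])

theorem actTensor_base (a : A) (t : Env k A L ⊗[A] Env k A L) :
    actTensor k A L (base k A L a) t = a • t := by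
  rw [actTensor, lift_base]; rfl

theorem actTensor_gen (X : L) (t : Env k A L ⊗[A] Env k A L) :
    actTensor k A L (gen k A L X) t = primOp X t := by
  rw [actTensor, lift_gen]; rfl

variable (k A L) in
/-- The coproduct `Δ : 𝒰_A(L) → 𝒰_A(L) ⊗_A 𝒰_A(L)`, defined by letting `u` act on `1 ⊗ 1`. It is
determined by `comul_one`, `A`-linearity and `comul_gen_mul`; in particular
`Δ(a) = a ⊗ 1` and `Δ(X) = X ⊗ 1 + 1 ⊗ X`. -/
def comul : Env k A L →ₗ[A] Env k A L ⊗[A] Env k A L where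
  toFun u := actTensor k A L u (1 ⊗ₜ 1)
  map_add' u v := by simp
  map_smul' a u := by
    simp [smul_def, actTensor_base]

theorem comul_one : comul k A L 1 = 1 ⊗ₜ 1 := by
  simp [comul]

theorem comul_gen_mul (X : L) (u : Env k A L) :
    comul k A L (gen k A L X * u) = primOp X (comul k A L u) := by
  simp [comul, actTensor_gen]

theorem comul_base_mul (a : A) (u : Env k A L) :
    comul k A L (base k A L a * u) = a • comul k A L u := by
  rw [← smul_def, map_smul]

/-- `Δ(X) = X ⊗ 1 + 1 ⊗ X`. -/
theorem comul_gen (X : L) :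
    comul k A L (gen k A L X) = gen k A L X ⊗ₜ 1 + 1 ⊗ₜ gen k A L X := by
  have := comul_gen_mul (k := k) (A := A) X 1
  simpa [comul_one] using this

/-- `Δ(u a) = u₁ ⊗ u₂ a`. -/
theorem comul_mul_base (u : Env k A L) (a : A) :
    comul k A L (u * base k A L a) =
      (mulRight (base k A L a)).lTensor (Env k A L) (comul k A L u) := by
  induction u using induction_left with
  | one =>
    have := comul_base_mul (k := k) (L := L) a 1
    rw [mul_one, comul_one, TensorProduct.smul_tmul', TensorProduct.smul_tmul, smul_def,
      mul_one] at this
    rw [one_mul, this, comul_one]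
    simp
  | add u v hu hv => rw [add_mul, map_add, map_add, map_add, hu, hv]
  | base_mul b u hu => rw [mul_assoc, comul_base_mul, comul_base_mul, hu, map_smul]
  | gen_mul X u hu =>
    rw [mul_assoc, comul_gen_mul, comul_gen_mul, hu]
    generalize comul k A L u = t
    induction t with
    | zero => simp
    | add x y hx hy => simp only [map_add, hx, hy]
    | tmul x y => simp [mul_assoc]

/-- The iterated coproduct `u ↦ u₁ ⊗ u₂ ⊗ u₃`. -/
def comul₃ : Env k A L →ₗ[A] Env k A L ⊗[A] (Env k A L ⊗[A] Env k A L) :=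
  (comul k A L).lTensor (Env k A L) ∘ₗ comul k A L

variable (k A L) in
/-- The tensor product `𝒰_A(L) ⊗_{Aᵒᵖ} 𝒰_A(L)` on which `u a ⊗ v = u ⊗ a v`. It is an `A`-module
through left multiplication on the first factor. -/
abbrev OpTensor : Type (max uk uA uL) := Env k A L ⊗[Aᵐᵒᵖ] LeftOp k A L

/-- The map `u ↦ u ⊗ v` to `𝒰_A(L) ⊗_{Aᵒᵖ} 𝒰_A(L)`. -/
def opTmul (v : Env k A L) : Env k A L →ₗ[A] OpTensor k A L where
  toFun u := u ⊗ₜ toLeftOp v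
  map_add' x y := TensorProduct.add_tmul x y _
  map_smul' a x := by rw [RingHom.id_apply, TensorProduct.smul_tmul']

variable (k A L) in
/-- The additive map underlying the Hopf-Galois map. -/
def galoisAdd : OpTensor k A L →+ Env k A L ⊗[A] Env k A L :=
  TensorProduct.liftAddHom
    { toFun := fun u =>
        { toFun := fun v =>
            (mulRight (toLeftOp.symm v)).lTensor (Env k A L) (comul k A L u)
          map_zero' := by
            have h : mulRight (toLeftOp.symm (0 : LeftOp k A L)) = 0 := by
              ext; simp
            rw [h]; simp
          map_add' := fun v w => by
            have h : mulRight (toLeftOp.symm (v + w : LeftOp k A L)) =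
                mulRight (toLeftOp.symm v) + mulRight (toLeftOp.symm w) := by
              ext; simp [mul_add]
            rw [h, LinearMap.lTensor_add]; rfl }
      map_zero' := by ext; simp
      map_add' := fun u u' => by ext v; simp }
    (fun a u v => by
      simp only [AddMonoidHom.coe_mk, ZeroHom.coe_mk, op_smul_def, comul_mul_base]
      rw [← LinearMap.comp_apply, ← LinearMap.lTensor_comp]
      congr 2
      ext x
      obtain ⟨v, rfl⟩ := toLeftOp.surjective v
      rw [smul_toLeftOp]
      simp [mul_assoc])

theorem galoisAdd_tmul (u v : Env k A L) : galoisAdd k A L (u ⊗ₜ toLeftOp v) =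
    (mulRight v).lTensor (Env k A L) (comul k A L u) := rfl

variable (k A L) in
/-- The Hopf-Galois map `β(u ⊗ v) = u₁ ⊗ u₂ v`. -/
def galois : OpTensor k A L →ₗ[A] Env k A L ⊗[A] Env k A L where
  toFun := galoisAdd k A L
  map_add' := map_add _
  map_smul' a t := by
    refine TensorProduct.induction_on t ?_ ?_ ?_
    · simp
    · intro u v
      obtain ⟨v, rfl⟩ := toLeftOp.surjective v
      rw [TensorProduct.smul_tmul', galoisAdd_tmul, map_smul, map_smul, galoisAdd_tmul]
      rfl
    · intro x y hx hy
      rw [smul_add, map_add, hx, hy, map_add, smul_add]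

open Classical in
variable (k A L) in
/-- The translation map `ξ(u) = u₊ ⊗ u₋ = β⁻¹(u ⊗ 1)`. (The value `0` when `β` is not bijective is
never taken, since `𝒰_A(L)` is a left Hopf algebroid.) -/
def translation : Env k A L →ₗ[A] OpTensor k A L :=
  if h : Function.Bijective (galois k A L) then
    ((LinearEquiv.ofBijective (galois k A L) h).symm : _ →ₗ[A] _) ∘ₗ
      (TensorProduct.mk A (Env k A L) (Env k A L)).flip 1
  else 0

variable (k A L) in
/-- The map `x ⊗ y ↦ ε(y) x`. -/
def idCounit : Env k A L ⊗[A] Env k A L →ₗ[A] Env k A L :=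
  (TensorProduct.rid A (Env k A L) : _ →ₗ[A] _) ∘ₗ (counit k A L).lTensor (Env k A L)

variable (k A L) in
/-- The Sweedler-Takeuchi product `𝒰_A(L) ×_A 𝒰_A(L)`: the `t` in `𝒰_A(L) ⊗_A 𝒰_A(L)` with
`∑ xᵢ a ⊗ yᵢ = ∑ xᵢ ⊗ yᵢ a` for all `a ∈ A`, where `t = ∑ xᵢ ⊗ yᵢ`. -/
def takeuchi : Set (Env k A L ⊗[A] Env k A L) :=
  {t | ∀ a : A, (mulRight (base k A L a)).rTensor (Env k A L) t =
    (mulRight (base k A L a)).lTensor (Env k A L) t}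

end Env
end Bialgebroid

/-! ## Symmetrisation -/

/-- A dual (projective) basis `{χᵢ, φᵢ}` of an `A`-module: each `φᵢ` is the `i`-th component of
`coord`, and `x = ∑ φᵢ(x) χᵢ` with finitely many nonzero terms. -/
structure DualBasis (A : Type uA) (M : Type uM) [CommRing A] [AddCommGroup M] [Module A M] where
  /-- the index set -/
  I : Type uI
  /-- the generators `χᵢ` -/
  vec : I → M
  /-- the family of forms `φᵢ` -/
  coord : M →ₗ[A] I →₀ A
  sum_coord : ∀ x, Finsupp.linearCombination A vec (coord x) = x

/-- The dual basis `{π(χᵢ), φᵢ ∘ γ}` induced by a split surjection `π` with section `γ`. -/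
def DualBasis.push {A : Type uA} {M : Type uM} {N : Type uN} [CommRing A] [AddCommGroup M]
    [Module A M] [AddCommGroup N] [Module A N] (D : DualBasis.{uA, uM, uI} A M) (π : M →ₗ[A] N)
    (γ : N →ₗ[A] M) (hγ : ∀ x, π (γ x) = x) : DualBasis.{uA, uN, uI} A N where
  I := D.I
  vec i := π (D.vec i)
  coord := D.coord ∘ₗ γ
  sum_coord x := by
    have h := congrArg π (D.sum_coord (γ x))
    rw [hγ, Finsupp.apply_linearCombination] at h
    exact h

section Symmetrisation

variable (k : Type uk) {A : Type uA} {L : Type uL}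
variable [Field k] [CommRing A] [Algebra k A]
variable [LieRing L] [LieAlgebra k L] [Module A L] [LieRingModule L A]

/-- The symmetrised product `1/m! ∑_σ x_{σ(1)} ⋯ x_{σ(m)}`. -/
def symProd {m : ℕ} {R : Type uR} [Ring R] [Algebra k R] (x : Fin m → R) : R :=
  (m.factorial : k)⁻¹ • ∑ σ : Equiv.Perm (Fin m), (List.ofFn fun i => x (σ i)).prod

/-- The symmetrised product of the generators `χᵢ` in a monomial. -/
def symMonomial (D : DualBasis.{uA, uL, uI} A L) (s : D.I →₀ ℕ) : Env k A L :=
  symProd k fun i => Env.gen k A L (D.vec ((Finsupp.toMultiset s).toList.get i))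

/-- The symmetrisation map `S : 𝒮_A(L) → 𝒰_A(L)` attached to a dual basis `{χᵢ, φᵢ}` of `L`: the
algebra map `X ↦ ∑ φᵢ(X) xᵢ` to polynomials, followed by the `A`-linear map which sends a monomial
`x_{j₁} ⋯ x_{jₘ}` to the symmetrised product of `χ_{j₁}, …, χ_{jₘ}`. See `symmetrisation_prod` for
the explicit formula. -/
def symmetrisation (D : DualBasis.{uA, uL, uI} A L) : SymmetricAlgebra A L →ₗ[A] Env k A L :=
  (MvPolynomial.basisMonomials D.I A).constr A (symMonomial k D) ∘ₗ
    (SymmetricAlgebra.lift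
      (Finsupp.linearCombination A (MvPolynomial.X : D.I → MvPolynomial D.I A) ∘ₗ
        D.coord)).toLinearMap

theorem symProd_comp_equiv {m m' : ℕ} {R : Type uR} [Ring R] [Algebra k R] (x : Fin m → R)
    (e : Fin m' ≃ Fin m) : symProd k (x ∘ e) = symProd k x := by
  have h : m' = m := by simpa using Fintype.card_congr e
  subst h
  unfold symProd
  congr 1
  exact Fintype.sum_equiv (Equiv.mulLeft e) _ _ (fun σ => rfl)

theorem symMonomial_sum (D : DualBasis.{uA, uL, uI} A L) {m : ℕ} (j : Fin m → D.I) :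
    symMonomial k D (∑ i, Finsupp.single (j i) 1) =
      symProd k fun i => Env.gen k A L (D.vec (j i)) := by
  classical
  have hl : (List.ofFn j).Perm (Finsupp.toMultiset (∑ i, Finsupp.single (j i) 1)).toList := by
    rw [← Multiset.coe_eq_coe, Multiset.coe_toList, map_sum]
    simp only [Finsupp.toMultiset_single, one_smul]
    rw [List.ofFn_eq_map, ← Multiset.map_coe, Finset.sum_eq_multiset_sum]
    change Multiset.map j (Finset.univ : Finset (Fin m)).val = _
    generalize (Finset.univ : Finset (Fin m)).val = s
    induction s using Multiset.induction with
    | empty => simp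
    | cons a s hs => simp [hs, ← Multiset.singleton_add]
  unfold symMonomial
  generalize (Finsupp.toMultiset (∑ i, Finsupp.single (j i) 1)).toList = l at hl
  have hlen : m = (List.ofFn j).length := by simp
  have hb : Function.Bijective hl.idxBij :=
    ⟨hl.idxBij_injective, hl.idxBij_surjective⟩
  let e : Fin m ≃ Fin l.length := (finCongr hlen).trans (Equiv.ofBijective _ hb)
  rw [← symProd_comp_equiv k _ e]
  congr 1
  funext i
  have := hl.getElem_idxBij_eq_getElem (finCongr hlen i)
  simp only [Function.comp_apply, List.get_eq_getElem]
  congr 2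
  refine this.trans ?_
  simp

/-- The explicit formula `S(X₁ ⋯ Xₘ) = 1/m! ∑_{j, σ} φ_{j₁}(X₁) ⋯ φ_{jₘ}(Xₘ) χ_{j_σ(1)} ⋯ χ_{j_σ(m)}`
for the symmetrisation map. -/
theorem symmetrisation_prod (D : DualBasis.{uA, uL, uI} A L) {m : ℕ} (X : Fin m → L) :
    symmetrisation k D (∏ i, SymmetricAlgebra.ι A L (X i)) =
      ∑ j ∈ Fintype.piFinset fun i => (D.coord (X i)).support,
        (∏ i, D.coord (X i) (j i)) • (m.factorial : k)⁻¹ •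
          ∑ σ : Equiv.Perm (Fin m), (List.ofFn fun i => Env.gen k A L (D.vec (j (σ i)))).prod := by
  have h : ∀ i, Finsupp.linearCombination A (MvPolynomial.X : D.I → MvPolynomial D.I A)
      (D.coord (X i)) = ∑ c ∈ (D.coord (X i)).support,
        MvPolynomial.monomial (Finsupp.single c 1) (D.coord (X i) c) := by
    intro i
    rw [Finsupp.linearCombination_apply, Finsupp.sum]
    refine Finset.sum_congr rfl fun c _ => ?_
    simp [MvPolynomial.X, MvPolynomial.smul_monomial]
  unfold symmetrisation
  simp only [LinearMap.comp_apply, AlgHom.toLinearMap_apply, map_prod,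
    SymmetricAlgebra.lift_ι_apply, h]
  rw [Finset.prod_univ_sum, map_sum]
  refine Finset.sum_congr rfl fun j _ => ?_
  rw [← MvPolynomial.monomial_sum_prod, ← mul_one (∏ i, D.coord (X i) (j i)), ← smul_eq_mul,
    ← MvPolynomial.smul_monomial, map_smul]
  have hb : MvPolynomial.monomial (∑ i, Finsupp.single (j i) 1) (1 : A) =
    MvPolynomial.basisMonomials D.I A (∑ i, Finsupp.single (j i) 1) := by simp
  rw [hb, Module.Basis.constr_basis, symMonomial_sum]
  simp [symProd]

end Symmetrisation

/-! ## The coring section induced by a linear section -/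

/-- A representation `x = ∑ xᵢ ⊗ yᵢ` of an element of a tensor product. An expression in Sweedler
notation is stated below for all such representations. -/
structure TensorRep {R : Type uR} {M : Type uM} {N : Type uN} [CommRing R] [AddCommGroup M]
    [Module R M] [AddCommGroup N] [Module R N] (x : M ⊗[R] N) where
  /-- the number of terms -/
  n : ℕ
  /-- the first factors -/
  fst : Fin n → M
  /-- the second factors -/
  snd : Fin n → N
  eq_sum : x = ∑ i, fst i ⊗ₜ[R] snd i

/-- A representation `x = ∑ xᵢ ⊗ yᵢ ⊗ zᵢ` of an element of a triple tensor product. -/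
structure TensorRep₃ {R : Type uR} {M : Type uM} [CommRing R] [AddCommGroup M]
    [Module R M] (x : M ⊗[R] (M ⊗[R] M)) where
  /-- the number of terms -/
  n : ℕ
  /-- the first factors -/
  fst : Fin n → M
  /-- the second factors -/
  snd : Fin n → M
  /-- the third factors -/
  trd : Fin n → M
  eq_sum : x = ∑ i, fst i ⊗ₜ[R] (snd i ⊗ₜ[R] trd i)

section Section

variable {k : Type uk} {A : Type uA} {L : Type uL} {M : Type uM}
variable [Field k] [CommRing A] [Algebra k A]
variable [LieRing L] [LieAlgebra k L] [Module A L] [LieRingModule L A]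
variable [LieRing M] [LieAlgebra k M] [Module A M] [LieRingModule M A]

/-- The algebra map `𝒮_A(γ)` between symmetric algebras. -/
def symMap (γ : M →ₗ[A] L) : SymmetricAlgebra A M →ₐ[A] SymmetricAlgebra A L :=
  SymmetricAlgebra.lift (SymmetricAlgebra.ι A L ∘ₗ γ)

open Classical in
/-- The map `Γ = S_L ∘ 𝒮_A(γ) ∘ S_M⁻¹ : 𝒰_A(M) → 𝒰_A(L)` induced by a linear section `γ` of
`π : L → M`. The symmetrisation maps are those of a dual basis `{χᵢ, φᵢ}` of `L` and of the induced
dual basis `{π(χᵢ), φᵢ ∘ γ}` of `M`. (The value `0` is never taken for projective modules in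
characteristic zero, where `S_M` is bijective.) -/
def coringSection (π : L →ₗ⁅AlgHom.id k A⁆ M) (γ : M →ₗ[A] L) (hγ : ∀ X, homLin π (γ X) = X)
    (D : DualBasis.{uA, uL, uI} A L) : Env k A M →ₗ[A] Env k A L :=
  if h : Function.Bijective (symmetrisation k (D.push (homLin π) γ hγ)) then
    symmetrisation k D ∘ₗ (symMap γ).toLinearMap ∘ₗ
      ((LinearEquiv.ofBijective (symmetrisation k (D.push (homLin π) γ hγ)) h).symm : _ →ₗ[A] _)
  else 0

variable [LieRinehartRing A L] [LieRinehartAlgebra k A L]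
variable [LieRinehartRing A M] [LieRinehartAlgebra k A M]

/-- `Γ` is a unital, left and right `A`-linear morphism of `A`-corings which is a section of
`𝒰_A(π)`. -/
structure IsCoringSection (π : L →ₗ⁅AlgHom.id k A⁆ M) (Γ : Env k A M →ₗ[A] Env k A L) : Prop where
  map_section : ∀ u, Env.map π (Γ u) = u
  comul_comp : Env.comul k A L ∘ₗ Γ = TensorProduct.map Γ Γ ∘ₗ Env.comul k A M
  counit_comp : Env.counit k A L ∘ₗ Γ = Env.counit k A M
  map_one : Γ 1 = 1
  map_mul_base : ∀ u a, Γ (u * Env.base k A M a) = Γ u * Env.base k A L a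

/-- The right `𝒰_A(M)`-coaction `u ↦ u₁ ⊗ 𝒰_A(π)(u₂)` on `𝒰_A(L)`. -/
def envCoaction (π : L →ₗ⁅AlgHom.id k A⁆ M) : Env k A L →ₗ[A] Env k A L ⊗[A] Env k A M :=
  (Env.mapLin π).lTensor (Env k A L) ∘ₗ Env.comul k A L

/-- The left Hopf kernel of `𝒰_A(π)`. -/
def leftHopfKernel (π : L →ₗ⁅AlgHom.id k A⁆ M) : Set (Env k A L) :=
  {u | envCoaction π u = u ⊗ₜ[A] 1}

end Section

/-! ## Measurings, cocycles and crossed products -/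

section Crossed

variable {k : Type uk} {A : Type uA} {L : Type uL} {B : Type uM}
variable [Field k] [CommRing A] [Algebra k A]
variable [LieRing L] [LieAlgebra k L] [Module A L] [LieRingModule L A] [LieRinehartRing A L]
variable [LieRinehartAlgebra k A L]
variable [Ring B] [Algebra k B]

/-- `𝒰_A(L)` measures the `A`-ring `j : A → B` through `act`. -/
structure IsMeasuring (j : A →ₐ[k] B) (act : Env k A L →ₗ[k] B →ₗ[k] B) : Prop where
  bilinear : ∀ a a' u b, act (Env.base k A L a * Env.base k A L a' * u) b = j a * act u b * j a'
  act_one : ∀ u, act u 1 = j (Env.counit k A L u)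
  act_mul : ∀ u b b' (S : TensorRep (Env.comul k A L u)),
    act u (b * b') = ∑ i, act (S.fst i) b * act (S.snd i) b'

/-- `σ` is a `B`-valued Hopf 2-cocycle on `𝒰_A(L)`. The condition `balanced` says that `σ` is
defined on the tensor product over `Aᵒᵖ`. -/
structure IsCocycle (j : A →ₐ[k] B) (act : Env k A L →ₗ[k] B →ₗ[k] B)
    (σ : Env k A L →ₗ[k] Env k A L →ₗ[k] B) : Prop where
  bilinear : ∀ a a' u v,
    σ (Env.base k A L a * Env.base k A L a' * u) v = j a * σ u v * j a'
  balanced : ∀ u a v, σ (u * Env.base k A L a) v = σ u (Env.base k A L a * v)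
  act_base : ∀ u a v (S : TensorRep (Env.comul k A L u)),
    ∑ i, act (S.fst i) (j a) * σ (S.snd i) v = σ u (Env.base k A L a * v)
  one_left : ∀ u, σ 1 u = j (Env.counit k A L u)
  one_right : ∀ u, σ u 1 = j (Env.counit k A L u)
  cocycle : ∀ u v w (S : TensorRep (Env.comul k A L u)) (T : TensorRep (Env.comul k A L v))
    (W : TensorRep (Env.comul k A L w)),
    ∑ i, ∑ j, ∑ l, act (S.fst i) (σ (T.fst j) (W.fst l)) * σ (S.snd i) (T.snd j * W.snd l) =
      ∑ i, ∑ j, σ (S.fst i) (T.fst j) * σ (S.snd i * T.snd j) w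

/-- The two further conditions that make `B` a `σ`-twisted left `𝒰_A(L)`-module. -/
structure IsTwistedModule (act : Env k A L →ₗ[k] B →ₗ[k] B)
    (σ : Env k A L →ₗ[k] Env k A L →ₗ[k] B) : Prop where
  one_act : ∀ b, act 1 b = b
  twisted : ∀ u v b (S : TensorRep (Env.comul k A L u)) (T : TensorRep (Env.comul k A L v)),
    ∑ i, ∑ j, act (S.fst i) (act (T.fst j) b) * σ (S.snd i) (T.snd j) =
      ∑ i, ∑ j, σ (S.fst i) (T.fst j) * act (S.snd i * T.snd j) b

/-- A right `𝒰_A(L)`-comodule algebra: an `A`-ring `j : A → R` with a coassociative and counital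
coaction `δ(r) = r₀ ⊗ r₁` with values in the Sweedler-Takeuchi product `R ×_A 𝒰_A(L)`, which is
multiplicative and unital. -/
structure IsRightComoduleAlgebra [Module A B] (j : A →ₐ[k] B)
    (δ : B →ₗ[A] B ⊗[A] Env k A L) : Prop where
  smul_eq : ∀ (a : A) (r : B), a • r = j a * r
  coassoc : (TensorProduct.assoc A B (Env k A L) (Env k A L) : _ →ₗ[A] _) ∘ₗ
    δ.rTensor (Env k A L) ∘ₗ δ = (Env.comul k A L).lTensor B ∘ₗ δ
  counit : (TensorProduct.rid A B : _ →ₗ[A] _) ∘ₗ (Env.counit k A L).lTensor B ∘ₗ δ = LinearMap.id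
  takeuchi : ∀ r a (S : TensorRep (δ r)),
    ∑ i, (S.fst i * j a) ⊗ₜ[A] S.snd i = ∑ i, S.fst i ⊗ₜ[A] (S.snd i * Env.base k A L a)
  map_one : δ 1 = 1 ⊗ₜ 1
  map_mul : ∀ r r' (S : TensorRep (δ r)) (T : TensorRep (δ r')),
    δ (r * r') = ∑ i, ∑ j, (S.fst i * T.fst j) ⊗ₜ[A] (S.snd i * T.snd j)

end Crossed

section Product

variable {k : Type uk} {A : Type uA} {N : Type uN} {L : Type uL}
variable [Field k] [CommRing A] [Algebra k A]
variable [LieRing N] [LieAlgebra k N] [Module A N] [LieRingModule N A]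
variable [LieRing L] [LieAlgebra k L] [Module A L] [LieRingModule L A] [LieRinehartRing A L]
variable [LieRinehartAlgebra k A L]

/-- The statement that the `σ`-twisted crossed product multiplication
`(b # u)(b' # v) = b (u₁ ▷ b') σ(u₂, v₁) # u₃ v₂` is well defined on `𝒰_A(N) ⊗_A 𝒰_A(L)`, and
associative with unit `1 # 1`; the map `mul` is determined by `mul_tmul`. It is used for `N` with
zero anchor, where the left and right `A`-module structures of `𝒰_A(N)` agree by
`Env.base_central`. -/
structure CrossedProductMul (act : Env k A L →ₗ[k] Env k A N →ₗ[k] Env k A N)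
    (σ : Env k A L →ₗ[k] Env k A L →ₗ[k] Env k A N) where
  /-- the multiplication -/
  mul : Env k A N ⊗[A] Env k A L →ₗ[k] Env k A N ⊗[A] Env k A L →ₗ[k] Env k A N ⊗[A] Env k A L
  mul_tmul : ∀ b u b' v (S : TensorRep₃ (Env.comul₃ (k := k) u))
    (T : TensorRep (Env.comul k A L v)),
    mul (b ⊗ₜ u) (b' ⊗ₜ v) = ∑ i, ∑ j,
      (b * act (S.fst i) b' * σ (S.snd i) (T.fst j)) ⊗ₜ[A] (S.trd i * T.snd j)
  one_mul : ∀ x, mul (1 ⊗ₜ 1) x = x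
  mul_one : ∀ x, mul x (1 ⊗ₜ 1) = x
  mul_assoc : ∀ x y z, mul (mul x y) z = mul x (mul y z)

variable {act : Env k A L →ₗ[k] Env k A N →ₗ[k] Env k A N}
variable {σ : Env k A L →ₗ[k] Env k A L →ₗ[k] Env k A N}

/-- The crossed product `𝒰_A(N) #_σ 𝒰_A(L)`. -/
def CrossedProduct (_P : CrossedProductMul act σ) : Type (max uk uA uN uL) :=
  Env k A N ⊗[A] Env k A L

namespace CrossedProduct

variable (P : CrossedProductMul act σ)

instance : AddCommGroup (CrossedProduct P) :=
  inferInstanceAs (AddCommGroup (Env k A N ⊗[A] Env k A L))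

instance : Module A (CrossedProduct P) :=
  inferInstanceAs (Module A (Env k A N ⊗[A] Env k A L))

instance : Module k (CrossedProduct P) :=
  inferInstanceAs (Module k (Env k A N ⊗[A] Env k A L))

instance : Ring (CrossedProduct P) where
  __ := (inferInstance : AddCommGroup (CrossedProduct P))
  mul x y := P.mul x y
  one := (1 : Env k A N) ⊗ₜ[A] (1 : Env k A L)
  left_distrib x y z := map_add (P.mul x) y z
  right_distrib x y z := LinearMap.map_add₂ P.mul x y z
  zero_mul x := LinearMap.map_zero₂ P.mul x
  mul_zero x := map_zero (P.mul x)
  mul_assoc := P.mul_assoc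
  one_mul := P.one_mul
  mul_one := P.mul_one

instance : Algebra k (CrossedProduct P) :=
  Algebra.ofModule (fun r x y => LinearMap.map_smul₂ P.mul r x y)
    (fun r x y => map_smul (P.mul x) r y)

/-- The underlying `A`-module of the crossed product. -/
def equiv : Env k A N ⊗[A] Env k A L ≃ₗ[A] CrossedProduct P := LinearEquiv.refl A _

/-- The element `b # u` of the crossed product. -/
def tmul (b : Env k A N) (u : Env k A L) : CrossedProduct P := equiv P (b ⊗ₜ u)

/-- The right `𝒰_A(L)`-coaction `b # u ↦ (b # u₁) ⊗ u₂`. -/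
def coaction : CrossedProduct P →ₗ[A] CrossedProduct P ⊗[A] Env k A L :=
  (equiv P).toLinearMap.rTensor (Env k A L) ∘ₗ
    (TensorProduct.assoc A (Env k A N) (Env k A L) (Env k A L)).symm.toLinearMap ∘ₗ
      (Env.comul k A L).lTensor (Env k A N) ∘ₗ (equiv P).symm.toLinearMap

theorem coaction_tmul (b : Env k A N) (u : Env k A L) (S : TensorRep (Env.comul k A L u)) :
    coaction P (tmul P b u) = ∑ i, tmul P b (S.fst i) ⊗ₜ[A] S.snd i := by
  simp [coaction, tmul, S.eq_sum, TensorProduct.tmul_sum]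

theorem tmul_mul_tmul (b b' : Env k A N) (u v : Env k A L)
    (S : TensorRep₃ (Env.comul₃ (k := k) u)) (T : TensorRep (Env.comul k A L v)) :
    tmul P b u * tmul P b' v = ∑ i, ∑ j,
      tmul P (b * act (S.fst i) b' * σ (S.snd i) (T.fst j)) (S.trd i * T.snd j) :=
  P.mul_tmul b u b' v S T

end CrossedProduct

end Product

/-- The kernel of a morphism of Lie-Rinehart algebras over `A` has zero anchor. -/
theorem anchor_eq_zero {k : Type uk} {A : Type uA} {N : Type uN} {L : Type uL} {M : Type uM}
    [Field k] [CommRing A] [Algebra k A]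
    [LieRing N] [LieAlgebra k N] [Module A N] [LieRingModule N A]
    [LieRing L] [LieAlgebra k L] [Module A L] [LieRingModule L A]
    [LieRing M] [LieAlgebra k M] [Module A M] [LieRingModule M A]
    (ι : N →ₗ⁅AlgHom.id k A⁆ L) (π : L →ₗ⁅AlgHom.id k A⁆ M) (hex : Function.Exact ι π)
    (X : N) (a : A) : ⁅X, a⁆ = 0 := by
  have h₁ : ⁅X, a⁆ = ⁅ι X, a⁆ := ι.apply_lie a X
  have h₂ : ⁅ι X, a⁆ = ⁅π (ι X), a⁆ := π.apply_lie a (ι X)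
  rw [h₁, h₂, hex.apply_apply_eq_zero, zero_lie]

/-! ## The weak action and the cocycle of a coring section -/

section Cleft

variable {k : Type uk} {A : Type uA} {L : Type uL} {M : Type uM}
variable [Field k] [CommRing A] [Algebra k A]
variable [LieRing L] [LieAlgebra k L] [Module A L] [LieRingModule L A] [LieRinehartRing A L]
variable [LieRinehartAlgebra k A L]
variable [LieRing M] [LieAlgebra k M] [Module A M] [LieRingModule M A] [LieRinehartRing A M]
variable [LieRinehartAlgebra k A M]

/-- The element `Γ(v₁)Γ(w₁) ⊗ Γ(v₂w₂)₊ ⊗ Γ(v₂w₂)₋` of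
`𝒰_A(L) ⊗_A (𝒰_A(L) ⊗_{Aᵒᵖ} 𝒰_A(L))`, computed from representations of `Δ(v)` and `Δ(w)`. -/
def cocycleTensor (Γ : Env k A M →ₗ[A] Env k A L) {v w : Env k A M}
    (S : TensorRep (Env.comul k A M v)) (T : TensorRep (Env.comul k A M w)) :
    Env k A L ⊗[A] Env.OpTensor k A L :=
  ∑ i, ∑ j, (Γ (S.fst i) * Γ (T.fst j)) ⊗ₜ[A] Env.translation k A L (Γ (S.snd i * T.snd j))

/-- A representation of an element `E` of `𝒰_A(L) ⊗_A 𝒰_A(L) ⊗_{Aᵒᵖ} 𝒰_A(L)` in the form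
`E = ∑ tᵢ ⊗ qᵢ` with `tᵢ` in the Sweedler-Takeuchi product `𝒰_A(L) ×_A 𝒰_A(L)`. -/
structure TakeuchiRep (E : Env k A L ⊗[A] Env.OpTensor k A L) where
  /-- the number of terms -/
  n : ℕ
  /-- the factors in the Sweedler-Takeuchi product -/
  t : Fin n → Env k A L ⊗[A] Env k A L
  /-- the last factors -/
  q : Fin n → Env k A L
  mem : ∀ i, t i ∈ Env.takeuchi k A L
  eq_sum : E = ∑ i, (Env.opTmul (q i)).lTensor (Env k A L) (t i)

/-- The value at `E = ∑ x ⊗ y ⊗ q` of the map `x ⊗ y ⊗ q ↦ ε(y) x q`, which is defined on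
`(𝒰_A(L) ×_A 𝒰_A(L)) ⊗_{Aᵒᵖ} 𝒰_A(L)`. -/
def TakeuchiRep.value {E : Env k A L ⊗[A] Env.OpTensor k A L} (R : TakeuchiRep E) : Env k A L :=
  ∑ i, Env.idCounit k A L (R.t i) * R.q i

variable {N : Type uN}
variable [LieRing N] [LieAlgebra k N] [Module A N] [LieRingModule N A]

/-- `act` is the weak action `v ▷ b = Γ(v)₊ b Γ(v)₋`, where `𝒰_A(N)` is mapped to `𝒰_A(L)` by
`𝒰_A(ι)`. -/
def IsWeakAdjoint (ι : N →ₗ⁅AlgHom.id k A⁆ L) (Γ : Env k A M →ₗ[A] Env k A L)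
    (act : Env k A M →ₗ[k] Env k A N →ₗ[k] Env k A N) : Prop :=
  ∀ v b (S : TensorRep (Env.translation k A L (Γ v))),
    Env.map ι (act v b) = ∑ i, S.fst i * Env.map ι b * Env.toLeftOp.symm (S.snd i)

/-- `σ` is the map `σ(v, w) = ε(Γ(v₂w₂)₊) Γ(v₁)Γ(w₁) Γ(v₂w₂)₋`. The expression is meaningful because
`Γ(v₁)Γ(w₁) ⊗ Γ(v₂w₂)₊ ⊗ Γ(v₂w₂)₋` lies in `(𝒰_A(L) ×_A 𝒰_A(L)) ⊗_{Aᵒᵖ} 𝒰_A(L)`, which is part of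
the statement. -/
def IsSectionCocycle (ι : N →ₗ⁅AlgHom.id k A⁆ L) (Γ : Env k A M →ₗ[A] Env k A L)
    (σ : Env k A M →ₗ[k] Env k A M →ₗ[k] Env k A N) : Prop :=
  ∀ v w (S : TensorRep (Env.comul k A M v)) (T : TensorRep (Env.comul k A M w)),
    Nonempty (TakeuchiRep (cocycleTensor Γ S T)) ∧
      ∀ R : TakeuchiRep (cocycleTensor Γ S T), Env.map ι (σ v w) = R.value

end Cleft

end LieRinehart

end

open LieRinehart

universe uk uA un ug uh uI

/-! Everything in parts 3 and 4 is formal once `b ⊗ v ↦ b Γ(v)` is known to be a bijection from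
`U(n) ⊗_A U(h)` to `U(g)`. Let `p(b Γ(v)) = ε(v) b` be the resulting projection to `U(n)` and `z ↦
z₀ ⊗ z₁` the coaction of `U(h)`. Since `Γ` is colinear and `U(n)` is coinvariant, every `z` in
`U(g)` equals `p(z₀) Γ(z₁)` (`equiv_proj_coaction`). Put `v ▷ b = p(Γ(v) b)` and `σ(v, w) = p(Γ(v)
Γ(w))`. The expansion turns into `Γ(v) b = (v₁ ▷ b) Γ(v₂)` and `Γ(v) Γ(w) = σ(v₁, w₁) Γ(v₂ w₂)`. The
measuring, cocycle and twisted module identities are `p` applied to products of two or three factors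
in `U(g)`, expanded in two ways. The crossed product is `U(g)` with its multiplication carried back
along the bijection.

The bijection is a Poincaré-Birkhoff-Witt statement, obtained from a `SymbolMap`, a linear map from
`U(L)` to `S(L)` with the expected leading terms. In its presence any linear map from `S(L)` to
`U(L)` with the expected leading terms is bijective, because both composites differ from the
identity by maps that lower the degree (`SymbolMap.bijective_of_sub_mem`). This serves for
symmetrisation and, through `S(g) ≅ S(n) ⊗ S(h)`, for `cleftMap_bijective`. For free `L` a symbol
map comes from a representation of `U(L)` on monomials in an ordered basis, flat by the Jacobi
identity (`pbwCurv_eq_zero`). A projective `L` is a retract of the free Lie-Rinehart algebra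
`FlatExt`, obtained by adding a free abelian ideal, and the symbol map restricts
(`nonempty_symbolMap`).

In characteristic zero, powers of linear forms with coefficients in `k` span the polynomial ring
over `A`, and symmetrisation sends such a power to the same power of an element of `L`. The
coproduct of a power is given by the binomial formula on both sides, so symmetrisation is a
coalgebra map (`comul_symPoly`) and so is `Γ`. Right linearity of `Γ` follows from `u a = u₁(a) u₂`.

The translation map is built explicitly as `ξ` (`xi`): `X` in `L` acts on a suitable part of `U ⊗ U`
over `Aᵒᵖ` by `p ⊗ q ↦ X p ⊗ q - p ⊗ q X`, and `ξ(u)` is the result of `u` acting on `1 ⊗ 1`. The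
rules `u₊ u₋ = ε(u)`, `u c = u₁₊ c u₁₋ u₂` and `u₊₁ ⊗ u₊₂ ⊗ u₋ = u₁ ⊗ u₂₊ ⊗ u₂₋` then identify the
maps defined through `p` with the formulas of the theorem. The formula for `σ` is independent of the
chosen representation because `U(g)` is projective over `A` (`TakeuchiRep.value_eq`). -/

noncomputable section

namespace LieRinehart

universe uL uM uN uR

/-! ## Filtrations by word length -/

section Filtration

variable (A : Type uA) {L : Type uL} {M : Type uM} {R : Type uR}
variable [CommRing A] [Ring R] [Module A R]

/-- The `A`-span of the words of length less than `n` in the elements `g X`. -/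
def wordSpan (g : L → R) (n : ℕ) : Submodule A R :=
  Submodule.span A {x | ∃ l : List L, l.length < n ∧ (l.map g).prod = x}

variable {A}

theorem prod_mem_wordSpan (g : L → R) {n : ℕ} (l : List L) (hl : l.length < n) :
    (l.map g).prod ∈ wordSpan A g n :=
  Submodule.subset_span ⟨l, hl, rfl⟩

theorem one_mem_wordSpan (g : L → R) (n : ℕ) : (1 : R) ∈ wordSpan A g (n + 1) :=
  prod_mem_wordSpan g [] (Nat.succ_pos n)

/-- Strict length bounds make level zero vanish, so inductions that lower the filtration start from
a trivial case. -/
theorem wordSpan_zero (g : L → R) : wordSpan A g 0 = ⊥ := by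
  rw [wordSpan, Submodule.span_eq_bot]
  rintro x ⟨l, hl, -⟩
  exact absurd hl (Nat.not_lt_zero _)

theorem wordSpan_mono (g : L → R) {m n : ℕ} (h : m ≤ n) : wordSpan A g m ≤ wordSpan A g n :=
  Submodule.span_mono fun _ ⟨l, hl, hx⟩ => ⟨l, hl.trans_le h, hx⟩

/-- The hypothesis is met with `c = 0` in commutative algebras and with `c = ⁅X, a⁆` in the
enveloping algebra. -/
theorem gen_mul_mem_wordSpan {g : L → R}
    (hg : ∀ X (a : A) u, ∃ c : A, g X * (a • u) = a • (g X * u) + c • u) (X : L) {n : ℕ} {u : R}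
    (hu : u ∈ wordSpan A g n) : g X * u ∈ wordSpan A g (n + 1) := by
  induction hu using Submodule.span_induction with
  | mem x hx =>
    obtain ⟨l, hl, rfl⟩ := hx
    rw [← List.prod_cons, ← List.map_cons]
    exact prod_mem_wordSpan g _ (by simpa using hl)
  | zero => simp
  | add x y _ _ hx hy => rw [mul_add]; exact add_mem hx hy
  | smul a x hx h =>
    obtain ⟨c, hc⟩ := hg X a x
    rw [hc]
    exact add_mem (Submodule.smul_mem _ _ h)
      (Submodule.smul_mem _ _ (wordSpan_mono g (Nat.le_succ n) hx))

/-- Induction along left multiplication by generators inside the filtration. -/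
theorem wordSpan_induction {g : L → R} {p : ℕ → R → Prop} (zero : ∀ n, p n 0)
    (add : ∀ n x y, p n x → p n y → p n (x + y)) (smul : ∀ n (a : A) x, x ∈ wordSpan A g n → p n x → p n (a • x))
    (one : ∀ n, p (n + 1) 1) (mul : ∀ n X u, u ∈ wordSpan A g n → p n u → p (n + 1) (g X * u))
    {n : ℕ} {u : R} (hu : u ∈ wordSpan A g n) : p n u := by
  have key : ∀ (l : List L) (n : ℕ), l.length < n → p n (l.map g).prod := by
    intro l
    induction l with
    | nil =>
      intro n hn
      obtain ⟨n, rfl⟩ := Nat.exists_eq_succ_of_ne_zero hn.ne'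
      exact one n
    | cons X l ih =>
      intro n hn
      obtain ⟨n, rfl⟩ := Nat.exists_eq_succ_of_ne_zero (Nat.ne_zero_of_lt hn)
      rw [List.map_cons, List.prod_cons]
      have hl : l.length < n := by simpa using hn
      exact mul n X _ (prod_mem_wordSpan g l hl) (ih n hl)
  induction hu using Submodule.span_induction with
  | mem x hx =>
    obtain ⟨l, hl, rfl⟩ := hx
    exact key l n hl
  | zero => exact zero n
  | add x y _ _ hx hy => exact add n x y hx hy
  | smul a x hx h => exact smul n a x hx h

/-- A perturbation of the identity by a map that lowers an exhaustive filtration is bijective. -/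
theorem bijective_of_sub_mem {V : Type uM} [AddCommGroup V] [Module A V] (W : ℕ → Submodule A V)
    (h₀ : W 0 = ⊥) (hW : ∀ x, ∃ n, x ∈ W n) (f : V →ₗ[A] V)
    (hf : ∀ n x, x ∈ W (n + 1) → f x - x ∈ W n) : Function.Bijective f := by
  constructor
  · rw [injective_iff_map_eq_zero]
    intro x hx
    obtain ⟨n, hn⟩ := hW x
    induction n with
    | zero => simpa [h₀] using hn
    | succ n ih =>
      have := hf n x hn
      rw [hx, zero_sub, neg_mem_iff] at this
      exact ih this
  · intro x
    obtain ⟨n, hn⟩ := hW x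
    induction n generalizing x with
    | zero => exact ⟨0, by simpa [h₀, eq_comm] using hn⟩
    | succ n ih =>
      -- If `f y = f x - x`, then `f (x - y) = x`.
      obtain ⟨y, hy⟩ := ih _ (hf n x hn)
      exact ⟨x - y, by rw [map_sub, hy]; abel⟩

end Filtration

/-! ### The degree filtration of the symmetric algebra -/

section SymFil

variable {A : Type uA} {M : Type uM} {N : Type uN} [CommRing A] [AddCommGroup M] [Module A M]
  [AddCommGroup N] [Module A N]

variable (A M) in
/-- The filtration of the symmetric algebra by degree. -/
abbrev symFil (n : ℕ) : Submodule A (SymmetricAlgebra A M) :=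
  wordSpan A (SymmetricAlgebra.ι A M) n

theorem ι_mul_mem_symFil (X : M) {n : ℕ} {s : SymmetricAlgebra A M} (hs : s ∈ symFil A M n) :
    SymmetricAlgebra.ι A M X * s ∈ symFil A M (n + 1) :=
  gen_mul_mem_wordSpan (fun X a u => ⟨0, by simp⟩) X hs

/-- Degrees at most `m - 1` and `n` add up to less than `m + n`; for `m = 0` the left factor is
zero. -/
theorem mul_mem_symFil {m n : ℕ} {s t : SymmetricAlgebra A M} (hs : s ∈ symFil A M m)
    (ht : t ∈ symFil A M (n + 1)) : s * t ∈ symFil A M (m + n) := by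
  refine wordSpan_induction (A := A) (p := fun m s => s * t ∈ symFil A M (m + n))
    ?_ ?_ ?_ ?_ ?_ hs
  · intro n; simp
  · intro n x y hx hy; rw [add_mul]; exact add_mem hx hy
  · intro n a x _ hx; rw [smul_mul_assoc]; exact Submodule.smul_mem _ _ hx
  · intro m; rw [one_mul]; exact wordSpan_mono _ (by omega) ht
  · intro m X u hu h
    rw [mul_assoc, Nat.add_right_comm]
    exact ι_mul_mem_symFil X h

theorem exists_mem_symFil (s : SymmetricAlgebra A M) : ∃ n, s ∈ symFil A M n := by
  suffices h : ∃ n, s ∈ symFil A M (n + 1) from ⟨_, h.choose_spec⟩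
  induction s using SymmetricAlgebra.induction with
  | algebraMap r =>
    exact ⟨0, by rw [Algebra.algebraMap_eq_smul_one]
                 exact Submodule.smul_mem _ _ (one_mem_wordSpan _ _)⟩
  | ι x => exact ⟨1, by simpa using ι_mul_mem_symFil x (one_mem_wordSpan _ 0)⟩
  | mul a b ha hb =>
    obtain ⟨m, hm⟩ := ha
    obtain ⟨n, hn⟩ := hb
    exact ⟨m + n, by rw [Nat.add_right_comm]; exact mul_mem_symFil hm hn⟩
  | add a b ha hb =>
    obtain ⟨m, hm⟩ := ha
    obtain ⟨n, hn⟩ := hb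
    exact ⟨m + n, add_mem (wordSpan_mono _ (by omega) hm) (wordSpan_mono _ (by omega) hn)⟩

theorem map_mem_symFil (f : SymmetricAlgebra A M →ₐ[A] SymmetricAlgebra A N) (g : M → N)
    (hf : ∀ X, f (SymmetricAlgebra.ι A M X) = SymmetricAlgebra.ι A N (g X)) {n : ℕ}
    {s : SymmetricAlgebra A M} (hs : s ∈ symFil A M n) : f s ∈ symFil A N n := by
  refine wordSpan_induction (A := A) (p := fun m s => f s ∈ symFil A N m) ?_ ?_ ?_ ?_ ?_ hs
  · intro n; simp
  · intro n x y hx hy; rw [map_add]; exact add_mem hx hy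
  · intro n a x _ hx; rw [map_smul]; exact Submodule.smul_mem _ _ hx
  · intro n; simpa using one_mem_wordSpan _ n
  · intro n X u _ h
    rw [map_mul, hf]
    exact ι_mul_mem_symFil _ h

end SymFil

/-! ### The word-length filtration of the enveloping algebra and symbol maps -/

section EnvFil

variable {k : Type uk} {A : Type uA} {L : Type uL} {M : Type uM}
variable [Field k] [CommRing A] [Algebra k A]
variable [LieRing L] [LieAlgebra k L] [Module A L] [LieRingModule L A]
variable [LieRing M] [LieAlgebra k M] [Module A M] [LieRingModule M A]

namespace Env

theorem gen_mul_smul (X : L) (a : A) (u : Env k A L) :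
    gen k A L X * (a • u) = a • (gen k A L X * u) + ⁅X, a⁆ • u := by
  simp only [smul_def, ← mul_assoc, gen_mul_base, add_mul]

variable (k A L) in
/-- The filtration of the enveloping algebra by word length. -/
abbrev fil (n : ℕ) : Submodule A (Env k A L) := wordSpan A (gen k A L) n

theorem gen_mul_mem_fil (X : L) {n : ℕ} {u : Env k A L} (hu : u ∈ fil k A L n) :
    gen k A L X * u ∈ fil k A L (n + 1) :=
  gen_mul_mem_wordSpan (fun X a u => ⟨_, gen_mul_smul X a u⟩) X hu

theorem mul_mem_fil {m n : ℕ} {u v : Env k A L} (hu : u ∈ fil k A L m)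
    (hv : v ∈ fil k A L (n + 1)) : u * v ∈ fil k A L (m + n) := by
  refine wordSpan_induction (A := A) (p := fun m u => u * v ∈ fil k A L (m + n)) ?_ ?_ ?_ ?_ ?_ hu
  · intro n; simp
  · intro n x y hx hy; rw [add_mul]; exact add_mem hx hy
  · intro n a x _ hx; rw [smul_mul_assoc]; exact Submodule.smul_mem _ _ hx
  · intro m; rw [one_mul]; exact wordSpan_mono _ (by omega) hv
  · intro m X u hu h
    rw [mul_assoc, Nat.add_right_comm]
    exact gen_mul_mem_fil X h

theorem exists_mem_fil (u : Env k A L) : ∃ n, u ∈ fil k A L n := by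
  induction u using induction_left with
  | one => exact ⟨1, one_mem_wordSpan _ 0⟩
  | add u v hu hv =>
    obtain ⟨m, hm⟩ := hu
    obtain ⟨n, hn⟩ := hv
    exact ⟨m + n, add_mem (wordSpan_mono _ (by omega) hm) (wordSpan_mono _ (by omega) hn)⟩
  | base_mul a u hu => exact ⟨_, Submodule.smul_mem _ a hu.choose_spec⟩
  | gen_mul X u hu => exact ⟨_, gen_mul_mem_fil X hu.choose_spec⟩

/-- Moving `Y` past a letter `X` leaves the single letter `⁅X, Y⁆`, and moving it past a scalar
leaves a scalar, so no word gets longer. -/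
theorem mul_gen_sub_gen_mul_mem_fil (Y : L) {n : ℕ} {u : Env k A L} (hu : u ∈ fil k A L n) :
    u * gen k A L Y - gen k A L Y * u ∈ fil k A L n := by
  refine wordSpan_induction (A := A)
    (p := fun n u => u * gen k A L Y - gen k A L Y * u ∈ fil k A L n) ?_ ?_ ?_ ?_ ?_ hu
  · intro n; simp
  · intro n x y hx hy
    rw [add_mul, mul_add, add_sub_add_comm]; exact add_mem hx hy
  · intro n a x hx h
    have e : a • x * gen k A L Y - gen k A L Y * (a • x) =
        a • (x * gen k A L Y - gen k A L Y * x) - ⁅Y, a⁆ • x := by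
      rw [gen_mul_smul, smul_mul_assoc, smul_sub]; abel
    rw [e]
    exact sub_mem (Submodule.smul_mem _ _ h) (Submodule.smul_mem _ _ hx)
  · intro n; simp
  · intro n X u hu h
    have e : gen k A L X * u * gen k A L Y - gen k A L Y * (gen k A L X * u) =
        gen k A L X * (u * gen k A L Y - gen k A L Y * u) + gen k A L ⁅X, Y⁆ * u := by
      rw [gen_lie]; noncomm_ring
    rw [e]
    exact add_mem (gen_mul_mem_fil X h) (gen_mul_mem_fil _ hu)

/-- A transposition of neighbours costs a bracket, which is a word shorter by one letter; every
permutation is a chain of these. -/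
theorem prod_perm_sub_mem_fil {l l' : List L} (h : l.Perm l') :
    (l.map (gen k A L)).prod - (l'.map (gen k A L)).prod ∈ fil k A L l.length := by
  induction h with
  | nil => simp
  | cons X _ ih =>
    simp only [List.map_cons, List.prod_cons, ← mul_sub, List.length_cons]
    exact gen_mul_mem_fil X ih
  | swap X Y l =>
    simp only [List.map_cons, List.prod_cons, List.length_cons, ← mul_assoc]
    rw [← sub_mul, ← gen_lie]
    exact wordSpan_mono _ (by omega)
      (gen_mul_mem_fil _ (prod_mem_wordSpan _ l (Nat.lt_succ_self _)))
  | trans h₁ _ ih₁ ih₂ =>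
    rw [h₁.length_eq] at ih₁ ⊢
    simpa using add_mem ih₁ ih₂

theorem map_gen (f : L →ₗ⁅AlgHom.id k A⁆ M) (X : L) : map f (gen k A L X) = gen k A M (f X) :=
  lift_gen _ _ _ _ _ X

theorem map_base (f : L →ₗ⁅AlgHom.id k A⁆ M) (a : A) : map f (base k A L a) = base k A M a :=
  lift_base _ _ _ _ _ a

theorem map_smul_eq (f : L →ₗ⁅AlgHom.id k A⁆ M) (a : A) (u : Env k A L) :
    map f (a • u) = a • map f u := (mapLin f).map_smul a u

theorem map_mem_fil (f : L →ₗ⁅AlgHom.id k A⁆ M) {n : ℕ} {u : Env k A L}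
    (hu : u ∈ fil k A L n) : map f u ∈ fil k A M n := by
  refine wordSpan_induction (A := A) (p := fun m s => map f s ∈ fil k A M m) ?_ ?_ ?_ ?_ ?_ hu
  · intro n; simp
  · intro n x y hx hy; rw [map_add]; exact add_mem hx hy
  · intro n a x _ hx; rw [map_smul_eq]; exact Submodule.smul_mem _ _ hx
  · intro n; simpa using one_mem_wordSpan _ n
  · intro n X u _ h
    rw [map_mul, map_gen]
    exact gen_mul_mem_fil _ h

end Env

variable (k A L) in
/-- A symbol map: a left `A`-linear map from the enveloping algebra to the symmetric algebra that
is compatible with left multiplication by `L` up to terms of lower degree. -/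
structure SymbolMap where
  /-- the underlying linear map -/
  toLin : Env k A L →ₗ[A] SymmetricAlgebra A L
  map_one : toLin 1 = 1
  map_gen_mul : ∀ n u, u ∈ Env.fil k A L n → ∀ X,
    toLin (Env.gen k A L X * u) - SymmetricAlgebra.ι A L X * toLin u ∈ symFil A L n

theorem SymbolMap.map_mem (G : SymbolMap k A L) {n : ℕ} {u : Env k A L}
    (hu : u ∈ Env.fil k A L n) : G.toLin u ∈ symFil A L n := by
  refine wordSpan_induction (A := A) (p := fun m s => G.toLin s ∈ symFil A L m) ?_ ?_ ?_ ?_ ?_ hu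
  · intro n; simp
  · intro n x y hx hy; rw [map_add]; exact add_mem hx hy
  · intro n a x _ hx; rw [map_smul]; exact Submodule.smul_mem _ _ hx
  · intro n; rw [G.map_one]; exact one_mem_wordSpan _ n
  · intro n X u hu h
    rw [← sub_add_cancel (G.toLin _) (SymmetricAlgebra.ι A L X * G.toLin u)]
    exact add_mem (wordSpan_mono _ n.le_succ (G.map_gen_mul n u hu X)) (ι_mul_mem_symFil X h)

/-- A linear map from the symmetric to the enveloping algebra that is compatible with
multiplication by `L` up to terms of lower degree preserves the filtrations. -/
theorem map_mem_fil_of_sub_mem (F : SymmetricAlgebra A L →ₗ[A] Env k A L) (h₁ : F 1 = 1)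
    (hF : ∀ n s, s ∈ symFil A L n → ∀ X,
      F (SymmetricAlgebra.ι A L X * s) - Env.gen k A L X * F s ∈ Env.fil k A L n)
    {n : ℕ} {s : SymmetricAlgebra A L} (hs : s ∈ symFil A L n) : F s ∈ Env.fil k A L n := by
  refine wordSpan_induction (A := A) (p := fun m s => F s ∈ Env.fil k A L m) ?_ ?_ ?_ ?_ ?_ hs
  · intro n; simp
  · intro n x y hx hy; rw [map_add]; exact add_mem hx hy
  · intro n a x _ hx; rw [map_smul]; exact Submodule.smul_mem _ _ hx
  · intro n; rw [h₁]; exact one_mem_wordSpan _ n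
  · intro n X u hu h
    rw [← sub_add_cancel (F _) (Env.gen k A L X * F u)]
    exact add_mem (wordSpan_mono _ n.le_succ (hF n u hu X)) (Env.gen_mul_mem_fil X h)

/-- In the presence of a symbol map, every linear map from the symmetric to the enveloping algebra
with the expected leading terms is bijective. -/
theorem SymbolMap.bijective_of_sub_mem (G : SymbolMap k A L)
    (F : SymmetricAlgebra A L →ₗ[A] Env k A L) (h₁ : F 1 = 1)
    (hF : ∀ n s, s ∈ symFil A L n → ∀ X,
      F (SymmetricAlgebra.ι A L X * s) - Env.gen k A L X * F s ∈ Env.fil k A L n) :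
    Function.Bijective F := by
  have hFm := fun n s (hs : s ∈ symFil A L n) => map_mem_fil_of_sub_mem F h₁ hF hs
  have hGF : Function.Bijective (G.toLin ∘ₗ F) := by
    refine LieRinehart.bijective_of_sub_mem (symFil A L) (wordSpan_zero _) exists_mem_symFil _ ?_
    -- The truncated `n - 1` puts the claim in a form that makes sense at every level, as
    -- `wordSpan_induction` requires; at level zero only `s = 0` occurs.
    suffices h : ∀ n s, s ∈ symFil A L n → (G.toLin ∘ₗ F) s - s ∈ symFil A L (n - 1) from
      fun n s hs => h (n + 1) s hs
    intro n s hs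
    refine wordSpan_induction (A := A)
      (p := fun m s => (G.toLin ∘ₗ F) s - s ∈ symFil A L (m - 1)) ?_ ?_ ?_ ?_ ?_ hs
    · intro n; simp
    · intro n x y hx hy; rw [map_add, add_sub_add_comm]; exact add_mem hx hy
    · intro n a x _ hx; rw [map_smul, ← smul_sub]; exact Submodule.smul_mem _ _ hx
    · intro n; simp [h₁, G.map_one]
    · intro n X s hs h
      rcases n with _ | n
      · rw [wordSpan_zero, Submodule.mem_bot] at hs
        simp [hs]
      -- The error splits into the failure of `F` to commute with `X`, the failure of `G` to do so,
      -- and `X` times the error at `s`.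
      · have e : (G.toLin ∘ₗ F) (SymmetricAlgebra.ι A L X * s) - SymmetricAlgebra.ι A L X * s =
            G.toLin (F (SymmetricAlgebra.ι A L X * s) - Env.gen k A L X * F s) +
            (G.toLin (Env.gen k A L X * F s) - SymmetricAlgebra.ι A L X * G.toLin (F s)) +
            SymmetricAlgebra.ι A L X * ((G.toLin ∘ₗ F) s - s) := by
          simp only [LinearMap.comp_apply, map_sub, mul_sub]; abel
        rw [e]
        exact add_mem (add_mem (G.map_mem (hF _ s hs X)) (G.map_gen_mul _ _ (hFm _ s hs) X))
          (ι_mul_mem_symFil X h)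
  have hFG : Function.Bijective (F ∘ₗ G.toLin) := by
    refine LieRinehart.bijective_of_sub_mem (Env.fil k A L) (wordSpan_zero _) Env.exists_mem_fil
      _ ?_
    suffices h : ∀ n s, s ∈ Env.fil k A L n → (F ∘ₗ G.toLin) s - s ∈ Env.fil k A L (n - 1) from
      fun n s hs => h (n + 1) s hs
    intro n s hs
    refine wordSpan_induction (A := A)
      (p := fun m s => (F ∘ₗ G.toLin) s - s ∈ Env.fil k A L (m - 1)) ?_ ?_ ?_ ?_ ?_ hs
    · intro n; simp
    · intro n x y hx hy; rw [map_add, add_sub_add_comm]; exact add_mem hx hy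
    · intro n a x _ hx; rw [map_smul, ← smul_sub]; exact Submodule.smul_mem _ _ hx
    · intro n; simp [h₁, G.map_one]
    · intro n X s hs h
      rcases n with _ | n
      · rw [wordSpan_zero, Submodule.mem_bot] at hs
        simp [hs]
      · have e : (F ∘ₗ G.toLin) (Env.gen k A L X * s) - Env.gen k A L X * s =
            F (G.toLin (Env.gen k A L X * s) - SymmetricAlgebra.ι A L X * G.toLin s) +
            (F (SymmetricAlgebra.ι A L X * G.toLin s) - Env.gen k A L X * F (G.toLin s)) +
            Env.gen k A L X * ((F ∘ₗ G.toLin) s - s) := by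
          simp only [LinearMap.comp_apply, map_sub, mul_sub]; abel
        rw [e]
        exact add_mem (add_mem (hFm _ _ (G.map_gen_mul _ s hs X)) (hF _ _ (G.map_mem hs) X))
          (Env.gen_mul_mem_fil X h)
  -- `G ∘ F` injective makes `F` injective, and `F ∘ G` surjective makes `F` surjective.
  exact ⟨Function.Injective.of_comp (f := G.toLin) (by simpa using hGF.1),
    Function.Surjective.of_comp (g := G.toLin) (by simpa using hFG.2)⟩

/-- Symbol maps restrict along split injections of Lie-Rinehart algebras. -/
def SymbolMap.restrict (G : SymbolMap k A M) (i : L →ₗ⁅AlgHom.id k A⁆ M) (p : M →ₗ[A] L)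
    (hp : ∀ X, p (i X) = X) : SymbolMap k A L where
  toLin := (symMap p).toLinearMap ∘ₗ G.toLin ∘ₗ Env.mapLin i
  map_one := by
    change symMap p (G.toLin (Env.map i 1)) = 1
    rw [_root_.map_one, G.map_one, _root_.map_one]
  map_gen_mul n u hu X := by
    change symMap p (G.toLin (Env.map i _)) - _ * symMap p (G.toLin (Env.map i u)) ∈ _
    have hι : ∀ Y, symMap p (SymmetricAlgebra.ι A M Y) = SymmetricAlgebra.ι A L (p Y) := fun Y => by
      simp [symMap]
    have := map_mem_symFil (symMap p) p hι (G.map_gen_mul n _ (Env.map_mem_fil i hu) (i X))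
    rwa [map_sub, map_mul (symMap p), hι, hp, ← Env.map_gen, ← map_mul] at this

end EnvFil

/-! ## The symbol map of a free Lie-Rinehart algebra -/

section CoordLie

variable {k : Type uk} {A : Type uA} {L : Type uL} {J : Type uI}
variable [Field k] [CommRing A] [Algebra k A]
variable [LieRing L] [LieAlgebra k L] [Module A L] [LieRingModule L A] [LieRinehartRing A L]
variable [LieRinehartAlgebra k A L]

variable (k) in
/-- The coordinatewise action of `X ∈ L` on finitely supported families of elements of `A`. -/
def coordLie (X : L) : (J →₀ A) →ₗ[k] J →₀ A :=
  Finsupp.mapRange.linearMap (LieModule.toEnd k L A X)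

@[simp] theorem coordLie_apply (X : L) (f : J →₀ A) (j : J) : coordLie k X f j = ⁅X, f j⁆ := rfl

theorem coordLie_smul (X : L) (a : A) (f : J →₀ A) :
    coordLie k X (a • f) = a • coordLie k X f + ⁅X, a⁆ • f := by
  ext j; simp

theorem coordLie_smul_left (a : A) (X : L) (f : J →₀ A) :
    coordLie k (a • X) f = a • coordLie k X f := by
  ext j; simp

theorem coordLie_add_left (X Y : L) (f : J →₀ A) :
    coordLie k (X + Y) f = coordLie k X f + coordLie k Y f := by
  ext j; simp

theorem coordLie_lie (X Y : L) (f : J →₀ A) :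
    coordLie k ⁅X, Y⁆ f = coordLie k X (coordLie k Y f) - coordLie k Y (coordLie k X f) := by
  ext j; simp

theorem lie_one_eq_zero (X : L) : ⁅X, (1 : A)⁆ = 0 := by
  simpa using LieRinehartRing.leibniz_mul_right X (1 : A) 1

theorem coordLie_single_one (X : L) (j : J) : coordLie k X (Finsupp.single j (1 : A)) = 0 := by
  classical
  ext i
  rw [coordLie_apply, Finsupp.single_apply]
  split_ifs <;> simp [lie_one_eq_zero]

end CoordLie

/-! ### The Poincaré-Birkhoff-Witt representation on monomials in an ordered basis -/

section Free

set_option linter.unusedSectionVars false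

variable {k : Type uk} {A : Type uA} {L : Type uL} {I : Type uI}
variable [Field k] [CommRing A] [Algebra k A]
variable [LieRing L] [LieAlgebra k L] [Module A L] [LieRingModule L A] [LieRinehartRing A L]
variable [LieRinehartAlgebra k A L]
variable (b : Module.Basis I A L)

open Finsupp in
/-- The span of the monomials of degree less than `n`. -/
def monoFil (A : Type uA) (I : Type uI) [CommRing A] (n : ℕ) : Submodule A (Multiset I →₀ A) :=
  supported A A {M | M.card < n}

theorem single_mem_monoFil {M : Multiset I} {n : ℕ} (h : M.card < n) (a : A) :
    Finsupp.single M a ∈ monoFil A I n :=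
  Finsupp.single_mem_supported A a h

theorem monoFil_mono {m n : ℕ} (h : m ≤ n) : monoFil A I m ≤ monoFil A I n :=
  Finsupp.supported_mono fun _ hM => lt_of_lt_of_le (b := m) hM h

theorem monoFil_induction {n : ℕ} {q : (Multiset I →₀ A) → Prop} (zero : q 0)
    (add : ∀ x y, q x → q y → q (x + y)) (smul : ∀ (a : A) x, x ∈ monoFil A I n → q x → q (a • x))
    (mono : ∀ M : Multiset I, M.card < n → q (Finsupp.single M 1)) {p : Multiset I →₀ A}
    (hp : p ∈ monoFil A I n) : q p := by
  rw [monoFil, Finsupp.supported_eq_span_single] at hp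
  induction hp using Submodule.span_induction with
  | mem x hx =>
    obtain ⟨M, hM, rfl⟩ := hx
    exact mono M hM
  | zero => exact zero
  | add x y _ _ hx hy => exact add x y hx hy
  | smul a x hx h =>
    rw [← Finsupp.supported_eq_span_single] at hx
    exact smul a x hx h

/-- Multiplication by `X ∈ L`, written in the basis of monomials. -/
def monoMul (X : L) : (Multiset I →₀ A) →ₗ[A] Multiset I →₀ A :=
  Finsupp.linearCombination A
    fun M => b.constr A (fun i => Finsupp.single (i ::ₘ M) (1 : A)) X

variable (k) in
/-- The operator attached to `X ∈ L` which satisfies the Leibniz rule and maps the monomial `M`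
to `t i M` for the `i`-th basis vector. -/
def pbwOp (t : I → Multiset I → Multiset I →₀ A) (X : L) :
    (Multiset I →₀ A) →ₗ[k] Multiset I →₀ A :=
  coordLie k X +
    (Finsupp.linearCombination A fun M => b.constr A (fun i => t i M) X).restrictScalars k

variable {t : I → Multiset I → Multiset I →₀ A}

theorem pbwOp_apply (X : L) (p : Multiset I →₀ A) : pbwOp k b t X p = coordLie k X p +
    Finsupp.linearCombination A (fun M => b.constr A (fun i => t i M) X) p := rfl

theorem pbwOp_smul (X : L) (a : A) (p : Multiset I →₀ A) :
    pbwOp k b t X (a • p) = a • pbwOp k b t X p + ⁅X, a⁆ • p := by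
  simp only [pbwOp_apply, coordLie_smul, map_smul, smul_add]
  abel

theorem pbwOp_smul_left (a : A) (X : L) (p : Multiset I →₀ A) :
    pbwOp k b t (a • X) p = a • pbwOp k b t X p := by
  simp only [pbwOp_apply, coordLie_smul_left, map_smul, smul_add]
  simp [Finsupp.linearCombination_apply, Finsupp.sum, Finset.smul_sum, smul_comm a]

theorem pbwOp_add_left (X Y : L) (p : Multiset I →₀ A) :
    pbwOp k b t (X + Y) p = pbwOp k b t X p + pbwOp k b t Y p := by
  simp only [pbwOp_apply, coordLie_add_left, map_add]
  simp only [Finsupp.linearCombination_apply, Finsupp.sum, smul_add, Finset.sum_add_distrib]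
  abel

theorem pbwOp_basis_single (i : I) (M : Multiset I) :
    pbwOp k b t (b i) (Finsupp.single M 1) = t i M := by
  simp [pbwOp_apply, coordLie_single_one]

theorem pbwOp_single (X : L) (M : Multiset I) :
    pbwOp k b t X (Finsupp.single M 1) = b.constr A (fun i => t i M) X := by
  simp [pbwOp_apply, coordLie_single_one]

theorem monoMul_mem (X : L) {n : ℕ} {p : Multiset I →₀ A} (hp : p ∈ monoFil A I n) :
    monoMul b X p ∈ monoFil A I (n + 1) := by
  refine monoFil_induction (q := fun p => monoMul b X p ∈ monoFil A I (n + 1)) (by simp) ?_ ?_ ?_ hp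
  · intro x y hx hy; rw [map_add]; exact add_mem hx hy
  · intro a x _ hx; rw [map_smul]; exact Submodule.smul_mem _ _ hx
  · intro M hM
    rw [monoMul, Finsupp.linearCombination_single, one_smul, Module.Basis.constr_apply]
    refine sum_mem fun i _ => Submodule.smul_mem _ _ (single_mem_monoFil ?_ _)
    simpa using hM

/-- The coordinatewise derivation does not raise the degree, so the leading term of the operator is
read off from the values `t`. -/
theorem pbwOp_sub_monoMul_mem
    (ht : ∀ i M, t i M - Finsupp.single (i ::ₘ M) 1 ∈ monoFil A I (M.card + 1))
    (X : L) {n : ℕ} {p : Multiset I →₀ A} (hp : p ∈ monoFil A I n) :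
    pbwOp k b t X p - monoMul b X p ∈ monoFil A I n := by
  refine monoFil_induction (q := fun p => pbwOp k b t X p - monoMul b X p ∈ monoFil A I n)
    (by simp) ?_ ?_ ?_ hp
  · intro x y hx hy; rw [map_add, map_add, add_sub_add_comm]; exact add_mem hx hy
  · intro a x h hx
    rw [(monoMul b X).map_smul, pbwOp_smul, add_sub_right_comm, ← smul_sub]
    exact add_mem (Submodule.smul_mem _ _ hx) (Submodule.smul_mem _ _ h)
  · intro M hM
    rw [pbwOp_single, monoMul, Finsupp.linearCombination_single, one_smul,
      Module.Basis.constr_apply, Module.Basis.constr_apply, Finsupp.sum, Finsupp.sum,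
      ← Finset.sum_sub_distrib]
    simp only [← smul_sub]
    exact sum_mem fun i _ => Submodule.smul_mem _ _ (monoFil_mono hM (ht i M))

theorem pbwOp_mem (ht : ∀ i M, t i M - Finsupp.single (i ::ₘ M) 1 ∈ monoFil A I (M.card + 1))
    (X : L) {n : ℕ} {p : Multiset I →₀ A} (hp : p ∈ monoFil A I n) :
    pbwOp k b t X p ∈ monoFil A I (n + 1) := by
  rw [← sub_add_cancel (pbwOp k b t X p) (monoMul b X p)]
  exact add_mem (monoFil_mono n.le_succ (pbwOp_sub_monoMul_mem b ht X hp)) (monoMul_mem b X hp)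

/-- This lets the partial tables `pbwSeq` stand in for the final `pbwCoeff` as long as the arguments
have low degree. -/
theorem pbwOp_congr {t' : I → Multiset I → Multiset I →₀ A} {n : ℕ}
    (h : ∀ i M, M.card < n → t i M = t' i M) (X : L) {p : Multiset I →₀ A}
    (hp : p ∈ monoFil A I n) : pbwOp k b t X p = pbwOp k b t' X p := by
  refine monoFil_induction (q := fun p => pbwOp k b t X p = pbwOp k b t' X p) (by simp) ?_ ?_ ?_ hp
  · intro x y hx hy; rw [map_add, map_add, hx, hy]
  · intro a x _ hx; rw [pbwOp_smul, pbwOp_smul, hx]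
  · intro M hM
    rw [pbwOp_single, pbwOp_single]
    simp only [h _ M hM]

variable [LinearOrder I]

open Classical in
variable (k t) in
/-- The value on a monomial of degree `n + 1` of the operator of the `i`-th basis vector, in terms
of the values `t` on monomials of degree at most `n`. -/
def pbwNext (i : I) (M : Multiset I) : Multiset I →₀ A :=
  -- For `M = x_j N` with `j` minimal and `j < i`, flatness forces `X_i M = X_j X_i N + [X_i, X_j]
  -- N`. Here `X_i N` is `x_i N` plus terms of lower degree, and `X_j` maps `x_i N` to `x_i x_j N`,
  -- which is entered directly so that only known values are used.
  if h : ∃ x : I × Multiset I, M = x.1 ::ₘ x.2 ∧ x.1 < i ∧ ∀ l ∈ x.2, x.1 ≤ l then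
    Finsupp.single (i ::ₘ M) 1 +
      pbwOp k b t (b h.choose.1) (t i h.choose.2 - Finsupp.single (i ::ₘ h.choose.2) 1) +
      pbwOp k b t ⁅b i, b h.choose.1⁆ (Finsupp.single h.choose.2 1)
  else Finsupp.single (i ::ₘ M) 1

/-- The pair `(j, N)` is determined by `j ::ₘ N`, since `j` is its least element; hence the choice
made in `pbwNext` has no effect. -/
theorem pbwNext_cons {i j : I} {N : Multiset I} (hj : j < i) (hN : ∀ l ∈ N, j ≤ l) :
    pbwNext k b t i (j ::ₘ N) = Finsupp.single (i ::ₘ j ::ₘ N) 1 +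
      pbwOp k b t (b j) (t i N - Finsupp.single (i ::ₘ N) 1) +
      pbwOp k b t ⁅b i, b j⁆ (Finsupp.single N 1) := by
  have h : ∃ x : I × Multiset I, j ::ₘ N = x.1 ::ₘ x.2 ∧ x.1 < i ∧ ∀ l ∈ x.2, x.1 ≤ l :=
    ⟨(j, N), rfl, hj, hN⟩
  rw [pbwNext, dif_pos h]
  obtain ⟨h₁, -, h₂⟩ := h.choose_spec
  generalize h.choose = x at *
  obtain ⟨j', N'⟩ := x
  have hj' : j' = j := by
    apply le_antisymm
    · have : j ∈ j' ::ₘ N' := h₁ ▸ Multiset.mem_cons_self _ _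
      rcases Multiset.mem_cons.1 this with e | e
      · exact e.ge
      · exact h₂ _ e
    · have : j' ∈ j ::ₘ N := h₁ ▸ Multiset.mem_cons_self _ _
      rcases Multiset.mem_cons.1 this with e | e
      · exact e.ge
      · exact hN _ e
  subst hj'
  obtain rfl : N = N' := (Multiset.cons_inj_right _).1 h₁
  rfl

theorem pbwNext_of_le {i : I} {M : Multiset I} (h : ∀ l ∈ M, i ≤ l) :
    pbwNext k b t i M = Finsupp.single (i ::ₘ M) 1 := by
  rw [pbwNext, dif_neg]
  rintro ⟨⟨j, N⟩, rfl, hj, -⟩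
  exact absurd (h j (Multiset.mem_cons_self _ _)) (not_le.2 hj)

variable (k) in
/-- The values on monomials, correct up to degree `n`. -/
def pbwSeq : ℕ → I → Multiset I → Multiset I →₀ A
  | 0, i, M => Finsupp.single (i ::ₘ M) 1
  | n + 1, i, M => if M.card = n + 1 then pbwNext k b (pbwSeq n) i M else pbwSeq n i M

variable (k) in
/-- The value on the monomial `M` of the operator attached to the `i`-th basis vector. -/
def pbwCoeff (i : I) (M : Multiset I) : Multiset I →₀ A := pbwSeq k b M.card i M

/-- Passing from stage `n` to stage `n + 1` changes only the values in degree `n + 1`, so those in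
degree at most `n` are final. -/
theorem pbwSeq_of_card_le {n : ℕ} (i : I) (M : Multiset I) (h : M.card ≤ n) :
    pbwSeq k b n i M = pbwCoeff k b i M := by
  induction n with
  | zero => rw [pbwCoeff, Nat.le_zero.1 h]
  | succ n ih =>
    by_cases hM : M.card = n + 1
    · rw [pbwCoeff, hM]
    · rw [pbwSeq, if_neg hM, ih (by omega)]

/-- For `M = x_j N` the two corrections are `X_j` and `[X_i, X_j]` applied to elements of degree at
most that of `N`, so their degree is at most that of `M`. -/
theorem pbwSeq_sub_mem (n : ℕ) (i : I) (M : Multiset I) :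
    pbwSeq k b n i M - Finsupp.single (i ::ₘ M) 1 ∈ monoFil A I (M.card + 1) := by
  classical
  induction n generalizing i M with
  | zero => simp [pbwSeq]
  | succ n ih =>
    rw [pbwSeq]
    split_ifs with hM
    · by_cases h : ∃ x : I × Multiset I, M = x.1 ::ₘ x.2 ∧ x.1 < i ∧ ∀ l ∈ x.2, x.1 ≤ l
      · obtain ⟨⟨j, N⟩, rfl, hj, hN⟩ := h
        rw [pbwNext_cons b hj hN, add_assoc, add_sub_cancel_left, Multiset.card_cons]
        exact add_mem (pbwOp_mem b ih _ (ih i N))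
          (pbwOp_mem b ih _ (single_mem_monoFil (Nat.lt_succ_self _) 1))
      · rw [pbwNext, dif_neg h, sub_self]
        exact zero_mem _
    · exact ih i M

theorem pbwCoeff_sub_mem (i : I) (M : Multiset I) :
    pbwCoeff k b i M - Finsupp.single (i ::ₘ M) 1 ∈ monoFil A I (M.card + 1) :=
  pbwSeq_sub_mem b _ i M

theorem pbwCoeff_of_le {i : I} {M : Multiset I} (h : ∀ l ∈ M, i ≤ l) :
    pbwCoeff k b i M = Finsupp.single (i ::ₘ M) 1 := by
  rw [pbwCoeff]
  rcases hM : M.card with _ | n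
  · rfl
  · rw [pbwSeq, if_pos hM, pbwNext_of_le b h]

variable (k) in
/-- The action of `X ∈ L` on the span of the monomials. -/
abbrev pbwAct (X : L) : (Multiset I →₀ A) →ₗ[k] Multiset I →₀ A := pbwOp k b (pbwCoeff k b) X

/-- The recursion of `pbwNext` in terms of the final operators. All values it consults have degree
at most that of `N`, where the stage used agrees with the final table. -/
theorem pbwAct_basis_cons {i j : I} {N : Multiset I} (hj : j < i) (hN : ∀ l ∈ N, j ≤ l) :
    pbwAct k b (b i) (Finsupp.single (j ::ₘ N) 1) =
      pbwAct k b (b j) (pbwAct k b (b i) (Finsupp.single N 1)) +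
        pbwAct k b ⁅b i, b j⁆ (Finsupp.single N 1) := by
  have hc : ∀ l M, M.card < N.card + 1 → pbwSeq k b N.card l M = pbwCoeff k b l M :=
    fun l M h => pbwSeq_of_card_le b l M (by omega)
  have hjN : ∀ l ∈ i ::ₘ N, j ≤ l := by
    intro l hl
    rcases Multiset.mem_cons.1 hl with rfl | h
    · exact hj.le
    · exact hN l h
  have h₁ : pbwAct k b (b j) (Finsupp.single (i ::ₘ N) 1) = Finsupp.single (i ::ₘ j ::ₘ N) 1 := by
    rw [pbwOp_basis_single, pbwCoeff_of_le b hjN, Multiset.cons_swap]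
  rw [pbwOp_basis_single, pbwOp_basis_single, pbwCoeff, Multiset.card_cons, pbwSeq,
    if_pos (Multiset.card_cons _ _), pbwNext_cons b hj hN, hc _ _ (Nat.lt_succ_self _),
    pbwOp_congr b hc _ (pbwCoeff_sub_mem b i N),
    pbwOp_congr b hc _ (single_mem_monoFil (Nat.lt_succ_self _) 1), map_sub, h₁]
  abel

/-! ### Flatness of the representation on monomials -/

variable (k) in
/-- The curvature of the operators `pbwAct`. -/
def pbwCurv (X Y : L) (p : Multiset I →₀ A) : Multiset I →₀ A :=
  pbwAct k b X (pbwAct k b Y p) - pbwAct k b Y (pbwAct k b X p) - pbwAct k b ⁅X, Y⁆ p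

theorem pbwCurv_zero (X Y : L) : pbwCurv k b X Y 0 = 0 := by simp [pbwCurv]

theorem pbwCurv_add (X Y : L) (p q : Multiset I →₀ A) :
    pbwCurv k b X Y (p + q) = pbwCurv k b X Y p + pbwCurv k b X Y q := by
  simp only [pbwCurv, map_add]; abel

/-- The mixed first-order terms cancel in the commutator, and the remaining derivative of `a`
cancels against that of `⁅X, Y⁆`, because the anchor is a Lie morphism. Being tensorial, the
curvature can be checked on monomials. -/
theorem pbwCurv_smul (X Y : L) (a : A) (p : Multiset I →₀ A) :
    pbwCurv k b X Y (a • p) = a • pbwCurv k b X Y p := by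
  simp only [pbwCurv, pbwOp_smul, map_add, smul_sub, lie_lie, sub_smul]
  abel

theorem pbwAct_neg_left (X : L) (p : Multiset I →₀ A) :
    pbwAct k b (-X) p = -pbwAct k b X p := by
  simpa using pbwOp_smul_left (k := k) (t := pbwCoeff k b) b (-1) X p

theorem pbwCurv_swap (X Y : L) (p : Multiset I →₀ A) :
    pbwCurv k b Y X p = -pbwCurv k b X Y p := by
  rw [pbwCurv, ← lie_skew, pbwAct_neg_left, pbwCurv]; abel

theorem pbwCurv_add_left (X X' Y : L) (p : Multiset I →₀ A) :
    pbwCurv k b (X + X') Y p = pbwCurv k b X Y p + pbwCurv k b X' Y p := by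
  simp only [pbwCurv, pbwOp_add_left, add_lie, map_add]; abel

/-- The term `-Y(a) X` in `[a X, Y]` compensates the derivative of `a` produced by `Y`. Together
with antisymmetry this reduces flatness to pairs of basis vectors. -/
theorem pbwCurv_smul_left (a : A) (X Y : L) (p : Multiset I →₀ A) :
    pbwCurv k b (a • X) Y p = a • pbwCurv k b X Y p := by
  have h : ⁅a • X, Y⁆ = a • ⁅X, Y⁆ + (-⁅Y, a⁆) • X := by
    rw [← lie_skew, LieRinehartRing.leibniz_smul_right, ← lie_skew X Y]
    simp only [smul_neg, neg_smul]; abel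
  simp only [pbwCurv, h, pbwOp_add_left, pbwOp_smul_left, pbwOp_smul, smul_sub]
  rw [neg_smul]
  abel

theorem pbwCurv_basis_of_le {i j : I} {N : Multiset I} (hj : j < i) (hN : ∀ l ∈ N, j ≤ l) :
    pbwCurv k b (b i) (b j) (Finsupp.single N 1) = 0 := by
  have h : pbwAct k b (b j) (Finsupp.single N 1) = Finsupp.single (j ::ₘ N) 1 := by
    rw [pbwOp_basis_single, pbwCoeff_of_le b hN]
  rw [pbwCurv, h, pbwAct_basis_cons b hj hN]
  abel

theorem pbwCurv_eq_zero_of_basis {p : Multiset I →₀ A}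
    (h : ∀ i j, j < i → pbwCurv k b (b i) (b j) p = 0) (X Y : L) : pbwCurv k b X Y p = 0 := by
  have hb : ∀ i j, pbwCurv k b (b i) (b j) p = 0 := by
    intro i j
    rcases lt_trichotomy i j with hij | rfl | hij
    · rw [pbwCurv_swap, h j i hij, neg_zero]
    · have := pbwOp_smul_left (k := k) (t := pbwCoeff k b) b 0 (0 : L) p
      rw [zero_smul, zero_smul] at this
      rw [pbwCurv, sub_self, lie_self, this, sub_zero]
    · exact h i j hij
  have h₁ : ∀ j X, pbwCurv k b X (b j) p = 0 := by
    intro j X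
    induction b.mem_span X using Submodule.span_induction with
    | mem x hx => obtain ⟨i, rfl⟩ := hx; exact hb i j
    | zero => simpa using pbwCurv_smul_left b (0 : A) 0 (b j) p
    | add x y _ _ hx hy => rw [pbwCurv_add_left, hx, hy, add_zero]
    | smul a x _ hx => rw [pbwCurv_smul_left, hx, smul_zero]
  rw [pbwCurv_swap, neg_eq_zero]
  induction b.mem_span Y using Submodule.span_induction with
  | mem x hx =>
    obtain ⟨j, rfl⟩ := hx
    rw [pbwCurv_swap, h₁, neg_zero]
  | zero => simpa using pbwCurv_smul_left b (0 : A) 0 X p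
  | add x y _ _ hx hy => rw [pbwCurv_add_left, hx, hy, add_zero]
  | smul a x _ hx => rw [pbwCurv_smul_left, hx, smul_zero]

/-- Induction on the degree. For a pair `i > j` either `j` is at most every letter and the recursion
gives the claim, or the least letter `m` can be split off. Then `X_i X_j X_m z` and `X_j X_i X_m z`
are compared by moving `X_m` to the front, and the Jacobi identity closes the computation. -/
theorem pbwCurv_eq_zero_of_mem {n : ℕ} {p : Multiset I →₀ A} (hp : p ∈ monoFil A I n) (X Y : L) :
    pbwCurv k b X Y p = 0 := by
  classical
  induction n generalizing p X Y with
  | zero =>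
    have : p = 0 := by simpa [monoFil] using hp
    rw [this, pbwCurv_zero]
  | succ n ih =>
    refine monoFil_induction (q := fun p => pbwCurv k b X Y p = 0) (pbwCurv_zero b X Y) ?_ ?_ ?_ hp
    · intro x y hx hy; rw [pbwCurv_add, hx, hy, add_zero]
    · intro a x _ hx; rw [pbwCurv_smul, hx, smul_zero]
    intro N hN
    refine pbwCurv_eq_zero_of_basis b (fun i j hij => ?_) X Y
    by_cases hj : ∀ l ∈ N, j ≤ l
    · exact pbwCurv_basis_of_le b hij hj
    push Not at hj
    obtain ⟨l₀, hl₀, hl₀j⟩ := hj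
    obtain ⟨m, hm, hmin⟩ := N.toFinset.exists_min_image id ⟨l₀, Multiset.mem_toFinset.2 hl₀⟩
    obtain ⟨M, rfl⟩ := Multiset.exists_cons_of_mem (Multiset.mem_toFinset.1 hm)
    have hmM : ∀ l ∈ M, m ≤ l := fun l hl =>
      hmin l (Multiset.mem_toFinset.2 (Multiset.mem_cons_of_mem hl))
    have hmj : m < j := (hmin l₀ (Multiset.mem_toFinset.2 hl₀)).trans_lt hl₀j
    have hcard : M.card < n := by simpa using hN
    have hz : Finsupp.single M (1 : A) ∈ monoFil A I n := single_mem_monoFil hcard 1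
    -- `X_j z` is the monomial `x_j M`, whose letters are all at least `m`, plus terms of degree at
    -- most that of `M`. The first part is covered by the recursion and the rest by the induction
    -- hypothesis.
    have hlow : ∀ i j, m < i → m < j →
        pbwCurv k b (b i) (b m) (pbwAct k b (b j) (Finsupp.single M 1)) = 0 := by
      intro i j hi hj
      have hmin' : ∀ l ∈ j ::ₘ M, m ≤ l := by
        intro l hl
        rcases Multiset.mem_cons.1 hl with rfl | h
        · exact hj.le
        · exact hmM l h
      rw [pbwOp_basis_single, ← sub_add_cancel (pbwCoeff k b j M) (Finsupp.single (j ::ₘ M) 1),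
        pbwCurv_add, pbwCurv_basis_of_le b hi hmin', add_zero]
      exact ih (monoFil_mono hcard (pbwCoeff_sub_mem b j M)) _ _
    have hNz : pbwAct k b (b m) (Finsupp.single M 1) = Finsupp.single (m ::ₘ M) 1 := by
      rw [pbwOp_basis_single, pbwCoeff_of_le b hmM]
    -- The monomial `N` is `X_m z`, since `m` is at most every letter of `M`.
    rw [← hNz]
    generalize Finsupp.single M (1 : A) = z at hz hlow
    have c : ∀ X Y q, pbwCurv k b X Y q = 0 → pbwAct k b X (pbwAct k b Y q) =
        pbwAct k b Y (pbwAct k b X q) + pbwAct k b ⁅X, Y⁆ q := by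
      intro X Y q h
      rw [pbwCurv, sub_eq_zero, sub_eq_iff_eq_add'] at h
      exact h
    have jac : pbwAct k b ⁅⁅b i, b j⁆, b m⁆ z =
        pbwAct k b ⁅b i, ⁅b j, b m⁆⁆ z - pbwAct k b ⁅b j, ⁅b i, b m⁆⁆ z := by
      rw [lie_lie, sub_eq_add_neg, pbwOp_add_left, pbwAct_neg_left, sub_eq_add_neg]
    have e₁ := c _ _ _ (hlow i j (hmj.trans hij) hmj)
    have e₂ := c _ _ _ (hlow j i hmj (hmj.trans hij))
    have e₃ := c (b i) ⁅b j, b m⁆ z (ih hz _ _)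
    have e₄ := c (b j) ⁅b i, b m⁆ z (ih hz _ _)
    have e₅ := c ⁅b i, b j⁆ (b m) z (ih hz _ _)
    have e₆ := congrArg (pbwAct k b (b m)) (c (b i) (b j) z (ih hz _ _))
    rw [map_add] at e₆
    rw [pbwCurv, c (b j) (b m) z (ih hz _ _), c (b i) (b m) z (ih hz _ _), map_add, map_add,
      e₁, e₂, e₃, e₄, e₅, e₆, jac]
    abel

theorem pbwCurv_eq_zero (X Y : L) (p : Multiset I →₀ A) : pbwCurv k b X Y p = 0 := by
  induction p using Finsupp.induction_linear with
  | zero => exact pbwCurv_zero b X Y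
  | add f g hf hg => rw [pbwCurv_add, hf, hg, add_zero]
  | single M a =>
    exact pbwCurv_eq_zero_of_mem b (single_mem_monoFil (Nat.lt_succ_self M.card) a) X Y

variable (k) in
/-- The action of `L` on the span of the monomials as a linear map. -/
def pbwLin : L →ₗ[k] Module.End k (Multiset I →₀ A) where
  toFun X := pbwAct k b X
  map_add' X Y := LinearMap.ext fun p => pbwOp_add_left b X Y p
  map_smul' c X := LinearMap.ext fun p => by
    rw [← algebraMap_smul A c X, pbwOp_smul_left, algebraMap_smul]
    rfl

variable (k) in
/-- The representation of the enveloping algebra on the span of the monomials. -/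
def pbwRep : Env k A L →ₐ[k] Module.End k (Multiset I →₀ A) :=
  Env.lift (R := Module.End k (Multiset I →₀ A)) (Algebra.lsmul k k (Multiset I →₀ A)) (pbwLin k b)
    (fun a X => LinearMap.ext fun p => pbwOp_smul_left b a X p)
    (fun X Y => LinearMap.ext fun p => (sub_eq_zero.1 (pbwCurv_eq_zero b X Y p)).symm)
    (fun X a => LinearMap.ext fun p => by
      change pbwAct k b X (a • p) - a • pbwAct k b X p = ⁅X, a⁆ • p
      rw [pbwOp_smul, add_sub_cancel_left])

theorem pbwRep_base (a : A) (p : Multiset I →₀ A) : pbwRep k b (Env.base k A L a) p = a • p := by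
  rw [pbwRep, Env.lift_base]; rfl

theorem pbwRep_gen (X : L) (p : Multiset I →₀ A) :
    pbwRep k b (Env.gen k A L X) p = pbwAct k b X p := by
  rw [pbwRep, Env.lift_gen]; rfl

/-- The map from the span of the monomials to the symmetric algebra. -/
def monoToSym : (Multiset I →₀ A) →ₗ[A] SymmetricAlgebra A L :=
  Finsupp.linearCombination A fun M => (M.map fun i => SymmetricAlgebra.ι A L (b i)).prod

theorem monoToSym_monoMul (X : L) (p : Multiset I →₀ A) :
    monoToSym b (monoMul b X p) = SymmetricAlgebra.ι A L X * monoToSym b p := by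
  induction p using Finsupp.induction_linear with
  | zero => simp
  | add f g hf hg => rw [map_add, map_add, hf, hg, map_add, mul_add]
  | single M a =>
    induction b.mem_span X using Submodule.span_induction with
    | mem x hx => obtain ⟨i, rfl⟩ := hx; simp [monoMul, monoToSym]
    | zero => simp [monoMul]
    | add x y _ _ hx hy =>
      rw [map_add, add_mul, ← hx, ← hy, ← map_add]; simp [monoMul]
    | smul c x _ hx =>
      rw [map_smul, smul_mul_assoc, ← hx, ← map_smul]; simp [monoMul, smul_comm a c]

theorem monoToSym_mem {n : ℕ} {p : Multiset I →₀ A} (hp : p ∈ monoFil A I n) :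
    monoToSym b p ∈ symFil A L n := by
  refine monoFil_induction (q := fun p => monoToSym b p ∈ symFil A L n) (by simp) ?_ ?_ ?_ hp
  · intro x y hx hy; rw [map_add]; exact add_mem hx hy
  · intro a x _ hx; rw [map_smul]; exact Submodule.smul_mem _ _ hx
  · intro M hM
    obtain ⟨l, rfl⟩ := Quot.exists_rep M
    have := prod_mem_wordSpan (A := A) (SymmetricAlgebra.ι A L) (l.map b) (n := n)
      (by simpa using hM)
    simpa [monoToSym, Function.comp_def] using this

/-- The symbol map of a free Lie-Rinehart algebra. -/
def symbolMapOfBasis : SymbolMap k A L where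
  toLin :=
    { toFun := fun u => monoToSym b (pbwRep k b u (Finsupp.single 0 1))
      map_add' := fun u v => by simp
      map_smul' := fun a u => by
        rw [Env.smul_def, map_mul, Module.End.mul_apply, pbwRep_base, map_smul, RingHom.id_apply] }
  map_one := by simp [monoToSym]
  map_gen_mul n u hu X := by
    have h : pbwRep k b u (Finsupp.single 0 1) ∈ monoFil A I n := by
      refine wordSpan_induction (A := A)
        (p := fun m u => pbwRep k b u (Finsupp.single 0 1) ∈ monoFil A I m) ?_ ?_ ?_ ?_ ?_ hu
      · intro n; simp
      · intro n x y hx hy; rw [map_add]; exact add_mem hx hy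
      · intro n a x _ hx
        rw [Env.smul_def, map_mul, Module.End.mul_apply, pbwRep_base]
        exact Submodule.smul_mem _ _ hx
      · intro n; rw [map_one]; exact single_mem_monoFil (by simp) 1
      · intro n X u hu h
        rw [map_mul, Module.End.mul_apply, pbwRep_gen]
        exact pbwOp_mem b (pbwCoeff_sub_mem b) X h
    change monoToSym b (pbwRep k b (Env.gen k A L X * u) _) - _ * monoToSym b _ ∈ _
    rw [map_mul, Module.End.mul_apply, pbwRep_gen, ← monoToSym_monoMul, ← map_sub]
    exact monoToSym_mem b (pbwOp_sub_monoMul_mem b (pbwCoeff_sub_mem b) X h)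

end Free

/-! ## The symbol map of a projective Lie-Rinehart algebra -/

section Swindle

variable (A : Type uA) (L : Type uL) [CommRing A] [AddCommGroup L] [Module A L]

/-- Finitely supported families of pairs are pairs of finitely supported families. -/
def finsuppProdEquiv (Q : Type uM) [AddCommGroup Q] [Module A Q] (J : Type uI) :
    (J →₀ L × Q) ≃ₗ[A] (J →₀ L) × (J →₀ Q) :=
  LinearEquiv.ofLinearMap
    ((Finsupp.mapRange.linearMap (LinearMap.fst A L Q)).prod
      (Finsupp.mapRange.linearMap (LinearMap.snd A L Q)))
    ((Finsupp.mapRange.linearMap (LinearMap.inl A L Q)).coprod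
      (Finsupp.mapRange.linearMap (LinearMap.inr A L Q)))
    (by ext <;> simp) (by ext <;> simp)

/-- Adding one more copy of `L` to countably many copies does not change the module. -/
def prodFinsuppNatEquiv : (L × (ℕ →₀ L)) ≃ₗ[A] (ℕ →₀ L) :=
  ((Finsupp.uniqueLinearEquiv A L ()).symm.prodCongr (LinearEquiv.refl A _)).trans
    ((Finsupp.sumFinsuppLEquivProdFinsupp A).symm.trans
      (Finsupp.domLCongr ((Equiv.sumComm Unit ℕ).trans Equiv.natSumPUnitEquivNat)))

/-- A projective module becomes free after adding a suitable free module. -/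
theorem exists_basis_prod_of_projective [Module.Projective A L] :
    Nonempty (Module.Basis (ℕ × L) A (L × (ℕ × L →₀ A))) := by
  obtain ⟨s, hs⟩ := Module.projective_def'.1 (inferInstance : Module.Projective A L)
  let p := Finsupp.linearCombination A (id : L → L)
  have hs' : ∀ x, p (s x) = x := fun x => LinearMap.congr_fun hs x
  let Q := LinearMap.ker p
  -- The splitting `s` makes the free module on the set `L` the direct sum of the module `L` and the
  -- kernel `Q` of the canonical surjection.
  let e : (L →₀ A) ≃ₗ[A] L × Q :=
    LinearEquiv.ofLinearMap
      (p.prod ((LinearMap.id - s ∘ₗ p).codRestrict Q fun x => by simp [Q, hs']))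
      (s.coprod Q.subtype)
      (LinearMap.ext fun ⟨x, q⟩ => by
        have hq : p q = 0 := q.2
        ext
        · simp [hs', hq]
        · simp [hs', hq])
      (LinearMap.ext fun x => by simp)
  let F : (ℕ × L →₀ A) ≃ₗ[A] (ℕ →₀ L) × (ℕ →₀ Q) :=
    (Finsupp.curryLinearEquiv A).trans
      ((Finsupp.mapRange.linearEquiv e).trans (finsuppProdEquiv A L Q ℕ))
  -- Eilenberg swindle: countably many copies of `L × Q` absorb one further copy of `L`, and the
  -- result is again the free module on `ℕ × L`.
  let E : (L × (ℕ × L →₀ A)) ≃ₗ[A] (ℕ →₀ L) × (ℕ →₀ Q) :=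
    ((LinearEquiv.refl A L).prodCongr F).trans
      ((LinearEquiv.prodAssoc A L (ℕ →₀ L) (ℕ →₀ Q)).symm.trans
        ((prodFinsuppNatEquiv A L).prodCongr (LinearEquiv.refl A _)))
  exact ⟨Module.Basis.ofRepr (E.trans F.symm)⟩

end Swindle

/-! ### Reduction of the projective to the free case -/

section FlatExt

set_option linter.unusedSectionVars false

/-- The extension of `L` by a free module, considered as an abelian Lie algebra over `k` with zero
anchor, on which `L` acts coordinatewise. -/
def FlatExt (_k : Type uk) (A : Type uA) (L : Type uL) (J : Type uI) [CommRing A] :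
    Type (max uA uL uI) := L × (J →₀ A)

variable (k : Type uk) (A : Type uA) (L : Type uL) (J : Type uI)
variable [Field k] [CommRing A] [Algebra k A]
variable [LieRing L] [LieAlgebra k L] [Module A L] [LieRingModule L A] [LieRinehartRing A L]
variable [LieRinehartAlgebra k A L]

namespace FlatExt

instance : AddCommGroup (FlatExt k A L J) := inferInstanceAs (AddCommGroup (L × (J →₀ A)))

instance : Module A (FlatExt k A L J) := inferInstanceAs (Module A (L × (J →₀ A)))

instance : Module k (FlatExt k A L J) := inferInstanceAs (Module k (L × (J →₀ A)))

instance : IsScalarTower k A (FlatExt k A L J) :=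
  inferInstanceAs (IsScalarTower k A (L × (J →₀ A)))

variable {k A L J}

theorem ext {x y : FlatExt k A L J} (h₁ : x.1 = y.1) (h₂ : x.2 = y.2) : x = y := Prod.ext h₁ h₂

theorem fst_add (x y : FlatExt k A L J) : (x + y).1 = x.1 + y.1 := rfl
theorem snd_add (x y : FlatExt k A L J) : (x + y).2 = x.2 + y.2 := rfl
theorem fst_smul (a : A) (x : FlatExt k A L J) : (a • x).1 = a • x.1 := rfl
theorem snd_smul (a : A) (x : FlatExt k A L J) : (a • x).2 = a • x.2 := rfl
theorem fst_smul' (c : k) (x : FlatExt k A L J) : (c • x).1 = c • x.1 := rfl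
theorem snd_smul' (c : k) (x : FlatExt k A L J) : (c • x).2 = c • x.2 := rfl

instance : Bracket (FlatExt k A L J) (FlatExt k A L J) :=
  ⟨fun x y => (⁅x.1, y.1⁆, coordLie k x.1 y.2 - coordLie k y.1 x.2)⟩

theorem fst_lie (x y : FlatExt k A L J) : ⁅x, y⁆.1 = ⁅x.1, y.1⁆ := rfl
theorem snd_lie (x y : FlatExt k A L J) :
    ⁅x, y⁆.2 = coordLie k x.1 y.2 - coordLie k y.1 x.2 := rfl

instance : LieRing (FlatExt k A L J) where
  add_lie x y z := ext (by simp only [fst_lie, fst_add, add_lie])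
    (by simp only [snd_lie, fst_add, snd_add, coordLie_add_left, map_add]; abel)
  lie_add x y z := ext (by simp only [fst_lie, fst_add, lie_add])
    (by simp only [snd_lie, fst_add, snd_add, coordLie_add_left, map_add]; abel)
  lie_self x := ext (lie_self x.1) (sub_self _)
  leibniz_lie x y z := ext (by simp only [fst_lie, fst_add, leibniz_lie x.1 y.1 z.1])
    (by simp only [snd_lie, fst_lie, snd_add, coordLie_lie, map_sub]; abel)

instance : LieAlgebra k (FlatExt k A L J) where
  lie_smul c x y := ext (by simp only [fst_lie, fst_smul', lie_smul])
    (by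
      simp only [snd_lie, fst_smul', snd_smul', map_smul, smul_sub]
      rw [← algebraMap_smul A c y.1, coordLie_smul_left, algebraMap_smul])

instance : LieRingModule (FlatExt k A L J) A where
  bracket x a := ⁅x.1, a⁆
  add_lie x y a := add_lie x.1 y.1 a
  lie_add x a b := lie_add x.1 a b
  leibniz_lie x y a := leibniz_lie x.1 y.1 a

theorem lie_base (x : FlatExt k A L J) (a : A) : ⁅x, a⁆ = ⁅x.1, a⁆ := rfl

instance : LieRinehartRing A (FlatExt k A L J) where
  lie_smul_eq_mul' a b x := LieRinehartRing.lie_smul_eq_mul a b x.1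
  leibniz_mul_right' x a b := LieRinehartRing.leibniz_mul_right x.1 a b
  leibniz_smul_right' x y a := ext
    (by simp only [fst_lie, fst_smul, fst_add, lie_base, LieRinehartRing.leibniz_smul_right])
    (by
      simp only [snd_lie, fst_smul, snd_smul, snd_add, lie_base, coordLie_smul,
        coordLie_smul_left, smul_sub]
      abel)

instance : LieRinehartAlgebra k A (FlatExt k A L J) where
  smul_lie c x a := smul_lie c x.1 a
  lie_smul c x a := lie_smul c x.1 a

variable (k A L J) in
/-- The inclusion of `L` in the extension. -/
def inl : L →ₗ⁅AlgHom.id k A⁆ FlatExt k A L J where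
  toFun X := (X, 0)
  map_add' X Y := ext rfl (add_zero _).symm
  map_smul' c X := ext rfl (smul_zero _).symm
  map_lie' {X Y} := ext rfl (by
    change (0 : J →₀ A) = coordLie k X 0 - coordLie k Y 0
    simp)
  map_smul_apply' a X := ext rfl (smul_zero _).symm
  apply_lie' a X := rfl

end FlatExt

/-- A projective Lie-Rinehart algebra has a symbol map. -/
theorem nonempty_symbolMap [Module.Projective A L] : Nonempty (SymbolMap k A L) := by
  obtain ⟨b⟩ := exists_basis_prod_of_projective A L
  let b' : Module.Basis (ℕ × L) A (FlatExt k A L (ℕ × L)) := b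
  classical
  -- Any linear order will do, as only minima of finite multisets are taken.
  let _ : LinearOrder (ℕ × L) := linearOrderOfSTO WellOrderingRel
  exact ⟨(symbolMapOfBasis b').restrict (FlatExt.inl k A L _)
    (LinearMap.fst A L (ℕ × L →₀ A)) fun _ => rfl⟩

end FlatExt

/-! ## Symmetrisation is an isomorphism of coalgebras -/

section Powers

variable {k : Type uk} [Field k] [CharZero k]

/-- The coefficients of a polynomial map whose values lie in a subspace lie in that subspace. -/
theorem coeff_mem_of_forall_sum_pow_mem {V : Type uM} [AddCommGroup V] [Module k V]
    (W : Submodule k V) {n : ℕ} (a : ℕ → V)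
    (h : ∀ c : k, ∑ j ∈ Finset.range n, c ^ j • a j ∈ W) {j : ℕ} (hj : j < n) : a j ∈ W := by
  -- Linear forms on the quotient by `W` reduce the claim to a scalar polynomial that vanishes on
  -- all of the infinite field `k`.
  rw [← Submodule.Quotient.mk_eq_zero, ← Module.forall_dual_apply_eq_zero_iff k]
  intro f
  let p : Polynomial k :=
    ∑ j ∈ Finset.range n, Polynomial.monomial j (f (Submodule.Quotient.mk (a j)))
  have hp : p = 0 := by
    refine Polynomial.funext fun c => ?_
    have := congrArg f ((Submodule.Quotient.mk_eq_zero W).2 (h c))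
    rw [← Submodule.mkQ_apply, map_sum, map_sum, map_zero] at this
    rw [Polynomial.eval_zero, ← this, Polynomial.eval_finsetSum]
    refine Finset.sum_congr rfl fun j _ => ?_
    simp [mul_comm]
  have := congrArg (fun q => Polynomial.coeff q j) hp
  simpa [p, Polynomial.finsetSum_coeff, Polynomial.coeff_monomial, hj] using this

variable (k) {A : Type uA} {I : Type uI} [CommRing A] [Algebra k A]

/-- The linear form with coefficients in `k`. -/
abbrev linForm (A : Type uA) [CommRing A] [Algebra k A] : (I →₀ k) →ₗ[k] MvPolynomial I A :=
  Finsupp.linearCombination k (MvPolynomial.X : I → MvPolynomial I A)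

/-- Polynomials are linear combinations of powers of linear forms with coefficients in `k`. -/
theorem mem_span_linForm_pow (p : MvPolynomial I A) :
    p ∈ Submodule.span A {q | ∃ (v : I →₀ k) (m : ℕ), q = linForm k A v ^ m} := by
  set W := Submodule.span A {q | ∃ (v : I →₀ k) (m : ℕ), q = linForm k A v ^ m}
  have hX : ∀ (i : I) (v : I →₀ k) (m : ℕ), linForm k A v ^ m * MvPolynomial.X i ∈ W := by
    intro i v m
    -- Polarisation: the coefficient of `c` in `(c x_i + v)^(m+1)` is `(m + 1) x_i v^m`, and `m + 1`
    -- is invertible in characteristic zero.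
    have := coeff_mem_of_forall_sum_pow_mem (W.restrictScalars k) (n := m + 1 + 1)
      (fun j => MvPolynomial.X i ^ j * linForm k A v ^ (m + 1 - j) * ((m + 1).choose j : MvPolynomial I A)) ?_
      (j := 1) (by omega)
    · have h2 := (W.restrictScalars k).smul_mem ((m + 1 : k)⁻¹) this
      convert h2 using 1
      rw [Submodule.restrictScalars_mem]
      have h3 : (m + 1 : k) ≠ 0 := Nat.cast_add_one_ne_zero m
      have h4 : ((((m + 1).choose 1 : ℕ)) : MvPolynomial I A) =
          (m + 1 : k) • (1 : MvPolynomial I A) := by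
        rw [Nat.choose_one_right, add_smul, one_smul, Nat.cast_smul_eq_nsmul]
        simp
      rw [h4, mul_smul_comm, smul_smul, inv_mul_cancel₀ h3]
      simp [mul_comm]
    · intro c
      have h1 : linForm k A ((Finsupp.single i c : I →₀ k) + v) ^ (m + 1) ∈ W :=
        Submodule.subset_span ⟨_, _, rfl⟩
      rw [map_add, add_pow, Finsupp.linearCombination_single] at h1
      simp only [smul_pow, smul_mul_assoc] at h1
      exact h1
  induction p using MvPolynomial.induction_on with
  | C a =>
    rw [← mul_one (MvPolynomial.C a), ← MvPolynomial.smul_eq_C_mul]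
    exact Submodule.smul_mem _ _ (Submodule.subset_span ⟨0, 0, (pow_zero _).symm⟩)
  | add p q hp hq => exact add_mem hp hq
  | mul_X p i hp =>
    induction hp using Submodule.span_induction with
    | mem x hx => obtain ⟨v, m, rfl⟩ := hx; exact hX i v m
    | zero => simp
    | add x y _ _ hx hy => rw [add_mul]; exact add_mem hx hy
    | smul a x _ hx => rw [smul_mul_assoc]; exact Submodule.smul_mem _ _ hx

end Powers

/-! ### Symmetrisation on polynomials and its leading terms -/

section Polynomials

set_option linter.unusedSectionVars false

variable {k : Type uk} {A : Type uA} {L : Type uL}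
variable [Field k] [CommRing A] [Algebra k A]
variable [LieRing L] [LieAlgebra k L] [Module A L] [LieRingModule L A]

variable (D : DualBasis.{uA, uL, uI} A L)

variable (k) in
/-- The symmetrisation map on polynomials. -/
def symPoly : MvPolynomial D.I A →ₗ[A] Env k A L :=
  (MvPolynomial.basisMonomials D.I A).constr A (symMonomial k D)

/-- The map from the symmetric algebra to polynomials attached to a dual basis. -/
def dualPoly : SymmetricAlgebra A L →ₐ[A] MvPolynomial D.I A :=
  SymmetricAlgebra.lift
    (Finsupp.linearCombination A (MvPolynomial.X : D.I → MvPolynomial D.I A) ∘ₗ D.coord)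

theorem symmetrisation_apply (s : SymmetricAlgebra A L) :
    symmetrisation k D s = symPoly k D (dualPoly D s) := rfl

theorem dualPoly_ι (X : L) : dualPoly D (SymmetricAlgebra.ι A L X) =
    Finsupp.linearCombination A (MvPolynomial.X : D.I → MvPolynomial D.I A) (D.coord X) := by
  simp [dualPoly]

theorem symPoly_prod_X {m : ℕ} (j : Fin m → D.I) :
    symPoly k D (∏ i, MvPolynomial.X (j i)) =
      symProd k fun i => Env.gen k A L (D.vec (j i)) := by
  have h : (∏ i, MvPolynomial.X (j i) : MvPolynomial D.I A) =
      MvPolynomial.basisMonomials D.I A (∑ i, Finsupp.single (j i) 1) := by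
    simp [MvPolynomial.X, ← MvPolynomial.monomial_sum_prod]
  rw [h, symPoly, Module.Basis.constr_basis, symMonomial_sum]

theorem symPoly_one [CharZero k] : symPoly k D 1 = 1 := by
  simpa [symProd] using symPoly_prod_X (k := k) D (m := 0) Fin.elim0

variable (k) in
/-- The symmetrised product as a multilinear map. -/
def symProdMultilinear (m : ℕ) (R : Type uR) [Ring R] [Algebra k R] :
    MultilinearMap k (fun _ : Fin m => R) R :=
  (m.factorial : k)⁻¹ • ∑ σ : Equiv.Perm (Fin m),
    (MultilinearMap.mkPiAlgebraFin k m R).domDomCongr σ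

theorem symProdMultilinear_apply {m : ℕ} {R : Type uR} [Ring R] [Algebra k R] (x : Fin m → R) :
    symProdMultilinear k m R x = symProd k x := by
  simp [symProdMultilinear, symProd]

theorem symProd_const [CharZero k] {m : ℕ} {R : Type uR} [Ring R] [Algebra k R] (x : R) :
    symProd k (fun _ : Fin m => x) = x ^ m := by
  have h : (m.factorial : k) ≠ 0 := Nat.cast_ne_zero.2 m.factorial_ne_zero
  simp only [symProd, List.ofFn_const, List.prod_replicate, Finset.sum_const, Finset.card_univ,
    Fintype.card_perm, Fintype.card_fin]
  rw [← Nat.cast_smul_eq_nsmul k, smul_smul, inv_mul_cancel₀ h, one_smul]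

/-- Both sides are `k`-multilinear in the forms and agree on variables. Coefficients are restricted
to `k` because scalars of `A` do not commute with `L` in the enveloping algebra. -/
theorem symPoly_prod_linForm {m : ℕ} (v : Fin m → D.I →₀ k) :
    symPoly k D (∏ i, linForm k A (v i)) =
      symProd k fun i => Env.gen k A L (Finsupp.linearCombination k D.vec (v i)) := by
  let f : MultilinearMap k (fun _ : Fin m => D.I →₀ k) (Env k A L) :=
    ((symPoly k D).restrictScalars k).compMultilinearMap
      ((MultilinearMap.mkPiAlgebra k (Fin m) (MvPolynomial D.I A)).compLinearMap
        fun _ => linForm k A)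
  let g : MultilinearMap k (fun _ : Fin m => D.I →₀ k) (Env k A L) :=
    (symProdMultilinear k m (Env k A L)).compLinearMap
      fun _ => Env.gen k A L ∘ₗ Finsupp.linearCombination k D.vec
  have hfg : f = g := by
    refine Module.Basis.ext_multilinear (fun _ => Finsupp.basisSingleOne) fun j => ?_
    simp only [f, g, LinearMap.compMultilinearMap_apply, MultilinearMap.compLinearMap_apply,
      MultilinearMap.mkPiAlgebra_apply, Finsupp.coe_basisSingleOne,
      Finsupp.linearCombination_single, one_smul, symProdMultilinear_apply,
      LinearMap.coe_restrictScalars, LinearMap.comp_apply]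
    exact symPoly_prod_X D j
  have := congrArg (fun F => F v) hfg
  simpa only [f, g, LinearMap.compMultilinearMap_apply, MultilinearMap.compLinearMap_apply,
      MultilinearMap.mkPiAlgebra_apply, symProdMultilinear_apply,
      LinearMap.coe_restrictScalars, LinearMap.comp_apply] using this

theorem symPoly_linForm_pow [CharZero k] (v : D.I →₀ k) (m : ℕ) :
    symPoly k D (linForm k A v ^ m) =
      Env.gen k A L (Finsupp.linearCombination k D.vec v) ^ m := by
  have := symPoly_prod_linForm D (m := m) fun _ => v
  rwa [symProd_const, Finset.prod_const, Finset.card_univ, Fintype.card_fin] at this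

/-! ### Leading terms -/

theorem algebra_smul_mem_wordSpan {n : ℕ} (c : k) {u : Env k A L} (hu : u ∈ Env.fil k A L n) :
    c • u ∈ Env.fil k A L n := by
  rw [← algebraMap_smul A c u]
  exact Submodule.smul_mem _ _ hu

/-- Each of the `m!` reorderings of a word agrees with it up to shorter words, hence so does their
average. -/
theorem symPoly_prod_list_sub_mem [CharZero k] (l : List D.I) :
    symPoly k D (l.map MvPolynomial.X).prod -
      ((l.map D.vec).map (Env.gen k A L)).prod ∈ Env.fil k A L l.length := by
  have h₁ : (l.map MvPolynomial.X).prod = ∏ i : Fin l.length,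
      (MvPolynomial.X (l.get i) : MvPolynomial D.I A) := by
    rw [← List.prod_ofFn]
    congr 1
    apply List.ext_getElem <;> simp
  have h : (l.length.factorial : k) ≠ 0 := Nat.cast_ne_zero.2 l.length.factorial_ne_zero
  have h₂ : ((l.map D.vec).map (Env.gen k A L)).prod = (l.length.factorial : k)⁻¹ •
      ∑ _σ : Equiv.Perm (Fin l.length), ((l.map D.vec).map (Env.gen k A L)).prod := by
    rw [Finset.sum_const, Finset.card_univ, Fintype.card_perm, Fintype.card_fin,
      ← Nat.cast_smul_eq_nsmul k, smul_smul, inv_mul_cancel₀ h, one_smul]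
  rw [h₁, symPoly_prod_X, h₂, symProd, ← smul_sub, ← Finset.sum_sub_distrib]
  refine algebra_smul_mem_wordSpan _ (sum_mem fun σ _ => ?_)
  have e : (List.ofFn fun i => Env.gen k A L (D.vec (l.get (σ i)))) =
      (List.ofFn fun i => D.vec (l.get (σ i))).map (Env.gen k A L) := by
    rw [List.map_ofFn]; rfl
  have hp : (List.ofFn fun i => D.vec (l.get (σ i))).Perm (l.map D.vec) := by
    have h1 := Equiv.Perm.ofFn_comp_perm σ (fun i => D.vec (l.get i))
    have h2 : (List.ofFn fun i => D.vec (l.get i)) = l.map D.vec := by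
      apply List.ext_getElem <;> simp
    rw [h2] at h1
    exact h1
  rw [e]
  have := Env.prod_perm_sub_mem_fil (k := k) (A := A) hp
  simpa using this

theorem symPoly_mem_fil [CharZero k] {n : ℕ} {p : MvPolynomial D.I A}
    (hp : p ∈ wordSpan A (MvPolynomial.X : D.I → MvPolynomial D.I A) n) :
    symPoly k D p ∈ Env.fil k A L n := by
  induction hp using Submodule.span_induction with
  | mem x hx =>
    obtain ⟨l, hl, rfl⟩ := hx
    rw [← sub_add_cancel (symPoly k D _) ((l.map D.vec).map (Env.gen k A L)).prod]
    exact add_mem (wordSpan_mono _ hl.le (symPoly_prod_list_sub_mem D l))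
      (prod_mem_wordSpan _ _ (by simpa using hl))
  | zero => simp
  | add x y _ _ hx hy => rw [map_add]; exact add_mem hx hy
  | smul a x _ hx => rw [map_smul]; exact Submodule.smul_mem _ _ hx

theorem symPoly_X_mul_sub_mem [CharZero k] (j : D.I) {n : ℕ} {p : MvPolynomial D.I A}
    (hp : p ∈ wordSpan A (MvPolynomial.X : D.I → MvPolynomial D.I A) n) :
    symPoly k D (MvPolynomial.X j * p) - Env.gen k A L (D.vec j) * symPoly k D p ∈
      Env.fil k A L n := by
  induction hp using Submodule.span_induction with
  | mem x hx =>
    obtain ⟨l, hl, rfl⟩ := hx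
    have h₁ := symPoly_prod_list_sub_mem (k := k) D (j :: l)
    have h₂ := Env.gen_mul_mem_fil (D.vec j) (symPoly_prod_list_sub_mem (k := k) D l)
    have := sub_mem h₁ h₂
    simp only [List.map_cons, List.prod_cons, mul_sub] at this
    rw [sub_sub_sub_cancel_right] at this
    exact wordSpan_mono _ hl this
  | zero => simp
  | add x y _ _ hx hy =>
    rw [mul_add, map_add, map_add, mul_add, add_sub_add_comm]; exact add_mem hx hy
  | smul a x hx h =>
    rw [mul_smul_comm, map_smul, map_smul, Env.gen_mul_smul, ← sub_sub, ← smul_sub]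
    exact sub_mem (Submodule.smul_mem _ _ h) (Submodule.smul_mem _ _ (symPoly_mem_fil D hx))

theorem dualPoly_mem {n : ℕ} {s : SymmetricAlgebra A L} (hs : s ∈ symFil A L n) :
    dualPoly D s ∈ wordSpan A (MvPolynomial.X : D.I → MvPolynomial D.I A) n := by
  refine wordSpan_induction (A := A)
    (p := fun n s => dualPoly D s ∈ wordSpan A (MvPolynomial.X : D.I → MvPolynomial D.I A) n)
    ?_ ?_ ?_ ?_ ?_ hs
  · intro n; simp
  · intro n x y hx hy; rw [map_add]; exact add_mem hx hy
  · intro n a x _ hx; rw [map_smul]; exact Submodule.smul_mem _ _ hx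
  · intro n; rw [map_one]; exact one_mem_wordSpan _ n
  · intro n X u _ h
    rw [map_mul, dualPoly_ι, Finsupp.linearCombination_apply, Finsupp.sum, Finset.sum_mul]
    refine sum_mem fun i _ => ?_
    rw [smul_mul_assoc]
    exact Submodule.smul_mem _ _ (gen_mul_mem_wordSpan (fun X a u => ⟨0, by simp⟩) i h)

theorem symmetrisation_one [CharZero k] : symmetrisation k D 1 = 1 := by
  rw [symmetrisation_apply, map_one, symPoly_one]

/-- Expanding `X` in the dual basis reduces to multiplication by one variable. The coefficients stay
on the left, so they cause no further error. -/
theorem symmetrisation_ι_mul_sub_mem [CharZero k] (n : ℕ) (s : SymmetricAlgebra A L)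
    (hs : s ∈ symFil A L n) (X : L) :
    symmetrisation k D (SymmetricAlgebra.ι A L X * s) -
      Env.gen k A L X * symmetrisation k D s ∈ Env.fil k A L n := by
  have hX : Env.gen k A L X =
      ∑ i ∈ (D.coord X).support, D.coord X i • Env.gen k A L (D.vec i) := by
    conv_lhs => rw [← D.sum_coord X, Finsupp.linearCombination_apply, Finsupp.sum, map_sum]
    exact Finset.sum_congr rfl fun i _ => Env.gen_smul k _ _
  rw [symmetrisation_apply, symmetrisation_apply, map_mul, dualPoly_ι,
    Finsupp.linearCombination_apply, Finsupp.sum, Finset.sum_mul, map_sum, hX, Finset.sum_mul,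
    ← Finset.sum_sub_distrib]
  refine sum_mem fun i _ => ?_
  rw [smul_mul_assoc, map_smul, smul_mul_assoc, ← smul_sub]
  exact Submodule.smul_mem _ _ (symPoly_X_mul_sub_mem D i (dualPoly_mem D hs))

end Polynomials

/-! ### Poincaré-Birkhoff-Witt theorem and comultiplicativity of symmetrisation -/

section Bijective

set_option linter.unusedSectionVars false

variable {k : Type uk} {A : Type uA} {L : Type uL}
variable [Field k] [CharZero k] [CommRing A] [Algebra k A]
variable [LieRing L] [LieAlgebra k L] [Module A L] [LieRingModule L A] [LieRinehartRing A L]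
variable [LieRinehartAlgebra k A L]

/-- The Poincaré-Birkhoff-Witt theorem for projective Lie-Rinehart algebras. -/
theorem symmetrisation_bijective [Module.Projective A L] (D : DualBasis.{uA, uL, uI} A L) :
    Function.Bijective (symmetrisation k D) := by
  obtain ⟨G⟩ := nonempty_symbolMap k A L
  exact G.bijective_of_sub_mem _ (symmetrisation_one D) (symmetrisation_ι_mul_sub_mem D)

/-! ### Compatibility with the coproduct -/

theorem Env.comul_gen_pow (X : L) (m : ℕ) : Env.comul k A L (Env.gen k A L X ^ m) =
    ∑ ij ∈ Finset.HasAntidiagonal.antidiagonal m,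
      m.choose ij.1 • ((Env.gen k A L X ^ ij.1) ⊗ₜ[A] (Env.gen k A L X ^ ij.2)) := by
  induction m with
  | zero => simp [Env.comul_one]
  | succ m ih =>
    rw [pow_succ', Env.comul_gen_mul, ih, map_sum,
      Finset.sum_antidiagonal_choose_succ_nsmul
        (fun i j => (Env.gen k A L X ^ i) ⊗ₜ[A] (Env.gen k A L X ^ j)), ← Finset.sum_add_distrib]
    refine Finset.sum_congr rfl fun ij hij => ?_
    have hc : m.choose ij.2 = m.choose ij.1 := by
      rw [← Finset.HasAntidiagonal.mem_antidiagonal.1 hij, Nat.choose_symm_add]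
    rw [map_nsmul, Env.primOp_tmul, hc, ← pow_succ', ← pow_succ', smul_add, add_comm]

/-- The coproduct of the polynomial ring for which the variables are primitive. -/
def polyComul (A : Type uA) (I : Type uI) [CommRing A] :
    MvPolynomial I A →ₐ[A] MvPolynomial I A ⊗[A] MvPolynomial I A :=
  MvPolynomial.aeval fun i => MvPolynomial.X i ⊗ₜ 1 + 1 ⊗ₜ MvPolynomial.X i

theorem polyComul_linForm {I : Type uI} (v : I →₀ k) : polyComul A I (linForm k A v) =
    linForm k A v ⊗ₜ 1 + 1 ⊗ₜ linForm k A v := by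
  induction v using Finsupp.induction_linear with
  | zero => simp
  | add f g hf hg => rw [map_add, map_add, hf, hg, TensorProduct.add_tmul,
      TensorProduct.tmul_add]; abel
  | single i c =>
    rw [Finsupp.linearCombination_single, ← algebraMap_smul A c, map_smul, polyComul,
      MvPolynomial.aeval_X, smul_add, TensorProduct.tmul_smul, TensorProduct.smul_tmul']

theorem polyComul_linForm_pow {I : Type uI} (v : I →₀ k) (m : ℕ) :
    polyComul A I (linForm k A v ^ m) =
      ∑ ij ∈ Finset.HasAntidiagonal.antidiagonal m,
        m.choose ij.1 • ((linForm k A v ^ ij.1) ⊗ₜ[A] (linForm k A v ^ ij.2)) := by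
  rw [map_pow, polyComul_linForm, Commute.add_pow' (Commute.all _ _)]
  refine Finset.sum_congr rfl fun ij _ => ?_
  simp [Algebra.TensorProduct.tmul_pow]

/-- Both sides are `A`-linear, so `p` may be taken to be a power of a linear form over `k`.
Symmetrisation preserves such powers, and both coproducts expand by the same binomial formula, the
base being primitive. -/
theorem comul_symPoly (D : DualBasis.{uA, uL, uI} A L) (p : MvPolynomial D.I A) :
    Env.comul k A L (symPoly k D p) =
      TensorProduct.map (symPoly k D) (symPoly k D) (polyComul A D.I p) := by
  induction mem_span_linForm_pow k p using Submodule.span_induction with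
  | mem x hx =>
    obtain ⟨v, m, rfl⟩ := hx
    rw [symPoly_linForm_pow, Env.comul_gen_pow, polyComul_linForm_pow, map_sum]
    refine Finset.sum_congr rfl fun ij _ => ?_
    rw [map_nsmul, TensorProduct.map_tmul, symPoly_linForm_pow, symPoly_linForm_pow]
  | zero => simp
  | add x y _ _ hx hy => simp only [map_add, hx, hy]
  | smul a x _ hx => simp only [map_smul, hx]

theorem polyComul_dualPoly (D : DualBasis.{uA, uL, uI} A L) (s : SymmetricAlgebra A L) :
    polyComul A D.I (dualPoly D s) = TensorProduct.map (dualPoly D).toLinearMap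
      (dualPoly D).toLinearMap (Coalgebra.comul (R := A) s) := by
  have : (polyComul A D.I).comp (dualPoly D) =
      (Algebra.TensorProduct.map (dualPoly D) (dualPoly D)).comp (Bialgebra.comulAlgHom A _) := by
    refine SymmetricAlgebra.algHom_ext (LinearMap.ext fun X => ?_)
    have h : ∀ f : D.I →₀ A, polyComul A D.I (Finsupp.linearCombination A MvPolynomial.X f) =
        Finsupp.linearCombination A MvPolynomial.X f ⊗ₜ 1 +
          1 ⊗ₜ Finsupp.linearCombination A MvPolynomial.X f := by
      intro f
      induction f using Finsupp.induction_linear with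
      | zero => simp
      | add f g hf hg =>
        rw [map_add, map_add, hf, hg, TensorProduct.add_tmul, TensorProduct.tmul_add]; abel
      | single i c =>
        rw [Finsupp.linearCombination_single, map_smul, polyComul,
          MvPolynomial.aeval_X, smul_add, TensorProduct.tmul_smul, TensorProduct.smul_tmul']
    simp [dualPoly_ι, h]
  exact DFunLike.congr_fun this s

/-- The symmetrisation map is a morphism of coalgebras. -/
theorem comul_symmetrisation (D : DualBasis.{uA, uL, uI} A L) (s : SymmetricAlgebra A L) :
    Env.comul k A L (symmetrisation k D s) = TensorProduct.map (symmetrisation k D)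
      (symmetrisation k D) (Coalgebra.comul (R := A) s) := by
  rw [symmetrisation_apply, comul_symPoly, polyComul_dualPoly, ← LinearMap.comp_apply,
    ← TensorProduct.map_comp]
  rfl

end Bijective

/-! ## The coring section -/

section CoringSection

set_option linter.unusedSectionVars false

variable {k : Type uk} {A : Type uA} {L : Type uL} {M : Type uM}
variable [Field k] [CommRing A] [Algebra k A]
variable [LieRing L] [LieAlgebra k L] [Module A L] [LieRingModule L A]
variable [LieRinehartRing A L] [LieRinehartAlgebra k A L]
variable [LieRing M] [LieAlgebra k M] [Module A M] [LieRingModule M A]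
variable [LieRinehartRing A M] [LieRinehartAlgebra k A M]

namespace Env

/-- Morphisms over the identity of `A` preserve the anchor, so the two actions agree on generators.
-/
theorem actBase_map (π : L →ₗ⁅AlgHom.id k A⁆ M) (u : Env k A L) :
    actBase k A M (map π u) = actBase k A L u := by
  have : (actBase k A M).comp (map π) = actBase k A L := by
    refine hom_ext (fun a => ?_) (fun X => ?_)
    · refine LinearMap.ext fun b => ?_
      rw [AlgHom.comp_apply, map_base, actBase_base, actBase_base]
    · refine LinearMap.ext fun b => ?_
      rw [AlgHom.comp_apply, map_gen, actBase_gen, actBase_gen]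
      exact (π.apply_lie b X).symm
  exact DFunLike.congr_fun this u

theorem counit_map (π : L →ₗ⁅AlgHom.id k A⁆ M) (u : Env k A L) :
    counit k A M (map π u) = counit k A L u := by
  change actBase k A M (map π u) 1 = actBase k A L u 1
  rw [actBase_map]

theorem actBase_smul (a : A) (u : Env k A L) (b : A) :
    actBase k A L (a • u) b = a * actBase k A L u b := by
  rw [smul_def, map_mul, Module.End.mul_apply, actBase_base]

/-- The map `x ⊗ y ↦ x(a) y`. -/
def actTmul (a : A) : Env k A L ⊗[A] Env k A L →ₗ[A] Env k A L :=
  TensorProduct.lift (LinearMap.mk₂ A (fun x y => actBase k A L x a • y)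
    (fun x x' y => by rw [map_add, LinearMap.add_apply, add_smul])
    (fun c x y => by rw [actBase_smul, mul_smul])
    (fun x y y' => smul_add _ _ _)
    (fun c x y => smul_comm _ _ _))

@[simp] theorem actTmul_tmul (a : A) (x y : Env k A L) :
    actTmul a (x ⊗ₜ[A] y) = actBase k A L x a • y := rfl

/-- `u a = u₁(a) u₂`. -/
theorem mul_base_eq (u : Env k A L) (a : A) :
    u * base k A L a = actTmul a (comul k A L u) := by
  induction u using induction_left with
  | one => simp [comul_one, smul_def]
  | add u v hu hv => rw [add_mul, hu, hv, map_add, map_add]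
  | base_mul b u hu => rw [mul_assoc, hu, comul_base_mul, map_smul, smul_def]
  | gen_mul X u hu =>
    rw [mul_assoc, hu, comul_gen_mul]
    generalize comul k A L u = t
    induction t with
    | zero => simp
    | add x y hx hy => rw [map_add, mul_add, hx, hy, map_add, map_add]
    | tmul x y =>
      rw [primOp_tmul, map_add, actTmul_tmul, actTmul_tmul, actTmul_tmul, map_mul,
        Module.End.mul_apply, actBase_gen, gen_mul_smul, add_comm]

end Env

variable (π : L →ₗ⁅AlgHom.id k A⁆ M) (γ : M →ₗ[A] L) (hγ : ∀ X, homLin π (γ X) = X)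
variable (D : DualBasis.{uA, uL, uI} A L)

theorem map_symProd {m : ℕ} {R : Type uR} {R' : Type uN} [Ring R] [Algebra k R] [Ring R']
    [Algebra k R'] (f : R →ₐ[k] R') (x : Fin m → R) : f (symProd k x) = symProd k (f ∘ x) := by
  simp only [symProd, map_smul, map_sum, map_list_prod, List.map_ofFn]
  rfl

theorem map_symPoly (p : MvPolynomial D.I A) :
    Env.map π (symPoly k D p) = symPoly k (D.push (homLin π) γ hγ) p := by
  have : Env.mapLin π ∘ₗ symPoly k D = symPoly k (D.push (homLin π) γ hγ) := by
    refine (MvPolynomial.basisMonomials D.I A).ext fun s => ?_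
    have e : symPoly k (D.push (homLin π) γ hγ) (MvPolynomial.basisMonomials D.I A s) =
        symMonomial k (D.push (homLin π) γ hγ) s :=
      (MvPolynomial.basisMonomials D.I A).constr_basis A _ s
    refine Eq.trans ?_ e.symm
    rw [LinearMap.comp_apply, symPoly, Module.Basis.constr_basis]
    refine (map_symProd (Env.map π) _).trans ?_
    refine congrArg (symProd k) (funext fun i => ?_)
    exact Env.map_gen π _
  exact LinearMap.congr_fun this p

theorem dualPoly_symMap (s : SymmetricAlgebra A M) :
    dualPoly D (symMap γ s) = dualPoly (D.push (homLin π) γ hγ) s := by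
  have : (dualPoly D).comp (symMap γ) = dualPoly (D.push (homLin π) γ hγ) := by
    refine SymmetricAlgebra.algHom_ext (LinearMap.ext fun X => ?_)
    have h := dualPoly_ι (D.push (homLin π) γ hγ) X
    refine Eq.trans ?_ h.symm
    have e : symMap γ (SymmetricAlgebra.ι A M X) = SymmetricAlgebra.ι A L (γ X) := by
      simp [symMap]
    exact (congrArg (dualPoly D) e).trans (dualPoly_ι D (γ X))
  exact DFunLike.congr_fun this s

/-- The dual basis of `M` has the same index set, vectors `π(χᵢ)` and forms `φᵢ ∘ γ`. Hence both
symmetrisations pass through the same polynomial, and `Π ∘ Γ = id` follows. -/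
theorem map_symmetrisation (s : SymmetricAlgebra A M) :
    Env.map π (symmetrisation k D (symMap γ s)) =
      symmetrisation k (D.push (homLin π) γ hγ) s := by
  rw [symmetrisation_apply, symmetrisation_apply, map_symPoly π γ hγ, dualPoly_symMap π γ hγ]

theorem comul_symMap (s : SymmetricAlgebra A M) : Coalgebra.comul (R := A) (symMap γ s) =
    TensorProduct.map (symMap γ).toLinearMap (symMap γ).toLinearMap
      (Coalgebra.comul (R := A) s) := by
  have : (Bialgebra.comulAlgHom A _).comp (symMap γ) =
      (Algebra.TensorProduct.map (symMap γ) (symMap γ)).comp (Bialgebra.comulAlgHom A _) := by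
    refine SymmetricAlgebra.algHom_ext (LinearMap.ext fun X => ?_)
    simp [symMap]
  exact DFunLike.congr_fun this s

variable [CharZero k] [Module.Projective A M]

theorem coringSection_symmetrisation (s : SymmetricAlgebra A M) :
    coringSection π γ hγ D (symmetrisation k (D.push (homLin π) γ hγ) s) =
      symmetrisation k D (symMap γ s) := by
  have h := symmetrisation_bijective (k := k) (D.push (homLin π) γ hγ)
  rw [coringSection, dif_pos h]
  change symmetrisation k D (symMap γ ((LinearEquiv.ofBijective _ h).symm _)) = _
  congr 2
  exact (LinearEquiv.ofBijective _ h).symm_apply_apply s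

/-- Every element of the source is a symmetrisation `S_M(s)`, on which `Γ` is `S_L ∘ 𝒮(γ)`, a
composite of comultiplicative maps. The counit is compatible because `Π` preserves counits and `Π ∘
Γ = id`. -/
theorem isCoringSection_coringSection : IsCoringSection π (coringSection π γ hγ D) := by
  have hS := (symmetrisation_bijective (k := k) (D.push (homLin π) γ hγ)).2
  have h₁ : ∀ u, Env.map π (coringSection π γ hγ D u) = u := by
    intro u
    obtain ⟨s, rfl⟩ := hS u
    rw [coringSection_symmetrisation, map_symmetrisation π γ hγ]
  have h₂ : Env.comul k A L ∘ₗ coringSection π γ hγ D =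
      TensorProduct.map (coringSection π γ hγ D) (coringSection π γ hγ D) ∘ₗ
        Env.comul k A M := by
    refine LinearMap.ext fun u => ?_
    obtain ⟨s, rfl⟩ := hS u
    have e : coringSection π γ hγ D ∘ₗ symmetrisation k (D.push (homLin π) γ hγ) =
        symmetrisation k D ∘ₗ (symMap γ).toLinearMap :=
      LinearMap.ext (coringSection_symmetrisation π γ hγ D)
    rw [LinearMap.comp_apply, LinearMap.comp_apply, coringSection_symmetrisation,
      comul_symmetrisation, comul_symmetrisation, comul_symMap]
    refine (LinearMap.congr_fun (TensorProduct.map_comp _ _ _ _) _).symm.trans ?_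
    refine Eq.trans ?_ (LinearMap.congr_fun (TensorProduct.map_comp _ _ _ _) _)
    rw [e]
  refine ⟨h₁, h₂, ?_, ?_, ?_⟩
  · refine LinearMap.ext fun u => ?_
    rw [LinearMap.comp_apply, ← Env.counit_map π, h₁]
  · have := coringSection_symmetrisation (k := k) π γ hγ D 1
    rwa [map_one (symMap γ), symmetrisation_one, symmetrisation_one] at this
  · intro u a
    have e := LinearMap.congr_fun h₂ u
    rw [LinearMap.comp_apply, LinearMap.comp_apply] at e
    -- Right multiplication by `a` is `u₁(a) u₂`, an expression in the coproduct and the action on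
    -- `A`. `Γ` respects the former, and the latter because `Π` does.
    rw [Env.mul_base_eq, Env.mul_base_eq, e]
    generalize Env.comul k A M u = t
    induction t with
    | zero => simp
    | add x y hx hy => simp only [map_add, hx, hy]
    | tmul x y =>
      rw [TensorProduct.map_tmul, Env.actTmul_tmul, Env.actTmul_tmul, map_smul,
        ← Env.actBase_map π, h₁]

end CoringSection

/-! ## The Hopf-Galois map -/

section Galois

set_option linter.unusedSectionVars false

variable {k : Type uk} {A : Type uA} {L : Type uL}
variable [Field k] [CommRing A] [Algebra k A]
variable [LieRing L] [LieAlgebra k L] [Module A L] [LieRingModule L A] [LieRinehartRing A L]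
variable [LieRinehartAlgebra k A L]

namespace Env

instance : SMulCommClass Aᵐᵒᵖ k (Env k A L) :=
  ⟨fun a c u => by simp only [op_smul_def, smul_mul_assoc]⟩

/-- Left multiplication on the first factor of `𝒰_A(L) ⊗_{Aᵒᵖ} 𝒰_A(L)`. -/
def opLeft (x : Env k A L) : OpTensor k A L →+ OpTensor k A L :=
  (LinearMap.rTensor (LeftOp k A L)
    ({ toFun := fun u => x * u
       map_add' := mul_add x
       map_smul' := fun a u => by simp only [op_smul_def, mul_assoc, RingHom.id_apply] } :
      Env k A L →ₗ[Aᵐᵒᵖ] Env k A L)).toAddMonoidHom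

/-- Right multiplication on the second factor of `𝒰_A(L) ⊗_{Aᵒᵖ} 𝒰_A(L)`. -/
def opRight (y : Env k A L) : OpTensor k A L →+ OpTensor k A L :=
  (LinearMap.lTensor (Env k A L)
    ({ toFun := fun v => toLeftOp (toLeftOp.symm v * y)
       map_add' := fun v w => by simp only [map_add, add_mul]
       map_smul' := fun a v => by
        obtain ⟨v, rfl⟩ := toLeftOp.surjective v
        simp only [smul_toLeftOp, AddEquiv.symm_apply_apply, mul_assoc, RingHom.id_apply] } :
      LeftOp k A L →ₗ[Aᵐᵒᵖ] LeftOp k A L)).toAddMonoidHom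

theorem opLeft_tmul (x u v : Env k A L) :
    opLeft x (u ⊗ₜ toLeftOp v) = (x * u) ⊗ₜ toLeftOp v := rfl

theorem opRight_tmul (y u v : Env k A L) :
    opRight y (u ⊗ₜ toLeftOp v) = u ⊗ₜ toLeftOp (v * y) := rfl

@[elab_as_elim]
theorem opTensor_induction {p : OpTensor k A L → Prop} (t : OpTensor k A L) (zero : p 0)
    (tmul : ∀ u v, p (u ⊗ₜ toLeftOp v)) (add : ∀ x y, p x → p y → p (x + y)) : p t :=
  TensorProduct.induction_on t zero (fun u v => tmul u (toLeftOp.symm v)) add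

theorem mul_base_tmul (u v : Env k A L) (a : A) :
    ((u * base k A L a) ⊗ₜ toLeftOp v : OpTensor k A L) = u ⊗ₜ toLeftOp (base k A L a * v) :=
  TensorProduct.smul_tmul (MulOpposite.op a) u (toLeftOp v)

theorem opLeft_base (a : A) (t : OpTensor k A L) : opLeft (base k A L a) t = a • t := by
  refine opTensor_induction t (by simp) (fun u v => ?_) (fun x y hx hy => ?_)
  · rw [opLeft_tmul, TensorProduct.smul_tmul', smul_def]
  · rw [map_add, hx, hy, smul_add]

theorem opLeft_add (x y : Env k A L) (t : OpTensor k A L) :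
    opLeft (x + y) t = opLeft x t + opLeft y t := by
  refine opTensor_induction t (by simp) (fun u v => ?_) (fun x y hx hy => ?_)
  · simp only [opLeft_tmul, add_mul, TensorProduct.add_tmul]
  · simp only [map_add, hx, hy]; abel

theorem opRight_add (x y : Env k A L) (t : OpTensor k A L) :
    opRight (x + y) t = opRight x t + opRight y t := by
  refine opTensor_induction t (by simp) (fun u v => ?_) (fun x y hx hy => ?_)
  · simp only [opRight_tmul, mul_add, map_add, TensorProduct.tmul_add]
  · simp only [map_add, hx, hy]; abel

theorem opLeft_mul (x y : Env k A L) (t : OpTensor k A L) :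
    opLeft (x * y) t = opLeft x (opLeft y t) := by
  refine opTensor_induction t (by simp) (fun u v => ?_) (fun x y hx hy => ?_)
  · simp only [opLeft_tmul, mul_assoc]
  · simp only [map_add, hx, hy]

theorem opRight_mul (x y : Env k A L) (t : OpTensor k A L) :
    opRight (x * y) t = opRight y (opRight x t) := by
  refine opTensor_induction t (by simp) (fun u v => ?_) (fun x y hx hy => ?_)
  · simp only [opRight_tmul, mul_assoc]
  · simp only [map_add, hx, hy]

theorem opLeft_opRight (x y : Env k A L) (t : OpTensor k A L) :
    opLeft x (opRight y t) = opRight y (opLeft x t) := by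
  refine opTensor_induction t (by simp) (fun u v => ?_) (fun x y hx hy => ?_)
  · simp only [opRight_tmul, opLeft_tmul]
  · simp only [map_add, hx, hy]

theorem opRight_smul (y : Env k A L) (a : A) (t : OpTensor k A L) :
    opRight y (a • t) = a • opRight y t := by
  rw [← opLeft_base, ← opLeft_base, opLeft_opRight]

theorem opRight_one (t : OpTensor k A L) : opRight 1 t = t := by
  refine opTensor_induction t (by simp) (fun u v => ?_) (fun x y hx hy => ?_)
  · simp only [opRight_tmul, mul_one]
  · simp only [map_add, hx, hy]

theorem opLeft_algebra_smul (c : k) (x : Env k A L) (t : OpTensor k A L) :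
    opLeft (c • x) t = c • opLeft x t := by
  refine opTensor_induction t (by simp) (fun u v => ?_) (fun x y hx hy => ?_)
  · simp only [opLeft_tmul, smul_mul_assoc, TensorProduct.smul_tmul']
  · simp only [map_add, hx, hy, smul_add]

theorem algebra_smul_eq (c : k) (t : OpTensor k A L) : c • t = algebraMap k A c • t :=
  (algebraMap_smul A c t).symm

theorem opRight_algebra_smul (c : k) (y : Env k A L) (t : OpTensor k A L) :
    opRight (c • y) t = c • opRight y t := by
  refine opTensor_induction t (by simp) (fun u v => ?_) (fun x y hx hy => ?_)
  · have h : c • y = base k A L (algebraMap k A c) * y := by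
      rw [← smul_def, algebraMap_smul]
    have h' : v * base k A L (algebraMap k A c) = base k A L (algebraMap k A c) * v := by
      rw [AlgHom.commutes]; exact (Algebra.commutes c v).symm
    have h'' : u * base k A L (algebraMap k A c) = base k A L (algebraMap k A c) * u := by
      rw [AlgHom.commutes]; exact (Algebra.commutes c u).symm
    rw [opRight_tmul, opRight_tmul, h, ← mul_assoc, h', mul_assoc, ← mul_base_tmul, h'',
      algebra_smul_eq, TensorProduct.smul_tmul', smul_def]
  · simp only [map_add, hx, hy, smul_add]

variable (k A L) in
/-- The elements of `𝒰_A(L) ⊗_{Aᵒᵖ} 𝒰_A(L)` on which the outer actions of `A` agree. -/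
def opCentre : Submodule A (OpTensor k A L) where
  carrier := {t | ∀ a : A, opRight (base k A L a) t = a • t}
  add_mem' hx hy a := by rw [map_add, hx, hy, smul_add]
  zero_mem' a := by simp
  smul_mem' c x hx a := by
    rw [opRight_smul, hx, smul_comm]

/-- The operator `p ⊗ q ↦ X p ⊗ q - p ⊗ q X`. -/
def adOp (X : L) (t : OpTensor k A L) : OpTensor k A L :=
  opLeft (gen k A L X) t - opRight (gen k A L X) t

theorem adOp_smul (X : L) (a : A) (t : OpTensor k A L) :
    adOp X (a • t) = a • adOp X t + ⁅X, a⁆ • t := by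
  rw [adOp, adOp, opRight_smul, ← opLeft_base, ← opLeft_mul, gen_mul_base, opLeft_add,
    opLeft_mul, opLeft_base, opLeft_base, smul_sub]
  abel

/-- Both outer actions of `a` fail to commute with the operator by the same term `⁅X, a⁆ • t`. -/
theorem adOp_mem (X : L) {t : OpTensor k A L} (ht : t ∈ opCentre k A L) :
    adOp X t ∈ opCentre k A L := by
  intro a
  have h : opRight (base k A L a) (opRight (gen k A L X) t) =
      a • opRight (gen k A L X) t + ⁅X, a⁆ • t := by
    rw [← opRight_mul, gen_mul_base, opRight_add, opRight_mul, ht a, ht ⁅X, a⁆, opRight_smul]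
  have h' : a • opLeft (gen k A L X) t =
      opLeft (gen k A L X) (a • t) - ⁅X, a⁆ • t := by
    rw [← opLeft_base a t, ← opLeft_mul, gen_mul_base, opLeft_add, opLeft_mul, opLeft_base,
      opLeft_base, add_sub_cancel_right]
  rw [adOp, map_sub, h, ← opLeft_opRight, ht a, smul_sub, h']
  abel

variable (k A L) in
/-- `opCentre` as a type. -/
def OpCentre : Type (max uk uA uL) := opCentre k A L

instance : AddCommGroup (OpCentre k A L) := inferInstanceAs (AddCommGroup (opCentre k A L))

instance : Module A (OpCentre k A L) := inferInstanceAs (Module A (opCentre k A L))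

instance : Module k (OpCentre k A L) := Module.compHom _ (algebraMap k A)

instance : IsScalarTower k A (OpCentre k A L) :=
  ⟨fun c a t => by
    rw [Algebra.smul_def, mul_smul]; rfl⟩

variable (k A L) in
/-- The action of `L` on `opCentre`. -/
def adLin : L →ₗ[k] Module.End k (OpCentre k A L) where
  toFun X :=
    { toFun := fun t => (⟨adOp X t.1, adOp_mem X t.2⟩ : opCentre k A L)
      map_add' := fun x y => Subtype.ext (by
        change adOp X (x.1 + y.1) = adOp X x.1 + adOp X y.1
        simp only [adOp, map_add]; abel)
      map_smul' := fun c x => Subtype.ext (by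
        have h : ⁅X, algebraMap k A c⁆ = 0 := by
          rw [Algebra.algebraMap_eq_smul_one]
          exact (lie_smul c X (1 : A)).trans (by rw [lie_one_eq_zero, smul_zero])
        change adOp X (algebraMap k A c • x.1) = algebraMap k A c • adOp X x.1
        rw [adOp_smul, h, zero_smul, add_zero]) }
  map_add' X Y := LinearMap.ext fun t => Subtype.ext (by
    change adOp (X + Y) t.1 = adOp X t.1 + adOp Y t.1
    simp only [adOp, map_add, opLeft_add, opRight_add]
    abel)
  map_smul' c X := LinearMap.ext fun t => Subtype.ext (by
    change adOp (c • X) t.1 = algebraMap k A c • adOp X t.1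
    rw [← algebra_smul_eq]
    simp only [adOp, map_smul, opLeft_algebra_smul, opRight_algebra_smul, smul_sub])

theorem opLeft_sub (x y : Env k A L) (t : OpTensor k A L) :
    opLeft (x - y) t = opLeft x t - opLeft y t :=
  eq_sub_of_add_eq (by rw [← opLeft_add, sub_add_cancel])

theorem opRight_sub (x y : Env k A L) (t : OpTensor k A L) :
    opRight (x - y) t = opRight x t - opRight y t :=
  eq_sub_of_add_eq (by rw [← opRight_add, sub_add_cancel])

variable (k A L) in
/-- The action of `𝒰_A(L)` on `opCentre`. -/
def adAct : Env k A L →ₐ[k] Module.End k (OpCentre k A L) :=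
  lift (R := Module.End k (OpCentre k A L)) (Algebra.lsmul k k (OpCentre k A L)) (adLin k A L)
    (fun a X => LinearMap.ext fun t => Subtype.ext (by
      change adOp (a • X) t.1 = a • adOp X t.1
      -- Linearity in `X` over `A` is the only relation that needs `opCentre`: the scalar in `q a X`
      -- must be carried to the outer left.
      rw [adOp, adOp, gen_smul, opLeft_mul, opRight_mul, t.2 a, opRight_smul, opLeft_base,
        smul_sub]))
    (fun X Y => LinearMap.ext fun t => Subtype.ext (by
      change adOp ⁅X, Y⁆ t.1 = adOp X (adOp Y t.1) - adOp Y (adOp X t.1)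
      simp only [adOp, gen_lie, opLeft_sub, opRight_sub, opLeft_mul, opRight_mul, map_sub,
        opLeft_opRight]
      abel))
    (fun X a => LinearMap.ext fun t => Subtype.ext (by
      change adOp X (a • t.1) - a • adOp X t.1 = ⁅X, a⁆ • t.1
      rw [adOp_smul, add_sub_cancel_left]))

theorem one_tmul_one_mem : ((1 : Env k A L) ⊗ₜ toLeftOp 1 : OpTensor k A L) ∈ opCentre k A L := by
  intro a
  rw [opRight_tmul, one_mul, ← opLeft_base, opLeft_tmul, mul_one]
  have := mul_base_tmul (k := k) (L := L) 1 1 a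
  rw [one_mul, mul_one] at this
  exact this.symm

variable (k A L) in
/-- The map `u ↦ u₊ ⊗ u₋`, constructed through the adjoint action. -/
def xi : Env k A L →ₗ[A] OpTensor k A L where
  toFun u := (adAct k A L u ⟨_, one_tmul_one_mem⟩).1
  map_add' u v := by rw [map_add]; rfl
  map_smul' a u := by
    rw [smul_def, map_mul, adAct, lift_base]; rfl

theorem xi_mem (u : Env k A L) : xi k A L u ∈ opCentre k A L := Subtype.property _

theorem xi_one : xi k A L 1 = 1 ⊗ₜ toLeftOp 1 := by
  change (adAct k A L 1 ⟨_, one_tmul_one_mem⟩).1 = _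
  rw [map_one]; rfl

theorem xi_gen_mul (X : L) (u : Env k A L) : xi k A L (gen k A L X * u) = adOp X (xi k A L u) := by
  change (adAct k A L (gen k A L X * u) ⟨_, one_tmul_one_mem⟩).1 = _
  rw [map_mul]
  change (adAct k A L (gen k A L X) (adAct k A L u _)).1 = _
  rw [adAct, lift_gen]
  rfl

theorem xi_base_mul (a : A) (u : Env k A L) :
    xi k A L (base k A L a * u) = a • xi k A L u := by
  rw [← smul_def, map_smul]

variable (k A L) in
/-- The map `x ⊗ y ↦ x₊ ⊗ x₋ y`. -/
def galoisInv : Env k A L ⊗[A] Env k A L →ₗ[A] OpTensor k A L :=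
  TensorProduct.lift (LinearMap.mk₂ A (fun x y => opRight y (xi k A L x))
    (fun x x' y => by rw [map_add, map_add])
    (fun c x y => by rw [map_smul, opRight_smul])
    (fun x y y' => opRight_add _ _ _)
    (fun c x y => by rw [smul_def, opRight_mul, xi_mem x c, opRight_smul]))

theorem galoisInv_tmul (x y : Env k A L) :
    galoisInv k A L (x ⊗ₜ y) = opRight y (xi k A L x) := rfl

theorem galois_tmul (u v : Env k A L) : galois k A L (u ⊗ₜ toLeftOp v) =
    (mulRight v).lTensor (Env k A L) (comul k A L u) := rfl

theorem galois_opRight (y : Env k A L) (t : OpTensor k A L) :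
    galois k A L (opRight y t) = (mulRight y).lTensor (Env k A L) (galois k A L t) := by
  refine opTensor_induction t (by simp) (fun u v => ?_) (fun x y hx hy => ?_)
  · rw [opRight_tmul, galois_tmul, galois_tmul, ← LinearMap.lTensor_comp_apply]
    congr 2
    ext x
    simp [mul_assoc]
  · simp only [map_add, hx, hy]

theorem primOp_lTensor_mulRight (X : L) (v : Env k A L) (t : Env k A L ⊗[A] Env k A L) :
    primOp X ((mulRight v).lTensor (Env k A L) t) =
      (mulRight v).lTensor (Env k A L) (primOp X t) := by
  induction t with
  | zero => simp
  | add x y hx hy => simp only [map_add, hx, hy]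
  | tmul x y => simp [mul_assoc]

theorem galois_opLeft_gen (X : L) (t : OpTensor k A L) :
    galois k A L (opLeft (gen k A L X) t) = primOp X (galois k A L t) := by
  refine opTensor_induction t (by simp) (fun u v => ?_) (fun x y hx hy => ?_)
  · rw [opLeft_tmul, galois_tmul, galois_tmul, comul_gen_mul, primOp_lTensor_mulRight]
  · simp only [map_add, hx, hy]

/-- Under `β` the operator `adOp X` becomes `X ⊗ 1 + 1 ⊗ X` minus right multiplication by `X` on the
second factor. On `u ⊗ 1` the last two contributions cancel. -/
theorem galois_xi (u : Env k A L) : galois k A L (xi k A L u) = u ⊗ₜ 1 := by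
  induction u using induction_left with
  | one =>
    rw [xi_one, galois_tmul, comul_one]
    simp
  | add u v hu hv => rw [map_add, map_add, hu, hv, TensorProduct.add_tmul]
  | base_mul a u hu =>
    rw [xi_base_mul, map_smul, hu, TensorProduct.smul_tmul', smul_def]
  | gen_mul X u hu =>
    rw [xi_gen_mul, adOp, map_sub, galois_opLeft_gen, galois_opRight, hu]
    simp

theorem galoisInv_comul (u : Env k A L) :
    galoisInv k A L (comul k A L u) = u ⊗ₜ toLeftOp 1 := by
  induction u using induction_left with
  | one => rw [comul_one, galoisInv_tmul, xi_one, opRight_one]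
  | add u v hu hv => rw [map_add, map_add, hu, hv, TensorProduct.add_tmul]
  | base_mul a u hu =>
    rw [comul_base_mul, map_smul, hu, TensorProduct.smul_tmul', smul_def]
  | gen_mul X u hu =>
    rw [comul_gen_mul, ← opLeft_tmul, ← hu]
    generalize comul k A L u = t
    induction t with
    | zero => simp
    | add x y hx hy => simp only [map_add, hx, hy]
    | tmul x y =>
      rw [primOp_tmul, map_add, galoisInv_tmul, galoisInv_tmul, galoisInv_tmul, xi_gen_mul, adOp,
        map_sub, opRight_mul, opLeft_opRight]
      abel

theorem galoisInv_lTensor_mulRight (v : Env k A L) (t : Env k A L ⊗[A] Env k A L) :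
    galoisInv k A L ((mulRight v).lTensor (Env k A L) t) = opRight v (galoisInv k A L t) := by
  induction t with
  | zero => simp
  | add x y hx hy => simp only [map_add, hx, hy]
  | tmul x y => rw [LinearMap.lTensor_tmul, mulRight_apply, galoisInv_tmul, galoisInv_tmul,
      opRight_mul]

/-- The inverse is `x ⊗ y ↦ x₊ ⊗ x₋ y`. Both maps commute with right multiplication on the second
factor, so it suffices to know `galois_xi` and `galoisInv_comul`. -/
theorem galois_bijective : Function.Bijective (galois k A L) := by
  refine Function.bijective_iff_has_inverse.2 ⟨galoisInv k A L, fun t => ?_, fun t => ?_⟩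
  · refine opTensor_induction t (by simp) (fun u v => ?_) (fun x y hx hy => ?_)
    · rw [galois_tmul, galoisInv_lTensor_mulRight, galoisInv_comul, opRight_tmul, one_mul]
    · rw [map_add, map_add, hx, hy]
  · induction t with
    | zero => simp
    | add x y hx hy => rw [map_add, map_add, hx, hy]
    | tmul x y =>
      rw [galoisInv_tmul, galois_opRight, galois_xi, LinearMap.lTensor_tmul, mulRight_apply,
        one_mul]

theorem galois_translation (u : Env k A L) :
    galois k A L (translation k A L u) = u ⊗ₜ 1 := by
  rw [translation, dif_pos galois_bijective]
  exact (LinearEquiv.ofBijective (galois k A L) galois_bijective).apply_symm_apply _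

end Env
end Galois

/-! ## The coaction induced by a morphism -/

section Derivation

variable {A : Type uA} {P : Type uM} {Q : Type uN} [CommRing A]
variable [AddCommGroup P] [Module A P] [AddCommGroup Q] [Module A Q]

/-- The operator `f ⊗ 1 + 1 ⊗ g` on `P ⊗_A Q`, where `f` and `g` satisfy the Leibniz rule with
respect to the same `d : A → A`. -/
def leibnizTensor {d : A → A} (f : P →+ P) (hf : ∀ a p, f (a • p) = a • f p + d a • p)
    (g : Q →+ Q) (hg : ∀ a q, g (a • q) = a • g q + d a • q) : P ⊗[A] Q →+ P ⊗[A] Q :=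
  TensorProduct.liftAddHom
    { toFun := fun p =>
        { toFun := fun q => f p ⊗ₜ q + p ⊗ₜ g q
          map_zero' := by simp
          map_add' := fun q q' => by simp only [map_add, TensorProduct.tmul_add]; abel }
      map_zero' := by ext; simp
      map_add' := fun p p' => by
        ext q
        simp only [map_add, TensorProduct.add_tmul, AddMonoidHom.coe_mk, ZeroHom.coe_mk,
          AddMonoidHom.add_apply]
        abel }
    (fun a p q => by
      simp only [AddMonoidHom.coe_mk, ZeroHom.coe_mk, hf, hg, TensorProduct.tmul_add,
        TensorProduct.add_tmul, TensorProduct.smul_tmul]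
      abel)

end Derivation

section Coaction

set_option linter.unusedSectionVars false

variable {k : Type uk} {A : Type uA} {L : Type uL} {M : Type uM}
variable [Field k] [CommRing A] [Algebra k A]
variable [LieRing L] [LieAlgebra k L] [Module A L] [LieRingModule L A]
variable [LieRinehartRing A L] [LieRinehartAlgebra k A L]
variable [LieRing M] [LieAlgebra k M] [Module A M] [LieRingModule M A]
variable [LieRinehartRing A M] [LieRinehartAlgebra k A M]

namespace Env

theorem counit_base_mul (a : A) (u : Env k A L) :
    counit k A L (base k A L a * u) = a * counit k A L u := by
  rw [← smul_def, map_smul, smul_eq_mul]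

theorem counit_gen_mul (X : L) (u : Env k A L) :
    counit k A L (gen k A L X * u) = ⁅X, counit k A L u⁆ := by
  change actBase k A L (gen k A L X * u) 1 = ⁅X, actBase k A L u 1⁆
  rw [map_mul, Module.End.mul_apply, actBase_gen]

theorem actBase_one (u : Env k A L) : actBase k A L u 1 = counit k A L u := rfl

/-- `ε(u₁) u₂ = u`. -/
theorem lid_rTensor_counit_comul (u : Env k A L) :
    TensorProduct.lid A _ ((counit k A L).rTensor (Env k A L) (comul k A L u)) = u := by
  have h := mul_base_eq u 1
  rw [map_one, mul_one] at h
  conv_rhs => rw [h]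
  generalize comul k A L u = t
  induction t with
  | zero => simp
  | add x y hx hy => simp only [map_add, hx, hy]
  | tmul x y => simp [actBase_one]

theorem gen_mul_smul_map (π : L →ₗ⁅AlgHom.id k A⁆ M) (X : L) (a : A) (u : Env k A M) :
    AddMonoidHom.mulLeft (gen k A M (π X)) (a • u) =
      a • AddMonoidHom.mulLeft (gen k A M (π X)) u + ⁅X, a⁆ • u := by
  have h : ⁅X, a⁆ = ⁅π X, a⁆ := π.apply_lie a X
  rw [AddMonoidHom.coe_mulLeft, gen_mul_smul, h]

/-- The operator `X ⊗ 1 + 1 ⊗ π(X)` on `𝒰_A(L) ⊗_A 𝒰_A(M)`. -/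
def coactOp (π : L →ₗ⁅AlgHom.id k A⁆ M) (X : L) :
    Env k A L ⊗[A] Env k A M →+ Env k A L ⊗[A] Env k A M :=
  leibnizTensor (d := fun a => ⁅X, a⁆) (AddMonoidHom.mulLeft (gen k A L X)) (gen_mul_smul X)
    (AddMonoidHom.mulLeft (gen k A M (π X))) (gen_mul_smul_map π X)

variable (π : L →ₗ⁅AlgHom.id k A⁆ M)

@[simp] theorem coactOp_tmul (X : L) (u : Env k A L) (v : Env k A M) :
    coactOp π X (u ⊗ₜ v) = (gen k A L X * u) ⊗ₜ v + u ⊗ₜ (gen k A M (π X) * v) := rfl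

theorem envCoaction_one : envCoaction π (1 : Env k A L) = 1 ⊗ₜ 1 := by
  have : mapLin π (1 : Env k A L) = 1 := map_one (map π)
  simp [envCoaction, comul_one, this]

theorem envCoaction_base_mul (a : A) (u : Env k A L) :
    envCoaction π (base k A L a * u) = a • envCoaction π u := by
  rw [← smul_def, map_smul]

theorem envCoaction_gen_mul (X : L) (u : Env k A L) :
    envCoaction π (gen k A L X * u) = coactOp π X (envCoaction π u) := by
  rw [envCoaction, LinearMap.comp_apply, LinearMap.comp_apply, comul_gen_mul]
  generalize comul k A L u = t
  induction t with
  | zero => simp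
  | add x y hx hy => simp only [map_add, hx, hy]
  | tmul x y =>
    have h : mapLin π (gen k A L X * y) = gen k A M (π X) * mapLin π y := by
      change map π _ = _ * map π _
      rw [map_mul, map_gen]
    simp [h]

/-- The coaction takes values in the Sweedler-Takeuchi product: both right multiplications commute
with the operators of `L` and agree on `1 ⊗ 1`. -/
theorem rTensor_mulRight_base_envCoaction (a : A) (u : Env k A L) :
    (mulRight (base k A L a)).rTensor (Env k A M) (envCoaction π u) =
      (mulRight (base k A M a)).lTensor (Env k A L) (envCoaction π u) := by
  induction u using induction_left with
  | one =>
    have h : (base k A L a : Env k A L) ⊗ₜ[A] (1 : Env k A M) = 1 ⊗ₜ base k A M a := by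
      have := TensorProduct.smul_tmul (R := A) a (1 : Env k A L) (1 : Env k A M)
      rwa [smul_def, smul_def, mul_one, mul_one] at this
    simp [envCoaction_one, h]
  | add u v hu hv => simp only [map_add, hu, hv]
  | base_mul b u hu => simp only [envCoaction_base_mul, map_smul, hu]
  | gen_mul X u hu =>
    have h₁ : ∀ t, (mulRight (base k A L a)).rTensor (Env k A M) (coactOp π X t) =
        coactOp π X ((mulRight (base k A L a)).rTensor (Env k A M) t) := by
      intro t
      induction t with
      | zero => simp
      | add x y hx hy => simp only [map_add, hx, hy]
      | tmul x y => simp [mul_assoc]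
    have h₂ : ∀ t, (mulRight (base k A M a)).lTensor (Env k A L) (coactOp π X t) =
        coactOp π X ((mulRight (base k A M a)).lTensor (Env k A L) t) := by
      intro t
      induction t with
      | zero => simp
      | add x y hx hy => simp only [map_add, hx, hy]
      | tmul x y => simp [mul_assoc]
    rw [envCoaction_gen_mul, h₁, h₂, hu]

/-- No factorwise product is available on the whole tensor product over `A`, but right
multiplications are left `A`-linear. Multiplicativity is therefore stated through them, and holds
since they commute with the operators of `L`. -/
theorem envCoaction_mul (u v : Env k A L) (T : TensorRep (envCoaction π v)) :
    envCoaction π (u * v) = ∑ j, TensorProduct.map (mulRight (T.fst j)) (mulRight (T.snd j))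
      (envCoaction π u) := by
  induction u using induction_left with
  | one =>
    rw [one_mul]
    refine T.eq_sum.trans (Finset.sum_congr rfl fun j _ => ?_)
    simp [envCoaction_one]
  | add u v hu hv => rw [add_mul, map_add, hu, hv]; simp only [map_add, Finset.sum_add_distrib]
  | base_mul b u hu =>
    rw [mul_assoc, envCoaction_base_mul, hu]
    simp only [envCoaction_base_mul, map_smul, Finset.smul_sum]
  | gen_mul X u hu =>
    rw [mul_assoc, envCoaction_gen_mul, hu, map_sum]
    refine Finset.sum_congr rfl fun j _ => ?_
    rw [envCoaction_gen_mul]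
    generalize envCoaction π u = t
    induction t with
    | zero => simp
    | add x y hx hy => simp only [map_add, hx, hy]
    | tmul x y => simp [mul_assoc]

theorem envCoaction_coassoc (u : Env k A L) :
    TensorProduct.assoc A _ _ _ ((envCoaction π).rTensor (Env k A M) (envCoaction π u)) =
      (comul k A M).lTensor (Env k A L) (envCoaction π u) := by
  induction u using induction_left with
  | one => simp [envCoaction_one, comul_one]
  | add u v hu hv => simp only [map_add, hu, hv]
  | base_mul b u hu => simp only [envCoaction_base_mul, map_smul, hu]
  | gen_mul X u hu =>
    -- The operator `X ⊗ 1 ⊗ 1 + 1 ⊗ π(X) ⊗ 1 + 1 ⊗ 1 ⊗ π(X)`; both sides of coassociativity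
    -- intertwine it with left multiplication by `X`.
    let D : Env k A L ⊗[A] (Env k A M ⊗[A] Env k A M) →+
        Env k A L ⊗[A] (Env k A M ⊗[A] Env k A M) :=
      leibnizTensor (d := fun a => ⁅X, a⁆) (AddMonoidHom.mulLeft (gen k A L X)) (gen_mul_smul X)
        (primOp (π X)) (fun a t => by
          have h : ⁅X, a⁆ = ⁅π X, a⁆ := π.apply_lie a X
          rw [primOp_smul, h])
    have hD : ∀ x z, D (x ⊗ₜ z) = (gen k A L X * x) ⊗ₜ z + x ⊗ₜ primOp (π X) z := fun _ _ => rfl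
    have h₁ : ∀ t, (TensorProduct.assoc A (Env k A L) (Env k A M) (Env k A M))
        ((envCoaction π).rTensor (Env k A M) (coactOp π X t)) =
        D (TensorProduct.assoc A _ _ _ ((envCoaction π).rTensor (Env k A M) t)) := by
      intro t
      induction t with
      | zero => simp
      | add x y hx hy => simp only [map_add, hx, hy]
      | tmul x y =>
        rw [coactOp_tmul, map_add, LinearMap.rTensor_tmul, LinearMap.rTensor_tmul,
          LinearMap.rTensor_tmul, envCoaction_gen_mul]
        generalize envCoaction π x = t
        induction t with
        | zero => simp
        | add x y hx hy =>
          simp only [map_add, TensorProduct.add_tmul] at hx hy ⊢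
          rw [← hx, ← hy]
          abel
        | tmul x z =>
          simp [hD, TensorProduct.add_tmul, TensorProduct.tmul_add]
          abel
    have h₂ : ∀ t, (comul k A M).lTensor (Env k A L) (coactOp π X t) =
        D ((comul k A M).lTensor (Env k A L) t) := by
      intro t
      induction t with
      | zero => simp
      | add x y hx hy => simp only [map_add, hx, hy]
      | tmul x y => simp [hD, comul_gen_mul]
    rw [envCoaction_gen_mul, h₁, h₂, hu]

theorem envCoaction_counit (u : Env k A L) :
    TensorProduct.rid A _ ((counit k A M).lTensor (Env k A L) (envCoaction π u)) = u := by
  induction u using induction_left with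
  | one => simp [envCoaction_one, counit_one]
  | add u v hu hv => simp only [map_add, hu, hv]
  | base_mul b u hu => simp only [envCoaction_base_mul, map_smul, hu]; rfl
  | gen_mul X u hu =>
    conv_rhs => rw [← hu]
    rw [envCoaction_gen_mul]
    generalize envCoaction π u = t
    induction t with
    | zero => simp
    | add x y hx hy => simp only [map_add, hx, hy, mul_add]
    | tmul x y =>
      have h : ⁅X, counit k A M y⁆ = ⁅π X, counit k A M y⁆ := π.apply_lie _ X
      simp [counit_gen_mul, gen_mul_smul, h]

end Env

theorem TensorRep.map_eq_sum {R : Type uR} {M₁ : Type uM} {N₁ : Type uN} [CommRing R]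
    [AddCommGroup M₁] [Module R M₁] [AddCommGroup N₁] [Module R N₁] {x : M₁ ⊗[R] N₁}
    (S : TensorRep x) {V : Type uL} [AddCommGroup V] [Module R V] (f : M₁ ⊗[R] N₁ →ₗ[R] V) :
    f x = ∑ i, f (S.fst i ⊗ₜ S.snd i) := by
  conv_lhs => rw [S.eq_sum, map_sum]

theorem isRightComoduleAlgebra_envCoaction (π : L →ₗ⁅AlgHom.id k A⁆ M) :
    IsRightComoduleAlgebra (Env.base k A L) (envCoaction π) where
  smul_eq _ _ := rfl
  coassoc := LinearMap.ext (Env.envCoaction_coassoc π)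
  counit := LinearMap.ext (Env.envCoaction_counit π)
  takeuchi r a S := by
    have h := Env.rTensor_mulRight_base_envCoaction π a r
    rwa [S.map_eq_sum, S.map_eq_sum] at h
  map_one := Env.envCoaction_one π
  map_mul r r' S T := by
    rw [Env.envCoaction_mul π r r' T, Finset.sum_comm]
    refine Finset.sum_congr rfl fun j _ => ?_
    rw [S.map_eq_sum]
    rfl

/-- The coproduct is the coaction of the identity, so the facts proved for coactions apply to it. -/
theorem Env.envCoaction_id :
    envCoaction (LieRinehartAlgebra.Hom.id : L →ₗ⁅AlgHom.id k A⁆ L) = Env.comul k A L := by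
  have h : Env.map (LieRinehartAlgebra.Hom.id : L →ₗ⁅AlgHom.id k A⁆ L) =
      AlgHom.id k (Env k A L) :=
    Env.hom_ext (fun a => Env.map_base _ a) (fun X => Env.map_gen _ X)
  have hid : Env.mapLin (LieRinehartAlgebra.Hom.id : L →ₗ⁅AlgHom.id k A⁆ L) =
      (LinearMap.id : Env k A L →ₗ[A] Env k A L) :=
    LinearMap.ext fun u => DFunLike.congr_fun h u
  rw [envCoaction, hid, LinearMap.lTensor_id, LinearMap.id_comp]

theorem Env.comul_mem_takeuchi (u : Env k A L) : Env.comul k A L u ∈ Env.takeuchi k A L := by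
  intro a
  rw [← Env.envCoaction_id]
  exact Env.rTensor_mulRight_base_envCoaction _ a u

theorem Env.idCounit_comul (u : Env k A L) : Env.idCounit k A L (Env.comul k A L u) = u := by
  rw [← Env.envCoaction_id]
  exact Env.envCoaction_counit _ u

end Coaction

/-! ## Cleft extensions of enveloping algebras -/

section Cleft

set_option linter.unusedSectionVars false

variable {k : Type uk} {A : Type uA} {N : Type uN} {L : Type uL} {M : Type uM}
variable [Field k] [CommRing A] [Algebra k A]
variable [LieRing N] [LieAlgebra k N] [Module A N] [LieRingModule N A]
variable [LieRing L] [LieAlgebra k L] [Module A L] [LieRingModule L A]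
variable [LieRinehartRing A L] [LieRinehartAlgebra k A L]
variable [LieRing M] [LieAlgebra k M] [Module A M] [LieRingModule M A]
variable [LieRinehartRing A M] [LieRinehartAlgebra k A M]

theorem Env.mul_smul_of_anchor (hN : ∀ (X : N) (a : A), ⁅X, a⁆ = 0) (a : A) (b b' : Env k A N) :
    b * (a • b') = a • (b * b') := by
  rw [Env.smul_def, Env.smul_def, ← mul_assoc, Env.base_central hN, mul_assoc]

theorem Env.map_mul_smul (hN : ∀ (X : N) (a : A), ⁅X, a⁆ = 0) (ι : N →ₗ⁅AlgHom.id k A⁆ L)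
    (a : A) (b : Env k A N) (z : Env k A L) :
    Env.map ι b * (a • z) = a • (Env.map ι b * z) := by
  rw [Env.smul_def, Env.smul_def, ← mul_assoc, ← Env.map_base ι, ← map_mul,
    Env.base_central hN, map_mul, mul_assoc]

theorem exists_tensorRep {R : Type uR} {M₁ : Type uM} {N₁ : Type uN} [CommRing R]
    [AddCommGroup M₁] [Module R M₁] [AddCommGroup N₁] [Module R N₁] (x : M₁ ⊗[R] N₁) :
    Nonempty (TensorRep x) := by
  induction x with
  | zero => exact ⟨⟨0, Fin.elim0, Fin.elim0, by simp⟩⟩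
  | tmul x y => exact ⟨⟨1, fun _ => x, fun _ => y, by simp⟩⟩
  | add x y hx hy =>
    obtain ⟨S⟩ := hx
    obtain ⟨T⟩ := hy
    refine ⟨⟨S.n + T.n, Fin.append S.fst T.fst, Fin.append S.snd T.snd, ?_⟩⟩
    rw [Fin.sum_univ_add]
    simp only [Fin.append_left, Fin.append_right]
    rw [← S.eq_sum, ← T.eq_sum]

/-- The map `b ⊗ v ↦ 𝒰_A(ι)(b) Γ(v)`. -/
def cleftMap (hN : ∀ (X : N) (a : A), ⁅X, a⁆ = 0) (ι : N →ₗ⁅AlgHom.id k A⁆ L)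
    (Γ : Env k A M →ₗ[A] Env k A L) : Env k A N ⊗[A] Env k A M →ₗ[A] Env k A L :=
  TensorProduct.lift (LinearMap.mk₂ A (fun b v => Env.map ι b * Γ v)
    (fun b b' v => by rw [map_add, add_mul])
    (fun c b v => by rw [Env.map_smul_eq, smul_mul_assoc])
    (fun b v v' => by rw [map_add, mul_add])
    (fun c b v => by rw [map_smul, Env.map_mul_smul hN]))

/-- An extension of Lie-Rinehart algebras with a coring section `Γ`, for which
`b ⊗ v ↦ 𝒰_A(ι)(b) Γ(v)` is bijective. -/
structure CleftExtension (ι : N →ₗ⁅AlgHom.id k A⁆ L) (π : L →ₗ⁅AlgHom.id k A⁆ M) where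
  /-- the coring section -/
  sec : Env k A M →ₗ[A] Env k A L
  isCoringSection : IsCoringSection π sec
  exact : Function.Exact ι π
  bijective : Function.Bijective (cleftMap (anchor_eq_zero ι π exact) ι sec)

namespace CleftExtension

variable {ι : N →ₗ⁅AlgHom.id k A⁆ L} {π : L →ₗ⁅AlgHom.id k A⁆ M} (C : CleftExtension ι π)

theorem anchor (C : CleftExtension ι π) (X : N) (a : A) : ⁅X, a⁆ = 0 :=
  anchor_eq_zero ι π C.exact X a

theorem comp_eq_zero (C : CleftExtension ι π) (X : N) : π (ι X) = 0 :=
  C.exact.apply_apply_eq_zero X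

/-- The isomorphism `b ⊗ v ↦ 𝒰_A(ι)(b) Γ(v)`. -/
def equiv : Env k A N ⊗[A] Env k A M ≃ₗ[A] Env k A L := LinearEquiv.ofBijective _ C.bijective

@[simp] theorem equiv_tmul (b : Env k A N) (v : Env k A M) :
    C.equiv (b ⊗ₜ v) = Env.map ι b * C.sec v := rfl

theorem sec_one : C.sec 1 = 1 := C.isCoringSection.map_one

theorem sec_base_mul (a : A) (v : Env k A M) :
    C.sec (Env.base k A M a * v) = Env.base k A L a * C.sec v := C.sec.map_smul a v

@[elab_as_elim]
theorem induction {p : Env k A L → Prop} (z : Env k A L)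
    (tmul : ∀ b v, p (Env.map ι b * C.sec v)) (add : ∀ x y, p x → p y → p (x + y)) : p z := by
  obtain ⟨t, rfl⟩ := C.equiv.surjective z
  induction t with
  | zero => simpa using tmul 0 0
  | add x y hx hy => rw [map_add]; exact add _ _ hx hy
  | tmul b v => exact tmul b v

theorem coaction_map (C : CleftExtension ι π) (b : Env k A N) : envCoaction π (Env.map ι b) = Env.map ι b ⊗ₜ 1 := by
  induction b using Env.induction_left with
  | one => rw [map_one, Env.envCoaction_one]
  | add u v hu hv => rw [map_add, map_add, hu, hv, TensorProduct.add_tmul]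
  | base_mul a u hu =>
    rw [map_mul, Env.map_base, Env.envCoaction_base_mul, hu, TensorProduct.smul_tmul',
      Env.smul_def]
  | gen_mul X u hu =>
    rw [map_mul, Env.map_gen, Env.envCoaction_gen_mul, hu, Env.coactOp_tmul, C.comp_eq_zero,
      map_zero, zero_mul, TensorProduct.tmul_zero, add_zero]

/-- Colinearity of `Γ` is comultiplicativity followed by `Π ∘ Γ = id` on the second factor. -/
theorem coaction_sec (v : Env k A M) :
    envCoaction π (C.sec v) = C.sec.rTensor (Env k A M) (Env.comul k A M v) := by
  have h : Env.comul k A L (C.sec v) = _ := LinearMap.congr_fun C.isCoringSection.comul_comp v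
  have h' : Env.mapLin π ∘ₗ C.sec = LinearMap.id :=
    LinearMap.ext C.isCoringSection.map_section
  rw [envCoaction, LinearMap.comp_apply, h, LinearMap.comp_apply, ← LinearMap.comp_apply,
    LinearMap.lTensor_comp_map, h']
  rfl

theorem coaction_map_mul (C : CleftExtension ι π) (b : Env k A N) (z : Env k A L) (S : TensorRep (envCoaction π z)) :
    envCoaction π (Env.map ι b * z) = ∑ i, (Env.map ι b * S.fst i) ⊗ₜ[A] S.snd i := by
  rw [(isRightComoduleAlgebra_envCoaction π).map_mul _ _
    ⟨1, fun _ => Env.map ι b, fun _ => 1, by simp [C.coaction_map]⟩ S]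
  simp

/-- The representation of the coaction on `Γ(v)` induced by a representation of `Δ(v)`. -/
def secRep {v : Env k A M} (S : TensorRep (Env.comul k A M v)) :
    TensorRep (envCoaction π (C.sec v)) where
  n := S.n
  fst i := C.sec (S.fst i)
  snd := S.snd
  eq_sum := by rw [coaction_sec, S.map_eq_sum]; rfl

theorem coaction_equiv (t : Env k A N ⊗[A] Env k A M) :
    envCoaction π (C.equiv t) = C.equiv.toLinearMap.rTensor (Env k A M)
      ((TensorProduct.assoc A (Env k A N) (Env k A M) (Env k A M)).symm
        ((Env.comul k A M).lTensor (Env k A N) t)) := by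
  induction t with
  | zero => simp
  | add x y hx hy => simp only [map_add, hx, hy]
  | tmul b v =>
    obtain ⟨S⟩ := exists_tensorRep (Env.comul k A M v)
    rw [equiv_tmul, C.coaction_map_mul b _ (C.secRep S), LinearMap.lTensor_tmul]
    conv_rhs => rw [S.eq_sum]
    simp [TensorProduct.tmul_sum, secRep]
    rfl

/-- The projection `𝒰_A(ι)(b) Γ(v) ↦ ε(v) b`. -/
def proj : Env k A L →ₗ[A] Env k A N :=
  (TensorProduct.rid A (Env k A N)).toLinearMap ∘ₗ
    (Env.counit k A M).lTensor (Env k A N) ∘ₗ C.equiv.symm.toLinearMap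

theorem proj_map_mul_sec (b : Env k A N) (v : Env k A M) :
    C.proj (Env.map ι b * C.sec v) = Env.counit k A M v • b := by
  change TensorProduct.rid A _ ((Env.counit k A M).lTensor _ (C.equiv.symm (C.equiv (b ⊗ₜ v)))) = _
  rw [LinearEquiv.symm_apply_apply]
  simp

theorem proj_sec (v : Env k A M) : C.proj (C.sec v) = Env.base k A N (Env.counit k A M v) := by
  have := C.proj_map_mul_sec 1 v
  rwa [map_one, one_mul, Env.smul_def, mul_one] at this

theorem proj_map (b : Env k A N) : C.proj (Env.map ι b) = b := by
  have := C.proj_map_mul_sec b 1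
  rwa [C.sec_one, mul_one, Env.counit_one, one_smul] at this

theorem map_injective (C : CleftExtension ι π) : Function.Injective (Env.map ι) :=
  Function.LeftInverse.injective C.proj_map

theorem proj_map_mul (b : Env k A N) (z : Env k A L) :
    C.proj (Env.map ι b * z) = b * C.proj z := by
  refine C.induction z (fun b' v => ?_) (fun x y hx hy => ?_)
  · rw [← mul_assoc, ← map_mul, proj_map_mul_sec, proj_map_mul_sec,
      Env.mul_smul_of_anchor C.anchor]
  · rw [mul_add, map_add, map_add, mul_add, hx, hy]

/-- `z = 𝒰_A(ι)(p(z₀)) Γ(z₁)` for the coaction `z₀ ⊗ z₁`. -/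
theorem equiv_proj_coaction (z : Env k A L) :
    C.equiv (C.proj.rTensor (Env k A M) (envCoaction π z)) = z := by
  refine C.induction z (fun b v => ?_) (fun x y hx hy => ?_)
  · obtain ⟨S⟩ := exists_tensorRep (Env.comul k A M v)
    rw [C.coaction_map_mul b _ (C.secRep S), map_sum, map_sum]
    have h := Env.lid_rTensor_counit_comul v
    rw [← LinearEquiv.coe_toLinearMap, ← LinearMap.comp_apply, S.map_eq_sum] at h
    conv_rhs => rw [← h, map_sum, Finset.mul_sum]
    refine Finset.sum_congr rfl fun i _ => ?_
    change Env.map ι (C.proj (Env.map ι b * C.sec (S.fst i))) * C.sec (S.snd i) =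
      Env.map ι b * C.sec (Env.counit k A M (S.fst i) • S.snd i)
    rw [proj_map_mul_sec, LinearMap.map_smul, Env.map_mul_smul C.anchor, Env.map_smul_eq,
      smul_mul_assoc]
  · simp only [map_add, hx, hy]

theorem eq_sum_coaction (z : Env k A L) (S : TensorRep (envCoaction π z)) :
    z = ∑ i, Env.map ι (C.proj (S.fst i)) * C.sec (S.snd i) := by
  have h := C.equiv_proj_coaction z
  rw [← LinearEquiv.coe_toLinearMap, ← LinearMap.comp_apply, S.map_eq_sum] at h
  exact h.symm

/-- If the coaction of `z` is `z ⊗ 1`, then `z = p(z₀) Γ(z₁)` reads `z = p(z) Γ(1)`, an element of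
the image. -/
theorem range_map (C : CleftExtension ι π) : Set.range (Env.map ι) = leftHopfKernel π := by
  ext z
  constructor
  · rintro ⟨b, rfl⟩
    exact C.coaction_map b
  · intro hz
    have h := C.eq_sum_coaction z ⟨1, fun _ => z, fun _ => 1, by
      rw [show envCoaction π z = z ⊗ₜ 1 from hz]; simp⟩
    refine ⟨C.proj z, ?_⟩
    rw [Fin.sum_univ_one] at h
    exact (h.trans (by rw [C.sec_one, mul_one])).symm

theorem proj_algebra_smul (c : k) (z : Env k A L) : C.proj (c • z) = c • C.proj z := by
  rw [← algebraMap_smul A c z, map_smul, algebraMap_smul]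

/-- The weak action `v ▷ b`. -/
def act : Env k A M →ₗ[k] Env k A N →ₗ[k] Env k A N :=
  LinearMap.mk₂ k (fun v b => C.proj (C.sec v * Env.map ι b))
    (fun v v' b => by rw [map_add, add_mul, map_add])
    (fun c v b => by rw [LinearMap.map_smul_of_tower, smul_mul_assoc, proj_algebra_smul])
    (fun v b b' => by rw [map_add, mul_add, map_add])
    (fun c v b => by rw [map_smul, mul_smul_comm, proj_algebra_smul])

/-- The cocycle `σ(v, w)`. -/
def cocycle : Env k A M →ₗ[k] Env k A M →ₗ[k] Env k A N :=
  LinearMap.mk₂ k (fun v w => C.proj (C.sec v * C.sec w))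
    (fun v v' b => by rw [map_add, add_mul, map_add])
    (fun c v b => by rw [LinearMap.map_smul_of_tower, smul_mul_assoc, proj_algebra_smul])
    (fun v b b' => by rw [map_add, mul_add, map_add])
    (fun c v b => by rw [LinearMap.map_smul_of_tower, mul_smul_comm, proj_algebra_smul])

theorem act_apply (v : Env k A M) (b : Env k A N) :
    C.act v b = C.proj (C.sec v * Env.map ι b) := rfl

theorem cocycle_apply (v w : Env k A M) : C.cocycle v w = C.proj (C.sec v * C.sec w) := rfl

/-- `Γ(v) b = (v₁ ▷ b) Γ(v₂)`. -/
theorem sec_mul_map (v : Env k A M) (b : Env k A N) (S : TensorRep (Env.comul k A M v)) :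
    C.sec v * Env.map ι b = ∑ i, Env.map ι (C.act (S.fst i) b) * C.sec (S.snd i) := by
  refine C.eq_sum_coaction _ ⟨S.n, fun i => C.sec (S.fst i) * Env.map ι b, S.snd, ?_⟩
  rw [(isRightComoduleAlgebra_envCoaction π).map_mul _ _ (C.secRep S)
    ⟨1, fun _ => Env.map ι b, fun _ => 1, by simp [C.coaction_map]⟩]
  simp only [secRep, Finset.univ_unique, Finset.sum_singleton, mul_one]
  rfl

theorem coaction_sec_mul_sec (v w : Env k A M) (S : TensorRep (Env.comul k A M v))
    (T : TensorRep (Env.comul k A M w)) : envCoaction π (C.sec v * C.sec w) =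
      ∑ i, ∑ j, (C.sec (S.fst i) * C.sec (T.fst j)) ⊗ₜ[A] (S.snd i * T.snd j) :=
  (isRightComoduleAlgebra_envCoaction π).map_mul _ _ (C.secRep S) (C.secRep T)

/-- `Γ(v) Γ(w) = σ(v₁, w₁) Γ(v₂ w₂)`. -/
theorem sec_mul_sec (v w : Env k A M) (S : TensorRep (Env.comul k A M v))
    (T : TensorRep (Env.comul k A M w)) : C.sec v * C.sec w =
      ∑ i, ∑ j, Env.map ι (C.cocycle (S.fst i) (T.fst j)) * C.sec (S.snd i * T.snd j) := by
  conv_lhs => rw [← C.equiv_proj_coaction (C.sec v * C.sec w), C.coaction_sec_mul_sec v w S T]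
  simp only [map_sum]
  rfl

theorem proj_sec_mul_map_mul (v : Env k A M) (b : Env k A N) (z : Env k A L)
    (S : TensorRep (Env.comul k A M v)) : C.proj (C.sec v * Env.map ι b * z) =
      ∑ i, C.act (S.fst i) b * C.proj (C.sec (S.snd i) * z) := by
  rw [C.sec_mul_map v b S, Finset.sum_mul, map_sum]
  refine Finset.sum_congr rfl fun i _ => ?_
  rw [mul_assoc, proj_map_mul]

theorem proj_sec_mul_sec_mul (v w : Env k A M) (z : Env k A L)
    (S : TensorRep (Env.comul k A M v)) (T : TensorRep (Env.comul k A M w)) :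
    C.proj (C.sec v * C.sec w * z) =
      ∑ i, ∑ j, C.cocycle (S.fst i) (T.fst j) * C.proj (C.sec (S.snd i * T.snd j) * z) := by
  simp only [C.sec_mul_sec v w S T, Finset.sum_mul, map_sum, mul_assoc, proj_map_mul]

theorem act_base_mul (a : A) (v : Env k A M) (b : Env k A N) :
    C.act (Env.base k A M a * v) b = Env.base k A N a * C.act v b := by
  rw [act_apply, act_apply, sec_base_mul, mul_assoc, ← Env.smul_def, map_smul, Env.smul_def]

theorem cocycle_base_mul (a : A) (v w : Env k A M) :
    C.cocycle (Env.base k A M a * v) w = Env.base k A N a * C.cocycle v w := by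
  rw [cocycle_apply, cocycle_apply, sec_base_mul, mul_assoc, ← Env.smul_def, map_smul,
    Env.smul_def]

/-- The product rule comes from `Γ(u) b b' = (u₁ ▷ b) Γ(u₂) b'` and the left `U(n)`-linearity of
`p`. -/
theorem isMeasuring : IsMeasuring (Env.base k A N) C.act where
  bilinear a a' u b := by
    rw [mul_assoc, act_base_mul, act_base_mul, mul_assoc, Env.base_central C.anchor]
  act_one u := by rw [act_apply, map_one, mul_one, proj_sec]
  act_mul u b b' S := by
    rw [act_apply, map_mul (Env.map ι), ← mul_assoc, C.proj_sec_mul_map_mul u b _ S]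
    rfl

/-- The cocycle identity is `p(Γ(u) Γ(v) Γ(w))`, expanded from the right on one side and from the
left on the other. The two conditions on `a` come from the position of `a` in `Γ(u) a Γ(v)`. -/
theorem isCocycle : IsCocycle (Env.base k A N) C.act C.cocycle where
  bilinear a a' u b := by
    rw [mul_assoc, cocycle_base_mul, cocycle_base_mul, mul_assoc, Env.base_central C.anchor]
  balanced u a v := by
    rw [cocycle_apply, cocycle_apply, C.isCoringSection.map_mul_base, sec_base_mul, mul_assoc]
  act_base u a v S := by
    have h := C.proj_sec_mul_map_mul u (Env.base k A N a) (C.sec v) S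
    rw [Env.map_base, mul_assoc, ← sec_base_mul] at h
    exact h.symm
  one_left u := by rw [cocycle_apply, sec_one, one_mul, proj_sec]
  one_right u := by rw [cocycle_apply, sec_one, mul_one, proj_sec]
  cocycle u v w S T W := by
    have h := C.proj_sec_mul_sec_mul u v (C.sec w) S T
    rw [mul_assoc, C.sec_mul_sec v w T W] at h
    refine Eq.trans ?_ h
    simp only [Finset.mul_sum, map_sum, ← mul_assoc, C.proj_sec_mul_map_mul u _ _ S]
    rw [Finset.sum_comm]
    refine Finset.sum_congr rfl fun i _ => ?_
    rw [Finset.sum_comm]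
    rfl

/-- The twisted module identity is `p(Γ(u) Γ(v) b)`, expanded from either side. -/
theorem isTwistedModule : IsTwistedModule C.act C.cocycle where
  one_act b := by rw [act_apply, sec_one, one_mul, proj_map]
  twisted u v b S T := by
    have h := C.proj_sec_mul_sec_mul u v (Env.map ι b) S T
    rw [mul_assoc, C.sec_mul_map v b T] at h
    refine Eq.trans ?_ h
    simp only [Finset.mul_sum, map_sum, ← mul_assoc, C.proj_sec_mul_map_mul u _ _ S]
    rw [Finset.sum_comm]
    rfl

end CleftExtension
end Cleft

/-! ## The translation map -/

section Translation

set_option linter.unusedSectionVars false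

variable {k : Type uk} {A : Type uA} {L : Type uL}
variable [Field k] [CommRing A] [Algebra k A]
variable [LieRing L] [LieAlgebra k L] [Module A L] [LieRingModule L A] [LieRinehartRing A L]
variable [LieRinehartAlgebra k A L]

namespace Env

/-- Both are sent by the injective `β` to `u ⊗ 1`; from here on the explicit construction is used.
-/
theorem translation_eq_xi : translation k A L = xi k A L :=
  LinearMap.ext fun u => galois_bijective.1 ((galois_translation u).trans (galois_xi u).symm)

/-- The map `p ⊗ q ↦ p c q`, for `c` commuting with `A`. -/
def opSandwich (c : Env k A L) (hc : ∀ a, c * base k A L a = base k A L a * c) :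
    OpTensor k A L →+ Env k A L :=
  TensorProduct.liftAddHom
    { toFun := fun p =>
        { toFun := fun q => p * c * toLeftOp.symm q
          map_zero' := by simp
          map_add' := fun q q' => by rw [map_add, mul_add] }
      map_zero' := by ext; simp
      map_add' := fun p p' => by ext q; simp [add_mul] }
    (fun a p q => by
      obtain ⟨q, rfl⟩ := toLeftOp.surjective q
      simp only [AddMonoidHom.coe_mk, ZeroHom.coe_mk, op_smul_def, smul_toLeftOp,
        AddEquiv.symm_apply_apply]
      rw [mul_assoc p, ← hc, ← mul_assoc, mul_assoc (p * c)])

variable {c : Env k A L} (hc : ∀ a, c * base k A L a = base k A L a * c)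

theorem opSandwich_tmul (p q : Env k A L) : opSandwich c hc (p ⊗ₜ toLeftOp q) = p * c * q := rfl

theorem opSandwich_opLeft (x : Env k A L) (t : OpTensor k A L) :
    opSandwich c hc (opLeft x t) = x * opSandwich c hc t := by
  refine opTensor_induction t (by simp) (fun u v => ?_) (fun x y hx hy => ?_)
  · rw [opLeft_tmul, opSandwich_tmul, opSandwich_tmul, mul_assoc, mul_assoc, mul_assoc]
  · simp only [map_add, hx, hy, mul_add]

theorem opSandwich_opRight (x : Env k A L) (t : OpTensor k A L) :
    opSandwich c hc (opRight x t) = opSandwich c hc t * x := by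
  refine opTensor_induction t (by simp) (fun u v => ?_) (fun x y hx hy => ?_)
  · rw [opRight_tmul, opSandwich_tmul, opSandwich_tmul, mul_assoc, mul_assoc, mul_assoc]
  · simp only [map_add, hx, hy, add_mul]

theorem opSandwich_smul (a : A) (t : OpTensor k A L) :
    opSandwich c hc (a • t) = a • opSandwich c hc t := by
  rw [← opLeft_base, opSandwich_opLeft, smul_def]

theorem opSandwich_xi_gen_mul (X : L) (u : Env k A L) :
    opSandwich c hc (xi k A L (gen k A L X * u)) =
      gen k A L X * opSandwich c hc (xi k A L u) - opSandwich c hc (xi k A L u) * gen k A L X := by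
  rw [xi_gen_mul, adOp, map_sub, opSandwich_opLeft, opSandwich_opRight]

/-- `u₊ u₋ = ε(u)`. -/
theorem opSandwich_one_xi (u : Env k A L) :
    opSandwich (1 : Env k A L) (fun a => by rw [one_mul, mul_one]) (xi k A L u) =
      base k A L (counit k A L u) := by
  induction u using induction_left with
  | one => rw [xi_one, opSandwich_tmul, counit_one, map_one, mul_one, mul_one]
  | add u v hu hv => simp only [map_add, hu, hv]
  | base_mul a u hu =>
    rw [xi_base_mul, opSandwich_smul, hu, counit_base_mul, map_mul, smul_def]
  | gen_mul X u hu =>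
    rw [opSandwich_xi_gen_mul, hu, gen_mul_base, add_sub_cancel_left, counit_gen_mul]

/-- `u c = u₁₊ c u₁₋ u₂`. -/
theorem mul_eq_sum_opSandwich (u : Env k A L) (S : TensorRep (comul k A L u)) :
    u * c = ∑ i, opSandwich c hc (xi k A L (S.fst i)) * S.snd i := by
  have h := congrArg (opSandwich c hc) (galoisInv_comul u)
  rw [opSandwich_tmul, mul_one, S.map_eq_sum, map_sum] at h
  rw [← h]
  refine Finset.sum_congr rfl fun i _ => ?_
  rw [galoisInv_tmul, opSandwich_opRight]

theorem opTmul_apply (u v : Env k A L) : opTmul v u = u ⊗ₜ toLeftOp v := rfl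

theorem opTmul_zero : opTmul (0 : Env k A L) = 0 :=
  LinearMap.ext fun x => by rw [opTmul_apply, map_zero, TensorProduct.tmul_zero]; rfl

theorem opTmul_add (v w : Env k A L) : opTmul (v + w) = opTmul v + opTmul w :=
  LinearMap.ext fun x => by rw [opTmul_apply, map_add, TensorProduct.tmul_add]; rfl

theorem opTmul_comp_mulRight_base (a : A) (v : Env k A L) :
    opTmul v ∘ₗ mulRight (base k A L a) = opTmul (base k A L a * v) :=
  LinearMap.ext fun x => mul_base_tmul x v a

/-- The map `v ↦ (q ↦ v₁ ⊗ v₂ ⊗ q)`. -/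
def comulTmul (p : Env k A L) : LeftOp k A L →+ Env k A L ⊗[A] OpTensor k A L where
  toFun q := (opTmul (toLeftOp.symm q)).lTensor (Env k A L) (comul k A L p)
  map_zero' := by
    rw [map_zero, opTmul_zero, LinearMap.lTensor_zero, LinearMap.zero_apply]
  map_add' v w := by
    rw [map_add, opTmul_add, LinearMap.lTensor_add, LinearMap.add_apply]

theorem comulTmul_apply (p q : Env k A L) : comulTmul p (toLeftOp q) =
    (opTmul q).lTensor (Env k A L) (comul k A L p) := rfl

theorem comulTmul_mul_base (p q : Env k A L) (a : A) :
    comulTmul (p * base k A L a) (toLeftOp q) = comulTmul p (toLeftOp (base k A L a * q)) := by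
  rw [comulTmul_apply, comulTmul_apply, comul_mul_base, ← LinearMap.lTensor_comp_apply,
    opTmul_comp_mulRight_base]

variable (k A L) in
/-- The additive map `p ⊗ q ↦ p₁ ⊗ p₂ ⊗ q`. -/
def comulOpAdd : OpTensor k A L →+ Env k A L ⊗[A] OpTensor k A L :=
  TensorProduct.liftAddHom
    { toFun := comulTmul
      map_zero' := AddMonoidHom.ext fun q => by
        obtain ⟨q, rfl⟩ := toLeftOp.surjective q
        rw [comulTmul_apply, map_zero, map_zero]; rfl
      map_add' := fun u u' => AddMonoidHom.ext fun q => by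
        obtain ⟨q, rfl⟩ := toLeftOp.surjective q
        rw [AddMonoidHom.add_apply]
        simp only [comulTmul_apply, map_add] }
    (fun a u v => comulTmul_mul_base u (toLeftOp.symm v) a.unop)

theorem comulOpAdd_tmul (p q : Env k A L) : comulOpAdd k A L (p ⊗ₜ toLeftOp q) =
    (opTmul q).lTensor (Env k A L) (comul k A L p) := rfl

theorem comulOpAdd_smul (a : A) (t : OpTensor k A L) :
    comulOpAdd k A L (a • t) = a • comulOpAdd k A L t := by
  refine opTensor_induction t (by simp) (fun u v => ?_) (fun x y hx hy => ?_)
  · rw [TensorProduct.smul_tmul', comulOpAdd_tmul, comulOpAdd_tmul, map_smul, map_smul]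
  · simp only [map_add, hx, hy, smul_add]

/-- `adOp` as an additive map. -/
def adOpHom (X : L) : OpTensor k A L →+ OpTensor k A L :=
  opLeft (gen k A L X) - opRight (gen k A L X)

/-- `u₊₁ ⊗ u₊₂ ⊗ u₋ = u₁ ⊗ u₂₊ ⊗ u₂₋`. -/
theorem comulOpAdd_xi (u : Env k A L) :
    comulOpAdd k A L (xi k A L u) = (xi k A L).lTensor (Env k A L) (comul k A L u) := by
  induction u using induction_left with
  | one => rw [xi_one, comulOpAdd_tmul, comul_one, LinearMap.lTensor_tmul, LinearMap.lTensor_tmul,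
      xi_one]; rfl
  | add u v hu hv => simp only [map_add, hu, hv]
  | base_mul a u hu => rw [xi_base_mul, comulOpAdd_smul, hu, comul_base_mul, map_smul]
  | gen_mul X u hu =>
    -- The operator `X ⊗ 1 + 1 ⊗ adOp X`, which both sides intertwine with left multiplication by
    -- `X`.
    let D : Env k A L ⊗[A] OpTensor k A L →+ Env k A L ⊗[A] OpTensor k A L :=
      leibnizTensor (d := fun a => ⁅X, a⁆) (AddMonoidHom.mulLeft (gen k A L X)) (gen_mul_smul X)
        (adOpHom X) (adOp_smul X)
    have hD : ∀ x z, D (x ⊗ₜ z) = (gen k A L X * x) ⊗ₜ z + x ⊗ₜ adOp X z := fun _ _ => rfl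
    have h₁ : ∀ t, comulOpAdd k A L (adOp X t) = D (comulOpAdd k A L t) := by
      intro t
      refine opTensor_induction t (by simp [adOp]) (fun u v => ?_) (fun x y hx hy => ?_)
      · rw [adOp, opLeft_tmul, opRight_tmul, map_sub, comulOpAdd_tmul, comulOpAdd_tmul,
          comulOpAdd_tmul, comul_gen_mul]
        generalize comul k A L u = s
        induction s with
        | zero => simp
        | add x y hx hy => simp only [map_add, ← hx, ← hy]; abel
        | tmul x y =>
          simp only [primOp_tmul, map_add, LinearMap.lTensor_tmul, hD]
          change _ ⊗ₜ (y ⊗ₜ toLeftOp v) + x ⊗ₜ ((gen k A L X * y) ⊗ₜ toLeftOp v) -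
            x ⊗ₜ (y ⊗ₜ toLeftOp (v * gen k A L X)) = _ ⊗ₜ (y ⊗ₜ toLeftOp v) +
              x ⊗ₜ (adOp X (y ⊗ₜ toLeftOp v))
          rw [adOp, opLeft_tmul, opRight_tmul, TensorProduct.tmul_sub]
          abel
      · have e : adOp X (x + y) = adOp X x + adOp X y := map_add (adOpHom X) x y
        rw [e, map_add, hx, hy, map_add, map_add]
    rw [xi_gen_mul, h₁, hu, comul_gen_mul]
    generalize comul k A L u = s
    induction s with
    | zero => simp
    | add x y hx hy => simp only [map_add, hx, hy]
    | tmul x y => simp only [primOp_tmul, map_add, LinearMap.lTensor_tmul, hD, xi_gen_mul]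

/-- The additive map `p ⊗ q ↦ p f(q)`. -/
def opEvalAdd (f : Env k A L →ₗ[A] A) : OpTensor k A L →+ Env k A L :=
  TensorProduct.liftAddHom
    { toFun := fun p =>
        { toFun := fun q => p * base k A L (f (toLeftOp.symm q))
          map_zero' := by simp
          map_add' := fun q q' => by simp only [map_add, mul_add] }
      map_zero' := by ext; simp
      map_add' := fun p p' => by ext q; simp [add_mul] }
    (fun a p q => by
      obtain ⟨q, rfl⟩ := toLeftOp.surjective q
      simp only [AddMonoidHom.coe_mk, ZeroHom.coe_mk, op_smul_def, smul_toLeftOp,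
        AddEquiv.symm_apply_apply]
      rw [← smul_def, map_smul, smul_eq_mul, map_mul, mul_assoc])

theorem opEvalAdd_tmul (f : Env k A L →ₗ[A] A) (p q : Env k A L) :
    opEvalAdd f (p ⊗ₜ toLeftOp q) = p * base k A L (f q) := rfl

/-- The map `p ⊗ q ↦ p f(q)`. -/
def opEval (f : Env k A L →ₗ[A] A) : OpTensor k A L →ₗ[A] Env k A L where
  toFun := opEvalAdd f
  map_add' := map_add _
  map_smul' a t := by
    refine opTensor_induction t (by simp) (fun u v => ?_) (fun x y hx hy => ?_)
    · rw [TensorProduct.smul_tmul', opEvalAdd_tmul, opEvalAdd_tmul, smul_mul_assoc]; rfl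
    · rw [smul_add, map_add, map_add, hx, hy, smul_add]

theorem opEval_comp_opTmul (f : Env k A L →ₗ[A] A) (q : Env k A L) :
    opEval f ∘ₗ opTmul q = mulRight (base k A L (f q)) := rfl

theorem idCounit_rTensor_mulRight (z : Env k A L) (t : Env k A L ⊗[A] Env k A L) :
    idCounit k A L ((mulRight z).rTensor (Env k A L) t) = idCounit k A L t * z := by
  induction t with
  | zero => simp
  | add x y hx hy => simp only [map_add, hx, hy, add_mul]
  | tmul x y => simp [idCounit, smul_mul_assoc]

end Env

/-! ### Values of Sweedler-Takeuchi representations -/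

namespace TakeuchiRep

variable {E E' : Env k A L ⊗[A] Env.OpTensor k A L}

/-- Applying `f` to the last factor leaves the scalar `f(q)` on the right of the second one. The
Sweedler-Takeuchi condition moves it to the right of the first, where `x ⊗ y ↦ ε(y) x` respects it.
The right-hand side depends on `E` alone. -/
theorem sum_idCounit_mul (R : TakeuchiRep E) (f : Env k A L →ₗ[A] A) :
    ∑ i, Env.idCounit k A L (R.t i) * Env.base k A L (f (R.q i)) =
      Env.idCounit k A L ((Env.opEval f).lTensor (Env k A L) E) := by
  conv_rhs => rw [R.eq_sum, map_sum, map_sum]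
  refine Finset.sum_congr rfl fun i _ => ?_
  rw [← LinearMap.lTensor_comp_apply, Env.opEval_comp_opTmul, ← R.mem i,
    Env.idCounit_rTensor_mulRight]

/-- A splitting `s` of the free cover writes each last factor in coordinates. Each coordinate of the
value depends only on `E` by `sum_idCounit_mul`, and the value is recovered from its coordinates. -/
theorem value_eq [Module.Projective A (Env k A L)] (R R' : TakeuchiRep E) :
    R.value = R'.value := by
  obtain ⟨s, hs⟩ := Module.projective_def'.1 (inferInstance : Module.Projective A (Env k A L))
  let V : TakeuchiRep E → (Env k A L →₀ Env k A L) := fun R => ∑ i,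
    (s (R.q i)).mapRange (fun a => Env.idCounit k A L (R.t i) * Env.base k A L a) (by simp)
  let ev : (Env k A L →₀ Env k A L) →+ Env k A L :=
    Finsupp.liftAddHom fun e => AddMonoidHom.mulRight e
  have hV : ∀ R : TakeuchiRep E, ev (V R) = R.value := by
    intro R
    rw [map_sum, value]
    refine Finset.sum_congr rfl fun i _ => ?_
    have h := LinearMap.congr_fun hs (R.q i)
    rw [LinearMap.comp_apply, Finsupp.linearCombination_apply, LinearMap.id_apply] at h
    conv_rhs => rw [← h]
    rw [Finsupp.liftAddHom_apply, Finsupp.sum_mapRange_index (by simp), Finsupp.sum, Finsupp.sum,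
      Finset.mul_sum]
    refine Finset.sum_congr rfl fun e _ => ?_
    rw [AddMonoidHom.mulRight_apply, mul_assoc]
    rfl
  rw [← hV, ← hV]
  congr 1
  ext e
  have h : ∀ R : TakeuchiRep E, V R e =
      ∑ i, Env.idCounit k A L (R.t i) * Env.base k A L ((Finsupp.lapply e ∘ₗ s) (R.q i)) := by
    intro R
    simp [V, Finsupp.finsetSum_apply]
  rw [h, h, sum_idCounit_mul, sum_idCounit_mul]

theorem exists_single {t : Env k A L ⊗[A] Env k A L} (ht : t ∈ Env.takeuchi k A L)
    (q : Env k A L) : ∃ R : TakeuchiRep ((Env.opTmul q).lTensor (Env k A L) t),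
      R.value = Env.idCounit k A L t * q :=
  ⟨⟨1, fun _ => t, fun _ => q, fun _ => ht, by simp⟩, by simp [value]⟩

theorem exists_zero : ∃ R : TakeuchiRep (0 : Env k A L ⊗[A] Env.OpTensor k A L), R.value = 0 :=
  ⟨⟨0, Fin.elim0, Fin.elim0, fun i => i.elim0, by simp⟩, by simp [value]⟩

theorem exists_add {z z' : Env k A L} (h : ∃ R : TakeuchiRep E, R.value = z)
    (h' : ∃ R : TakeuchiRep E', R.value = z') :
    ∃ R : TakeuchiRep (E + E'), R.value = z + z' := by
  obtain ⟨R, rfl⟩ := h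
  obtain ⟨R', rfl⟩ := h'
  refine ⟨⟨R.n + R'.n, Fin.append R.t R'.t, Fin.append R.q R'.q, fun i => ?_, ?_⟩, ?_⟩
  · refine Fin.addCases (fun i => ?_) (fun i => ?_) i
    · rw [Fin.append_left]; exact R.mem i
    · rw [Fin.append_right]; exact R'.mem i
  · rw [Fin.sum_univ_add]
    simp only [Fin.append_left, Fin.append_right]
    rw [← R.eq_sum, ← R'.eq_sum]
  · simp only [value, Fin.sum_univ_add, Fin.append_left, Fin.append_right]

theorem exists_sum {J : Type*} (s : Finset J) {E : J → Env k A L ⊗[A] Env.OpTensor k A L}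
    {z : J → Env k A L} (h : ∀ i, ∃ R : TakeuchiRep (E i), R.value = z i) :
    ∃ R : TakeuchiRep (∑ i ∈ s, E i), R.value = ∑ i ∈ s, z i := by
  classical
  induction s using Finset.induction with
  | empty => exact exists_zero
  | insert i s hi ih =>
    rw [Finset.sum_insert hi, Finset.sum_insert hi]
    exact exists_add (h i) ih

end TakeuchiRep

end Translation

/-! ## The weak action, the cocycle and the crossed product of a cleft extension -/

section Transport

variable {k : Type uk} {A : Type uA} {L : Type uL} {B : Type uM} {B₁ : Type uN}
variable [Field k] [CommRing A] [Algebra k A]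
variable [LieRing L] [LieAlgebra k L] [Module A L] [LieRingModule L A] [LieRinehartRing A L]
variable [LieRinehartAlgebra k A L]
variable [Ring B] [Algebra k B] [Module A B] [Ring B₁] [Algebra k B₁] [Module A B₁]

/-- A comodule algebra structure can be transported along an isomorphism. -/
theorem IsRightComoduleAlgebra.of_equiv {j : A →ₐ[k] B} {δ : B →ₗ[A] B ⊗[A] Env k A L}
    {j' : A →ₐ[k] B₁} {δ' : B₁ →ₗ[A] B₁ ⊗[A] Env k A L} (h : IsRightComoduleAlgebra j' δ')
    (Φ : B ≃ₐ[k] B₁) (e : B ≃ₗ[A] B₁) (he : ∀ x, e x = Φ x) (hj : ∀ a, Φ (j a) = j' a)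
    (hδ : ∀ x, δ' (Φ x) = e.toLinearMap.rTensor (Env k A L) (δ x)) :
    IsRightComoduleAlgebra j δ := by
  have hinj : Function.Injective (e.toLinearMap.rTensor (Env k A L)) :=
    (LinearEquiv.rTensor (Env k A L) e).injective
  have rep : ∀ {r : B} (S : TensorRep (δ r)), δ' (Φ r) = ∑ i, Φ (S.fst i) ⊗ₜ S.snd i :=
    fun {r} S => by
      rw [hδ, S.map_eq_sum]
      simp only [LinearMap.rTensor_tmul, LinearEquiv.coe_coe, he]
  refine ⟨fun a r => ?_, LinearMap.ext fun r => ?_, LinearMap.ext fun r => ?_, fun r a S => ?_, ?_,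
    fun r r' S T => ?_⟩
  · apply Φ.injective
    rw [← he, map_smul, he, h.smul_eq, _root_.map_mul, hj]
  · have hinj' : Function.Injective (e.toLinearMap.rTensor (Env k A L ⊗[A] Env k A L)) :=
      (LinearEquiv.rTensor (Env k A L ⊗[A] Env k A L) e).injective
    apply hinj'
    have h₁ : ∀ t : B ⊗[A] Env k A L, e.toLinearMap.rTensor (Env k A L ⊗[A] Env k A L)
        (TensorProduct.assoc A _ _ _ (δ.rTensor (Env k A L) t)) =
        TensorProduct.assoc A _ _ _ (δ'.rTensor (Env k A L)
          (e.toLinearMap.rTensor (Env k A L) t)) := by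
      intro t
      induction t with
      | zero => simp
      | add x y hx hy => simp only [map_add, hx, hy]
      | tmul x y =>
        simp only [LinearMap.rTensor_tmul, LinearEquiv.coe_coe, he, hδ]
        generalize δ x = s
        induction s with
        | zero => simp
        | add x y hx hy => simp only [map_add, TensorProduct.add_tmul, hx, hy]
        | tmul x z => simp [he]
    have h₂ : ∀ t : B ⊗[A] Env k A L, e.toLinearMap.rTensor (Env k A L ⊗[A] Env k A L)
        ((Env.comul k A L).lTensor B t) =
        (Env.comul k A L).lTensor B₁ (e.toLinearMap.rTensor (Env k A L) t) := by
      intro t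
      induction t with
      | zero => simp
      | add x y hx hy => simp only [map_add, hx, hy]
      | tmul x y => simp
    refine (h₁ (δ r)).trans (Eq.trans ?_ (h₂ (δ r)).symm)
    rw [← hδ]
    exact LinearMap.congr_fun h.coassoc (Φ r)
  · apply Φ.injective
    have h₁ : ∀ t : B ⊗[A] Env k A L, e (TensorProduct.rid A B ((Env.counit k A L).lTensor B t)) =
        TensorProduct.rid A B₁ ((Env.counit k A L).lTensor B₁
          (e.toLinearMap.rTensor (Env k A L) t)) := by
      intro t
      induction t with
      | zero => simp
      | add x y hx hy => simp only [map_add, hx, hy]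
      | tmul x y => simp
    refine (he _).symm.trans ((h₁ (δ r)).trans ?_)
    rw [← hδ]
    exact LinearMap.congr_fun h.counit (Φ r)
  · apply hinj
    simp only [map_sum, LinearMap.rTensor_tmul, LinearEquiv.coe_coe, he, _root_.map_mul, hj]
    exact h.takeuchi (Φ r) a ⟨S.n, fun i => Φ (S.fst i), S.snd, rep S⟩
  · apply hinj
    rw [← hδ, _root_.map_one, h.map_one]
    simp [he]
  · apply hinj
    have := h.map_mul (Φ r) (Φ r')
      ⟨S.n, fun i => Φ (S.fst i), S.snd, rep S⟩ ⟨T.n, fun i => Φ (T.fst i), T.snd, rep T⟩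
    rw [← hδ, _root_.map_mul, this]
    simp only [map_sum, LinearMap.rTensor_tmul, LinearEquiv.coe_coe, he, _root_.map_mul]

end Transport

/-! ### The formulas for the weak action and the cocycle through the translation map -/

section Cleft

set_option linter.unusedSectionVars false

variable {k : Type uk} {A : Type uA} {N : Type uN} {L : Type uL} {M : Type uM}
variable [Field k] [CommRing A] [Algebra k A]
variable [LieRing N] [LieAlgebra k N] [Module A N] [LieRingModule N A]
variable [LieRing L] [LieAlgebra k L] [Module A L] [LieRingModule L A]
variable [LieRinehartRing A L] [LieRinehartAlgebra k A L]
variable [LieRing M] [LieAlgebra k M] [Module A M] [LieRingModule M A]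
variable [LieRinehartRing A M] [LieRinehartAlgebra k A M]
variable {ι : N →ₗ⁅AlgHom.id k A⁆ L} {π : L →ₗ⁅AlgHom.id k A⁆ M}

namespace CleftExtension

variable (C : CleftExtension ι π)

theorem rTensor_lTensor_comm {R : Type*} [CommRing R] {P P' Q Q' : Type*} [AddCommGroup P]
    [AddCommGroup P'] [AddCommGroup Q] [AddCommGroup Q'] [Module R P] [Module R P'] [Module R Q]
    [Module R Q'] (f : P →ₗ[R] P') (g : Q →ₗ[R] Q') (t : P ⊗[R] Q) :
    f.rTensor Q' (g.lTensor P t) = g.lTensor P' (f.rTensor Q t) := by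
  rw [← LinearMap.comp_apply, ← LinearMap.comp_apply, LinearMap.rTensor_comp_lTensor,
    LinearMap.lTensor_comp_rTensor]

theorem map_mul_base (C : CleftExtension ι π) (b : Env k A N) (a : A) :
    Env.map ι b * Env.base k A L a = Env.base k A L a * Env.map ι b := by
  rw [← Env.map_base ι, ← map_mul, ← map_mul, Env.base_central C.anchor]

/-- The image of `𝒰_A(N)` is stable under commutators. -/
theorem exists_map_eq_commutator (C : CleftExtension ι π) (X : L) (b : Env k A N) :
    ∃ b', Env.map ι b' = Env.gen k A L X * Env.map ι b - Env.map ι b * Env.gen k A L X := by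
  induction b using Env.induction_left with
  | one => exact ⟨0, by simp⟩
  | add u v hu hv =>
    obtain ⟨u', hu⟩ := hu
    obtain ⟨v', hv⟩ := hv
    exact ⟨u' + v', by rw [map_add, hu, hv, map_add, mul_add, add_mul]; abel⟩
  | base_mul a u hu =>
    obtain ⟨u', hu⟩ := hu
    refine ⟨Env.base k A N a * u' + Env.base k A N ⁅X, a⁆ * u, ?_⟩
    rw [map_add, map_mul, map_mul, map_mul, hu, Env.map_base, Env.map_base, ← mul_assoc,
      Env.gen_mul_base, mul_sub, add_mul]
    simp only [mul_assoc]
    abel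
  | gen_mul Y u hu =>
    obtain ⟨u', hu⟩ := hu
    have hXY : π ⁅X, ι Y⁆ = 0 := by
      have h : π ⁅X, ι Y⁆ = ⁅π X, π (ι Y)⁆ := LieHom.map_lie π.toLieHom X (ι Y)
      rw [h, C.comp_eq_zero, lie_zero]
    -- By exactness the bracket comes from `N`, which is an ideal in `L`.
    obtain ⟨Z, hZ⟩ := (C.exact _).1 hXY
    refine ⟨Env.gen k A N Z * u + Env.gen k A N Y * u', ?_⟩
    rw [map_add, map_mul, map_mul, map_mul, hu, Env.map_gen, Env.map_gen]
    have hZ' : Env.gen k A L (ι Z) = Env.gen k A L ⁅X, ι Y⁆ := congrArg _ hZ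
    rw [hZ', Env.gen_lie, mul_sub, sub_mul]
    simp only [mul_assoc]
    abel

/-- On generators `u₊ b u₋` is an iterated commutator, since this is how `ξ` is built, and `U(n)` is
stable under commutators with `L`. -/
theorem exists_map_eq_opSandwich (C : CleftExtension ι π) (b : Env k A N) (u : Env k A L) :
    ∃ b', Env.map ι b' = Env.opSandwich (Env.map ι b) (C.map_mul_base b) (Env.xi k A L u) := by
  induction u using Env.induction_left with
  | one => exact ⟨b, by rw [Env.xi_one, Env.opSandwich_tmul, one_mul, mul_one]⟩
  | add u v hu hv =>
    obtain ⟨u', hu⟩ := hu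
    obtain ⟨v', hv⟩ := hv
    exact ⟨u' + v', by rw [map_add, hu, hv, map_add, map_add]⟩
  | base_mul a u hu =>
    obtain ⟨u', hu⟩ := hu
    exact ⟨a • u', by rw [Env.map_smul_eq, hu, Env.xi_base_mul, Env.opSandwich_smul]⟩
  | gen_mul X u hu =>
    obtain ⟨u', hu⟩ := hu
    obtain ⟨b', hb⟩ := C.exists_map_eq_commutator X u'
    exact ⟨b', by rw [hb, Env.opSandwich_xi_gen_mul, hu]⟩

/-- `v ▷ b = Γ(v)₊ b Γ(v)₋`. -/
theorem map_act (v : Env k A M) (b : Env k A N) : Env.map ι (C.act v b) =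
    Env.opSandwich (Env.map ι b) (C.map_mul_base b) (Env.xi k A L (C.sec v)) := by
  choose f hf using fun x : Env k A M => C.exists_map_eq_opSandwich b (C.sec x)
  obtain ⟨S⟩ := exists_tensorRep (Env.comul k A M v)
  have hS : Env.comul k A L (C.sec v) = ∑ i, C.sec (S.fst i) ⊗ₜ C.sec (S.snd i) := by
    have h : Env.comul k A L (C.sec v) = _ := LinearMap.congr_fun C.isCoringSection.comul_comp v
    rw [h, LinearMap.comp_apply, S.map_eq_sum]
    rfl
  -- This gives `Γ(v) b` as the sum of the `(Γ(v₁)₊ b Γ(v₁)₋) Γ(v₂)`. The bracketed factors lie in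
  -- `U(n)`, so `p` replaces `Γ(v₂)` by `ε(v₂)`, and the counit identity `ε(v₂) v₁ = v` remains.
  have h := Env.mul_eq_sum_opSandwich (C.map_mul_base b) (C.sec v)
    ⟨S.n, fun i => C.sec (S.fst i), fun i => C.sec (S.snd i), hS⟩
  have hv := Env.envCoaction_counit (LieRinehartAlgebra.Hom.id : M →ₗ⁅AlgHom.id k A⁆ M) v
  rw [Env.envCoaction_id, ← LinearEquiv.coe_toLinearMap, ← LinearMap.comp_apply,
    S.map_eq_sum] at hv
  conv_rhs => rw [← hv]
  rw [act_apply, h]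
  simp only [map_sum]
  refine Finset.sum_congr rfl fun i _ => ?_
  rw [← hf, proj_map_mul_sec, Env.map_smul_eq, hf, ← Env.opSandwich_smul, ← map_smul, ← map_smul]
  simp

theorem isWeakAdjoint : IsWeakAdjoint ι C.sec C.act := by
  intro v b S
  rw [C.map_act, ← Env.translation_eq_xi]
  conv_lhs => rw [S.eq_sum, map_sum]
  rfl

/-- Left multiplication by an element of `𝒰_A(N)`. -/
def mapMul (b : Env k A N) : Env k A L →ₗ[A] Env k A L where
  toFun z := Env.map ι b * z
  map_add' := mul_add _
  map_smul' a z := Env.map_mul_smul C.anchor ι a b z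

theorem mapMul_apply (b : Env k A N) (z : Env k A L) : C.mapMul b z = Env.map ι b * z := rfl

theorem rTensor_mapMul_mem_takeuchi (b : Env k A N) {t : Env k A L ⊗[A] Env k A L}
    (ht : t ∈ Env.takeuchi k A L) :
    (C.mapMul b).rTensor (Env k A L) t ∈ Env.takeuchi k A L := by
  intro a
  have h : Env.mulRight (Env.base k A L a) ∘ₗ C.mapMul b =
      C.mapMul b ∘ₗ Env.mulRight (Env.base k A L a) := by
    ext z
    simp [mapMul_apply, mul_assoc]
  rw [← LinearMap.rTensor_comp_apply, h, LinearMap.rTensor_comp_apply, ht a,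
    rTensor_lTensor_comm]

theorem idCounit_rTensor_mapMul (b : Env k A N) (t : Env k A L ⊗[A] Env k A L) :
    Env.idCounit k A L ((C.mapMul b).rTensor (Env k A L) t) =
      Env.map ι b * Env.idCounit k A L t := by
  induction t with
  | zero => simp
  | add x y hx hy => simp only [map_add, hx, hy, mul_add]
  | tmul x y => simp [Env.idCounit, mapMul_apply, Env.map_mul_smul C.anchor]

/-- On `p ⊗ q` the element is `b p₁ ⊗ p₂ ⊗ q`, whose first two factors form an element of the
Sweedler-Takeuchi product because `Δ(p)` does. Its value is `ε(p₂) b p₁ q = b p q`. -/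
theorem exists_takeuchiRep_comulOpAdd (b : Env k A N) (t : Env.OpTensor k A L) :
    ∃ R : TakeuchiRep ((C.mapMul b).rTensor (Env.OpTensor k A L) (Env.comulOpAdd k A L t)),
      R.value = Env.map ι b * Env.opSandwich (1 : Env k A L) (fun a => by rw [one_mul, mul_one])
        t := by
  refine Env.opTensor_induction t ?_ (fun p q => ?_) (fun x y hx hy => ?_)
  · simp only [map_zero, mul_zero]
    exact TakeuchiRep.exists_zero
  · obtain ⟨R, hR⟩ := TakeuchiRep.exists_single
      (C.rTensor_mapMul_mem_takeuchi b (Env.comul_mem_takeuchi p)) q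
    have e : (C.mapMul b).rTensor (Env.OpTensor k A L)
        (Env.comulOpAdd k A L (p ⊗ₜ Env.toLeftOp q)) =
        (Env.opTmul q).lTensor (Env k A L)
          ((C.mapMul b).rTensor (Env k A L) (Env.comul k A L p)) := by
      rw [Env.comulOpAdd_tmul, rTensor_lTensor_comm]
    rw [e, Env.opSandwich_tmul]
    refine ⟨R, hR.trans ?_⟩
    rw [idCounit_rTensor_mapMul, Env.idCounit_comul, mul_one, mul_assoc]
  · rw [map_add, map_add, map_add, mul_add]
    exact TakeuchiRep.exists_add hx hy

theorem cocycle_eq_sum (v w : Env k A M) (S : TensorRep (Env.comul k A M v))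
    (T : TensorRep (Env.comul k A M w)) : C.cocycle v w = ∑ i, ∑ j,
      C.cocycle (S.fst i) (T.fst j) * Env.base k A N (Env.counit k A M (S.snd i * T.snd j)) := by
  have h := C.proj_sec_mul_sec_mul v w 1 S T
  simp only [mul_one, proj_sec] at h
  exact h

/-- The left side is the coaction of `Γ(v) Γ(w)` with `ξ ∘ Γ` applied to the second factor.
Rewriting the product as `σ(v₁, w₁) Γ(v₂ w₂)` and using `comulOpAdd_xi` exhibits it as a sum of
terms `b p₁ ⊗ p₂ ⊗ q`, which makes the Sweedler-Takeuchi condition visible. -/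
theorem cocycleTensor_eq (v w : Env k A M) (S : TensorRep (Env.comul k A M v))
    (T : TensorRep (Env.comul k A M w)) : cocycleTensor C.sec S T =
      ∑ i, ∑ j, (C.mapMul (C.cocycle (S.fst i) (T.fst j))).rTensor (Env.OpTensor k A L)
        (Env.comulOpAdd k A L (Env.xi k A L (C.sec (S.snd i * T.snd j)))) := by
  have h₁ : cocycleTensor C.sec S T = (Env.xi k A L ∘ₗ C.sec).lTensor (Env k A L)
      (envCoaction π (C.sec v * C.sec w)) := by
    rw [C.coaction_sec_mul_sec v w S T, cocycleTensor, Env.translation_eq_xi]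
    simp only [map_sum]
    rfl
  rw [h₁]
  conv_lhs => rw [C.sec_mul_sec v w S T]
  simp only [map_sum]
  refine Finset.sum_congr rfl fun i _ => Finset.sum_congr rfl fun j _ => ?_
  generalize S.snd i * T.snd j = z
  generalize C.cocycle (S.fst i) (T.fst j) = b
  have h₂ : envCoaction π (Env.map ι b * C.sec z) =
      (C.mapMul b ∘ₗ C.sec).rTensor (Env k A M) (Env.comul k A M z) := by
    obtain ⟨W⟩ := exists_tensorRep (Env.comul k A M z)
    rw [C.coaction_map_mul b _ (C.secRep W), W.map_eq_sum]
    rfl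
  have h₃ : Env.comul k A L (C.sec z) = TensorProduct.map C.sec C.sec (Env.comul k A M z) :=
    LinearMap.congr_fun C.isCoringSection.comul_comp z
  rw [h₂, Env.comulOpAdd_xi, h₃]
  generalize Env.comul k A M z = t
  induction t with
  | zero => simp
  | add x y hx hy => simp only [map_add, hx, hy]
  | tmul x y => rfl

/-- With the representation from `cocycleTensor_eq`, the rule `u₊ u₋ = ε(u)` gives the value `σ(v₁,
w₁) ε(v₂ w₂) = σ(v, w)`. Any other representation has the same value by `TakeuchiRep.value_eq`. -/
theorem isSectionCocycle [Module.Projective A (Env k A L)] :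
    IsSectionCocycle ι C.sec C.cocycle := by
  intro v w S T
  obtain ⟨R, hR⟩ : ∃ R : TakeuchiRep (cocycleTensor C.sec S T),
      R.value = Env.map ι (C.cocycle v w) := by
    rw [C.cocycleTensor_eq v w S T, C.cocycle_eq_sum v w S T]
    simp only [map_sum, map_mul]
    refine TakeuchiRep.exists_sum _ fun i => TakeuchiRep.exists_sum _ fun j => ?_
    obtain ⟨R, hR⟩ := C.exists_takeuchiRep_comulOpAdd (C.cocycle (S.fst i) (T.fst j))
      (Env.xi k A L (C.sec (S.snd i * T.snd j)))
    refine ⟨R, hR.trans ?_⟩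
    have h : Env.counit k A L (C.sec (S.snd i * T.snd j)) = _ :=
      LinearMap.congr_fun C.isCoringSection.counit_comp _
    rw [Env.opSandwich_one_xi, h, Env.map_base]
  exact ⟨⟨R⟩, fun Q => hR.symm.trans (TakeuchiRep.value_eq R Q)⟩

/-! ### The crossed product -/

/-- `u ↦ σ(u, w)` as an `A`-linear map. -/
def cocycleLin (w : Env k A M) : Env k A M →ₗ[A] Env k A N where
  toFun u := C.cocycle u w
  map_add' u v := by rw [map_add, LinearMap.add_apply]
  map_smul' a u := C.cocycle_base_mul a u w

/-- The map `x ⊗ t ↦ (x ▷ b) f(t)`. -/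
def actMul (b : Env k A N) {V : Type*} [AddCommGroup V] [Module A V] (f : V →ₗ[A] Env k A L) :
    Env k A M ⊗[A] V →ₗ[A] Env k A L :=
  TensorProduct.lift (LinearMap.mk₂ A (fun x t => Env.map ι (C.act x b) * f t)
    (fun x x' t => by rw [map_add, LinearMap.add_apply, map_add, add_mul])
    (fun a x t => by
      rw [Env.smul_def, act_base_mul, ← Env.smul_def, Env.map_smul_eq, smul_mul_assoc])
    (fun x t t' => by rw [map_add, mul_add])
    (fun a x t => by rw [map_smul, Env.map_mul_smul C.anchor]))

theorem actMul_tmul (b : Env k A N) {V : Type*} [AddCommGroup V] [Module A V]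
    (f : V →ₗ[A] Env k A L) (x : Env k A M) (t : V) :
    C.actMul b f (x ⊗ₜ t) = Env.map ι (C.act x b) * f t := rfl

/-- This is the crossed product formula inside `U(g)`. It follows from moving `b` and then `Γ(v)`
through `Γ(u)`. -/
theorem sec_mul_map_mul_sec (u v : Env k A M) (b : Env k A N)
    (S : TensorRep₃ (Env.comul₃ (k := k) u)) (T : TensorRep (Env.comul k A M v)) :
    C.sec u * Env.map ι b * C.sec v = ∑ i, ∑ j,
      Env.map ι (C.act (S.fst i) b * C.cocycle (S.snd i) (T.fst j)) *
        C.sec (S.trd i * T.snd j) := by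
  -- With `v₁ ⊗ v₂` fixed, `x ⊗ y ↦ σ(x, v₁) Γ(y v₂)` is well defined over `A`. Arbitrary
  -- representations of the iterated coproduct of `u` can thus be used.
  let f : Env k A M ⊗[A] Env k A M →ₗ[A] Env k A L := ∑ j, C.equiv.toLinearMap ∘ₗ
    TensorProduct.map (C.cocycleLin (T.fst j)) (Env.mulRight (T.snd j))
  have hf : ∀ x y, f (x ⊗ₜ y) = ∑ j, Env.map ι (C.cocycle x (T.fst j)) * C.sec (y * T.snd j) := by
    intro x y
    simp only [f, LinearMap.sum_apply]
    rfl
  have hf' : ∀ y, f (Env.comul k A M y) = C.sec y * C.sec v := by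
    intro y
    obtain ⟨W⟩ := exists_tensorRep (Env.comul k A M y)
    rw [W.map_eq_sum, C.sec_mul_sec y v W T]
    simp only [hf]
  have h₁ : C.actMul b f (Env.comul₃ u) = C.sec u * Env.map ι b * C.sec v := by
    obtain ⟨W⟩ := exists_tensorRep (Env.comul k A M u)
    rw [Env.comul₃, LinearMap.comp_apply, ← LinearMap.comp_apply, W.map_eq_sum,
      C.sec_mul_map u b W, Finset.sum_mul]
    refine Finset.sum_congr rfl fun i _ => ?_
    rw [LinearMap.comp_apply, LinearMap.lTensor_tmul, actMul_tmul, hf', mul_assoc]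
  rw [← h₁]
  refine (congrArg (C.actMul b f) S.eq_sum).trans ?_
  rw [map_sum]
  refine Finset.sum_congr rfl fun i _ => ?_
  rw [actMul_tmul, hf, Finset.mul_sum]
  refine Finset.sum_congr rfl fun j _ => ?_
  rw [map_mul (Env.map ι), mul_assoc]

theorem equiv_algebra_smul (c : k) (x : Env k A N ⊗[A] Env k A M) :
    C.equiv (c • x) = c • C.equiv x := by
  rw [← algebraMap_smul A c x, map_smul, algebraMap_smul]

theorem equiv_symm_algebra_smul (c : k) (x : Env k A L) :
    C.equiv.symm (c • x) = c • C.equiv.symm x := by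
  rw [← algebraMap_smul A c x, map_smul, algebraMap_smul]

/-- The crossed product multiplication, transported from `𝒰_A(L)`. -/
def crossedProductMul : CrossedProductMul C.act C.cocycle where
  mul := LinearMap.mk₂ k (fun x y => C.equiv.symm (C.equiv x * C.equiv y))
    (fun x x' y => by rw [map_add, add_mul, map_add])
    (fun c x y => by rw [equiv_algebra_smul, smul_mul_assoc, equiv_symm_algebra_smul])
    (fun x y y' => by rw [map_add, mul_add, map_add])
    (fun c x y => by rw [equiv_algebra_smul, mul_smul_comm, equiv_symm_algebra_smul])
  mul_tmul b u b' v S T := by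
    rw [LinearMap.mk₂_apply, LinearEquiv.symm_apply_eq, equiv_tmul, equiv_tmul, mul_assoc,
      ← mul_assoc (C.sec u), C.sec_mul_map_mul_sec u v b' S T]
    simp only [map_sum, equiv_tmul, Finset.mul_sum, map_mul, mul_assoc]
  one_mul x := by
    rw [LinearMap.mk₂_apply, equiv_tmul, map_one, sec_one, one_mul, one_mul,
      LinearEquiv.symm_apply_apply]
  mul_one x := by
    rw [LinearMap.mk₂_apply, equiv_tmul, map_one, sec_one, mul_one, mul_one,
      LinearEquiv.symm_apply_apply]
  mul_assoc x y z := by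
    simp only [LinearMap.mk₂_apply, LinearEquiv.apply_symm_apply, mul_assoc]

/-- The isomorphism from the crossed product, as an `A`-linear map. -/
def crossedLin : CrossedProduct C.crossedProductMul ≃ₗ[A] Env k A L :=
  (CrossedProduct.equiv C.crossedProductMul).symm.trans C.equiv

theorem crossedLin_mul (x y : CrossedProduct C.crossedProductMul) :
    C.crossedLin (x * y) = C.crossedLin x * C.crossedLin y :=
  C.equiv.apply_symm_apply _

/-- The isomorphism from the crossed product. -/
def crossedEquiv : CrossedProduct C.crossedProductMul ≃ₐ[k] Env k A L :=
  AlgEquiv.ofLinearEquiv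
    { C.crossedLin.toAddEquiv with
      map_smul' := fun c x => C.equiv_algebra_smul c x }
    (by
      change C.equiv (1 ⊗ₜ 1) = 1
      rw [equiv_tmul, map_one, sec_one, one_mul])
    C.crossedLin_mul

theorem crossedEquiv_tmul (b : Env k A N) (v : Env k A M) :
    C.crossedEquiv (CrossedProduct.tmul _ b v) = Env.map ι b * C.sec v := rfl

/-- The base map of the crossed product. -/
def crossedBase : A →ₐ[k] CrossedProduct C.crossedProductMul :=
  (C.crossedEquiv.symm : Env k A L →ₐ[k] _).comp (Env.base k A L)

theorem crossedEquiv_base (a : A) : C.crossedEquiv (C.crossedBase a) = Env.base k A L a :=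
  C.crossedEquiv.apply_symm_apply _

theorem crossedBase_apply (a : A) :
    C.crossedBase a = CrossedProduct.tmul _ (Env.base k A N a) 1 := by
  apply C.crossedEquiv.injective
  rw [crossedEquiv_base, crossedEquiv_tmul, sec_one, mul_one, Env.map_base]

theorem coaction_crossedEquiv (x : CrossedProduct C.crossedProductMul) :
    envCoaction π (C.crossedEquiv x) = C.crossedLin.toLinearMap.rTensor (Env k A M)
      (CrossedProduct.coaction C.crossedProductMul x) := by
  refine (C.coaction_equiv x).trans ?_
  have h : C.equiv.toLinearMap = C.crossedLin.toLinearMap ∘ₗ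
      (CrossedProduct.equiv C.crossedProductMul).toLinearMap := LinearMap.ext fun _ => rfl
  rw [h, LinearMap.rTensor_comp]
  rfl

theorem isRightComoduleAlgebra_crossedProduct :
    IsRightComoduleAlgebra C.crossedBase (CrossedProduct.coaction C.crossedProductMul) :=
  (isRightComoduleAlgebra_envCoaction π).of_equiv C.crossedEquiv C.crossedLin (fun _ => rfl)
    C.crossedEquiv_base C.coaction_crossedEquiv

theorem coaction_crossedEquiv_eq_sum (x : CrossedProduct C.crossedProductMul)
    (S : TensorRep (CrossedProduct.coaction C.crossedProductMul x)) :
    envCoaction π (C.crossedEquiv x) = ∑ i, C.crossedEquiv (S.fst i) ⊗ₜ[A] S.snd i := by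
  rw [coaction_crossedEquiv, S.map_eq_sum]
  rfl

end CleftExtension
end Cleft

/-! ## Extensions of projective Lie-Rinehart algebras are cleft -/

theorem nonempty_dualBasis (A : Type uA) (M : Type uM) [CommRing A] [AddCommGroup M] [Module A M]
    [Module.Projective A M] : Nonempty (DualBasis.{uA, uM, uM} A M) := by
  obtain ⟨s, hs⟩ := Module.projective_def'.1 (inferInstance : Module.Projective A M)
  exact ⟨⟨M, id, s, LinearMap.congr_fun hs⟩⟩

section Split

variable {A : Type uA} {N : Type uN} {L : Type uL} {M : Type uM} [CommRing A]
variable [LieRing N] [Module A N] [LieRing L] [Module A L] [LieRing M] [Module A M]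
variable {i : N →ₗ[A] L} {p : L →ₗ[A] M} {γ : M →ₗ[A] L}

theorem exists_retraction (hi : Function.Injective i) (hex : Function.Exact i p)
    (hγ : ∀ X, p (γ X) = X) : ∃ r : L →ₗ[A] N, (∀ X, i (r X) + γ (p X) = X) ∧
      (∀ Y, r (i Y) = Y) ∧ ∀ Z, r (γ Z) = 0 := by
  have hmem : ∀ X, (LinearMap.id - γ ∘ₗ p : L →ₗ[A] L) X ∈ LinearMap.range i := by
    intro X
    refine (hex _).1 ?_
    simp [hγ]
  let r : L →ₗ[A] N := (LinearEquiv.ofInjective i hi).symm.toLinearMap ∘ₗ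
    (LinearMap.id - γ ∘ₗ p : L →ₗ[A] L).codRestrict _ hmem
  have hr : ∀ X, i (r X) = X - γ (p X) := by
    intro X
    have := congrArg Subtype.val ((LinearEquiv.ofInjective i hi).apply_symm_apply
      ((LinearMap.id - γ ∘ₗ p : L →ₗ[A] L).codRestrict _ hmem X))
    exact this
  refine ⟨r, fun X => by rw [hr, sub_add_cancel], fun Y => hi ?_, fun Z => hi ?_⟩
  · rw [hr, hex.apply_apply_eq_zero, map_zero, sub_zero]
  · rw [hr, hγ, sub_self, map_zero]

/-- The algebra map `𝒮_A(L) → 𝒮_A(N) ⊗_A 𝒮_A(M)` induced by maps `L → N` and `L → M`. -/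
def symSplit (r : L →ₗ[A] N) (p : L →ₗ[A] M) :
    SymmetricAlgebra A L →ₐ[A] SymmetricAlgebra A N ⊗[A] SymmetricAlgebra A M :=
  SymmetricAlgebra.lift
    (Algebra.TensorProduct.includeLeft.toLinearMap ∘ₗ SymmetricAlgebra.ι A N ∘ₗ r +
      Algebra.TensorProduct.includeRight.toLinearMap ∘ₗ SymmetricAlgebra.ι A M ∘ₗ p)

theorem symSplit_ι (r : L →ₗ[A] N) (p : L →ₗ[A] M) (X : L) :
    symSplit r p (SymmetricAlgebra.ι A L X) =
      SymmetricAlgebra.ι A N (r X) ⊗ₜ 1 + 1 ⊗ₜ SymmetricAlgebra.ι A M (p X) := by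
  simp [symSplit]

theorem symMap_ι (f : M →ₗ[A] L) (X : M) :
    symMap f (SymmetricAlgebra.ι A M X) = SymmetricAlgebra.ι A L (f X) := by
  simp [symMap]

/-- The inverse multiplies the images of the two factors under `𝒮(i)` and `𝒮(γ)`; the composites are
algebra maps and are compared on generators. -/
theorem symSplit_bijective {r : L →ₗ[A] N} (h₁ : ∀ X, i (r X) + γ (p X) = X)
    (h₂ : ∀ Y, r (i Y) = Y) (h₃ : ∀ Z, r (γ Z) = 0) (h₄ : ∀ Y, p (i Y) = 0)
    (h₅ : ∀ Z, p (γ Z) = Z) : Function.Bijective (symSplit r p) := by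
  let τ := Algebra.TensorProduct.productMap (symMap i) (symMap γ)
  have e₁ : τ.comp (symSplit r p) = AlgHom.id A _ := by
    refine SymmetricAlgebra.algHom_ext (LinearMap.ext fun X => ?_)
    change τ (symSplit r p (SymmetricAlgebra.ι A L X)) = SymmetricAlgebra.ι A L X
    rw [symSplit_ι, map_add]
    simp only [τ, Algebra.TensorProduct.productMap_apply_tmul, map_one, mul_one, one_mul, symMap_ι]
    rw [← map_add, h₁]
  have e₂ : (symSplit r p).comp τ = AlgHom.id A _ := by
    refine Algebra.TensorProduct.ext ?_ ?_
    · refine SymmetricAlgebra.algHom_ext (LinearMap.ext fun Y => ?_)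
      change symSplit r p (τ (SymmetricAlgebra.ι A N Y ⊗ₜ 1)) = SymmetricAlgebra.ι A N Y ⊗ₜ 1
      simp only [τ, Algebra.TensorProduct.productMap_apply_tmul, map_one, mul_one, symMap_ι,
        symSplit_ι, h₂, h₄, map_zero, TensorProduct.tmul_zero, add_zero]
    · refine SymmetricAlgebra.algHom_ext (LinearMap.ext fun Z => ?_)
      change symSplit r p (τ (1 ⊗ₜ SymmetricAlgebra.ι A M Z)) = 1 ⊗ₜ SymmetricAlgebra.ι A M Z
      simp only [τ, Algebra.TensorProduct.productMap_apply_tmul, map_one, one_mul, symMap_ι,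
        symSplit_ι, h₃, h₅, map_zero, TensorProduct.zero_tmul, zero_add]
  exact Function.bijective_iff_has_inverse.2
    ⟨τ, fun x => DFunLike.congr_fun e₁ x, fun x => DFunLike.congr_fun e₂ x⟩

variable (A N M) in
/-- The filtration of `𝒮_A(N) ⊗_A 𝒮_A(M)` by total word length. -/
def tensorFil (n : ℕ) : Submodule A (SymmetricAlgebra A N ⊗[A] SymmetricAlgebra A M) :=
  -- Degrees at most `l - 1` and `m - 1` add up to less than `n` when `l + m ≤ n + 1`.
  Submodule.span A {t | ∃ l m s s', l + m ≤ n + 1 ∧ s ∈ symFil A N l ∧ s' ∈ symFil A M m ∧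
    s ⊗ₜ s' = t}

theorem symSplit_mem_tensorFil (r : L →ₗ[A] N) (p : L →ₗ[A] M) {n : ℕ}
    {s : SymmetricAlgebra A L} (hs : s ∈ symFil A L n) : symSplit r p s ∈ tensorFil A N M n := by
  refine wordSpan_induction (A := A) (p := fun n s => symSplit r p s ∈ tensorFil A N M n)
    ?_ ?_ ?_ ?_ ?_ hs
  · intro n; rw [map_zero]; exact zero_mem _
  · intro n x y hx hy; rw [map_add]; exact add_mem hx hy
  · intro n a x _ hx; rw [map_smul]; exact Submodule.smul_mem _ _ hx
  · intro n
    rw [map_one]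
    exact Submodule.subset_span ⟨1, 1, 1, 1, by omega, one_mem_wordSpan _ 0,
      one_mem_wordSpan _ 0, rfl⟩
  · intro n X u _ hu
    rw [map_mul, symSplit_ι]
    generalize symSplit r p u = t at hu
    induction hu using Submodule.span_induction with
    | mem t ht =>
      obtain ⟨l, m, s, s', h, hs, hs', rfl⟩ := ht
      rw [add_mul, Algebra.TensorProduct.tmul_mul_tmul, Algebra.TensorProduct.tmul_mul_tmul,
        one_mul, one_mul]
      exact add_mem
        (Submodule.subset_span ⟨l + 1, m, _, _, by omega, ι_mul_mem_symFil _ hs, hs', rfl⟩)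
        (Submodule.subset_span ⟨l, m + 1, _, _, by omega, hs, ι_mul_mem_symFil _ hs', rfl⟩)
    | zero => rw [mul_zero]; exact zero_mem _
    | add x y _ _ hx hy => rw [mul_add]; exact add_mem hx hy
    | smul a x _ hx => rw [mul_smul_comm]; exact Submodule.smul_mem _ _ hx

end Split

/-! ### Bijectivity of `b ⊗ v ↦ b Γ(v)` -/

section Extension

set_option linter.unusedSectionVars false

variable {k : Type uk} {A : Type uA} {N : Type uN} {L : Type uL} {M : Type uM}
variable [Field k] [CharZero k] [CommRing A] [Algebra k A]
variable [LieRing N] [LieAlgebra k N] [Module A N] [LieRingModule N A]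
variable [LieRinehartRing A N] [LieRinehartAlgebra k A N] [Module.Projective A N]
variable [LieRing L] [LieAlgebra k L] [Module A L] [LieRingModule L A]
variable [LieRinehartRing A L] [LieRinehartAlgebra k A L] [Module.Projective A L]
variable [LieRing M] [LieAlgebra k M] [Module A M] [LieRingModule M A]
variable [LieRinehartRing A M] [LieRinehartAlgebra k A M] [Module.Projective A M]

/-- A dual basis makes `S(L)` a retract of a polynomial ring, which is free, and symmetrisation
carries this over to `U(L)`. -/
theorem projective_env : Module.Projective A (Env k A L) := by
  obtain ⟨D⟩ := nonempty_dualBasis A L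
  have hD : (MvPolynomial.aeval (fun i => SymmetricAlgebra.ι A L (D.vec i))).comp (dualPoly D) =
      AlgHom.id A (SymmetricAlgebra A L) := by
    refine SymmetricAlgebra.algHom_ext (LinearMap.ext fun X => ?_)
    change MvPolynomial.aeval (fun i => SymmetricAlgebra.ι A L (D.vec i))
      (dualPoly D (SymmetricAlgebra.ι A L X)) = SymmetricAlgebra.ι A L X
    conv_rhs => rw [← D.sum_coord X]
    rw [dualPoly_ι, Finsupp.apply_linearCombination, Finsupp.linearCombination_apply,
      Finsupp.linearCombination_apply, map_finsuppSum]
    refine Finsupp.sum_congr fun i _ => ?_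
    simp
  have : Module.Projective A (SymmetricAlgebra A L) :=
    Module.Projective.of_split (dualPoly D).toLinearMap
      (MvPolynomial.aeval (fun i => SymmetricAlgebra.ι A L (D.vec i))).toLinearMap
      (LinearMap.ext fun x => DFunLike.congr_fun hD x)
  exact Module.Projective.of_equiv
    (LinearEquiv.ofBijective _ (symmetrisation_bijective (k := k) D))

theorem symmetrisation_mem_fil (D : DualBasis.{uA, uL, uI} A L) {n : ℕ}
    {s : SymmetricAlgebra A L} (hs : s ∈ symFil A L n) :
    symmetrisation k D s ∈ Env.fil k A L n :=
  map_mem_fil_of_sub_mem _ (symmetrisation_one D) (symmetrisation_ι_mul_sub_mem D) hs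

variable (ι : N →ₗ⁅AlgHom.id k A⁆ L) (π : L →ₗ⁅AlgHom.id k A⁆ M)
variable (γ : M →ₗ[A] L) (hγ : ∀ X, homLin π (γ X) = X) (D : DualBasis.{uA, uL, uI} A L)

/-- Precomposition with `S(L) ≅ S(N) ⊗ S(M)` and the two symmetrisations gives a map from `S(L)` to
`U(L)`. It has the expected leading terms, hence is bijective by `SymbolMap.bijective_of_sub_mem`,
and the isomorphisms can be cancelled. -/
theorem cleftMap_bijective (hN : ∀ (X : N) (a : A), ⁅X, a⁆ = 0) (hι : Function.Injective ι)
    (hex : Function.Exact ι π) :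
    Function.Bijective (cleftMap hN ι (coringSection π γ hγ D)) := by
  obtain ⟨r, h₁, h₂, h₃⟩ := exists_retraction (i := homLin ι) (p := homLin π) hι hex hγ
  obtain ⟨DN⟩ := nonempty_dualBasis A N
  obtain ⟨G⟩ := nonempty_symbolMap k A L
  let DM := D.push (homLin π) γ hγ
  let P := TensorProduct.map (symmetrisation k DN) (symmetrisation k DM)
  have hP : Function.Bijective P :=
    (TensorProduct.congr (LinearEquiv.ofBijective _ (symmetrisation_bijective (k := k) DN))
      (LinearEquiv.ofBijective _ (symmetrisation_bijective (k := k) DM))).bijective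
  have hsplit := symSplit_bijective (i := homLin ι) (p := homLin π) h₁ h₂ h₃
    (fun Y => hex.apply_apply_eq_zero Y) hγ
  let F := cleftMap hN ι (coringSection π γ hγ D) ∘ₗ P
  have hF : ∀ s s', F (s ⊗ₜ s') =
      Env.map ι (symmetrisation k DN s) * symmetrisation k D (symMap γ s') := by
    intro s s'
    rw [← coringSection_symmetrisation π γ hγ D s']
    rfl
  -- The first half is carried along for the scalar case, where moving `a` past `X` leaves `⁅X, a⁆ •
  -- F x`.
  have step : ∀ n t, t ∈ tensorFil A N M n → F t ∈ Env.fil k A L n ∧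
      ∀ X, F (symSplit r (homLin π) (SymmetricAlgebra.ι A L X) * t) - Env.gen k A L X * F t ∈
        Env.fil k A L n := by
    intro n t ht
    induction ht using Submodule.span_induction with
    | zero =>
      refine ⟨by rw [map_zero]; exact zero_mem _, fun X => ?_⟩
      rw [mul_zero, map_zero, mul_zero, sub_zero]
      exact zero_mem _
    | add x y _ _ hx hy =>
      refine ⟨by rw [map_add]; exact add_mem hx.1 hy.1, fun X => ?_⟩
      rw [mul_add, map_add, map_add, mul_add, add_sub_add_comm]
      exact add_mem (hx.2 X) (hy.2 X)
    | smul a x _ hx =>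
      refine ⟨by rw [map_smul]; exact Submodule.smul_mem _ _ hx.1, fun X => ?_⟩
      rw [mul_smul_comm, map_smul, map_smul, Env.gen_mul_smul, ← sub_sub, ← smul_sub]
      exact sub_mem (Submodule.smul_mem _ _ (hx.2 X)) (Submodule.smul_mem _ _ hx.1)
    | mem t ht =>
      obtain ⟨l, m, s, s', h, hs, hs', rfl⟩ := ht
      cases m with
      | zero =>
        have : s' = 0 := by rwa [symFil, wordSpan_zero, Submodule.mem_bot] at hs'
        subst this
        simp
      | succ m =>
        have hB : Env.map ι (symmetrisation k DN s) ∈ Env.fil k A L l :=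
          Env.map_mem_fil ι (symmetrisation_mem_fil DN hs)
        have hs'' : symMap γ s' ∈ symFil A L (m + 1) := map_mem_symFil _ γ (symMap_ι γ) hs'
        have hC : symmetrisation k D (symMap γ s') ∈ Env.fil k A L (m + 1) :=
          symmetrisation_mem_fil D hs''
        have hle : Env.fil k A L (l + m) ≤ Env.fil k A L n := wordSpan_mono _ (by omega)
        refine ⟨by rw [hF]; exact hle (Env.mul_mem_fil hB hC), fun X => ?_⟩
        -- Write `X` as the sum of `ι(r X)` and `γ(π X)`. The three errors are that of
        -- symmetrisation on `N` for the first summand, that of symmetrisation on `L` for the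
        -- second, and the commutator of `γ(π X)` with the factor from `U(N)`, which stands to its
        -- left.
        have k₁ := hle (Env.mul_mem_fil (Env.map_mem_fil ι
          (symmetrisation_ι_mul_sub_mem (k := k) DN l s hs (r X))) hC)
        have k₂ := hle (Env.mul_mem_fil hB
          (symmetrisation_ι_mul_sub_mem (k := k) D (m + 1) _ hs'' (γ (homLin π X))))
        have k₃ := hle (Env.mul_mem_fil
          (Env.mul_gen_sub_gen_mul_mem_fil (γ (homLin π X)) hB) hC)
        have e : Env.gen k A L X = Env.gen k A L (ι (r X)) + Env.gen k A L (γ (homLin π X)) := by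
          conv_lhs => rw [← h₁ X, map_add]
          rfl
        convert add_mem k₁ (add_mem k₂ k₃) using 1
        rw [symSplit_ι, add_mul, Algebra.TensorProduct.tmul_mul_tmul,
          Algebra.TensorProduct.tmul_mul_tmul, one_mul, one_mul, map_add, hF, hF, hF, e,
          map_mul (symMap γ), symMap_ι, map_sub, map_mul (Env.map ι), Env.map_gen]
        simp only [sub_mul, mul_sub, add_mul, mul_assoc]
        abel
  have hbij : Function.Bijective (F ∘ₗ (symSplit r (homLin π)).toLinearMap) := by
    refine G.bijective_of_sub_mem _ ?_ ?_
    · change F (symSplit r (homLin π) 1) = 1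
      rw [map_one, Algebra.TensorProduct.one_def, hF, map_one (symMap γ), symmetrisation_one,
        symmetrisation_one, map_one, one_mul]
    · intro n s hs X
      have := (step n _ (symSplit_mem_tensorFil r (homLin π) hs)).2 X
      rw [← map_mul] at this
      exact this
  have hFb : Function.Bijective F := (Function.Bijective.of_comp_iff F hsplit).1 hbij
  exact (Function.Bijective.of_comp_iff _ hP).1 hFb

/-- The cleft extension given by a linear section and a dual basis. -/
def cleftExtension (hι : Function.Injective ι) (hex : Function.Exact ι π) :
    CleftExtension ι π where
  sec := coringSection π γ hγ D
  isCoringSection := isCoringSection_coringSection π γ hγ D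
  exact := hex
  bijective := cleftMap_bijective ι π γ hγ D _ hι hex

end Extension

end LieRinehart

end

theorem theorem3p9 {k : Type uk} {A : Type uA} {n : Type un} {g : Type ug} {h : Type uh}
    [Field k] [CharZero k] [CommRing A] [Algebra k A]
    [LieRing n] [LieAlgebra k n] [Module A n] [LieRingModule n A] [LieRinehartRing A n]
    [LieRinehartAlgebra k A n] [Module.Projective A n]
    [LieRing g] [LieAlgebra k g] [Module A g] [LieRingModule g A] [LieRinehartRing A g]
    [LieRinehartAlgebra k A g] [Module.Projective A g]
    [LieRing h] [LieAlgebra k h] [Module A h] [LieRingModule h A] [LieRinehartRing A h]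
    [LieRinehartAlgebra k A h] [Module.Projective A h]
    (ι : n →ₗ⁅AlgHom.id k A⁆ g) (π : g →ₗ⁅AlgHom.id k A⁆ h)
    (hι : Function.Injective ι) (hex : Function.Exact ι π) (hπ : Function.Surjective π) :
    (∃ γ : h →ₗ[A] g, ∀ X, homLin π (γ X) = X) ∧ Nonempty (DualBasis.{uA, ug, ug} A g) ∧
    Function.Bijective (Env.galois k A g) ∧
    Function.Injective (Env.map ι) ∧ Set.range (Env.map ι) = leftHopfKernel π ∧
    ∀ (γ : h →ₗ[A] g) (hγ : ∀ X, homLin π (γ X) = X) (D : DualBasis.{uA, ug, uI} A g),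
      Function.Bijective (symmetrisation k (D.push (homLin π) γ hγ)) ∧
      IsCoringSection π (coringSection π γ hγ D) ∧
      ∃ (act : Env k A h →ₗ[k] Env k A n →ₗ[k] Env k A n)
        (σ : Env k A h →ₗ[k] Env k A h →ₗ[k] Env k A n),
        IsWeakAdjoint ι (coringSection π γ hγ D) act ∧
        IsSectionCocycle ι (coringSection π γ hγ D) σ ∧
        IsMeasuring (Env.base k A n) act ∧
        IsCocycle (Env.base k A n) act σ ∧
        IsTwistedModule act σ ∧
        ∃ (P : CrossedProductMul act σ) (j : A →ₐ[k] CrossedProduct P)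
          (Φ : CrossedProduct P ≃ₐ[k] Env k A g),
          (∀ a, j a = CrossedProduct.tmul P (Env.base k A n a) 1) ∧
          (∀ b v, Φ (CrossedProduct.tmul P b v) = Env.map ι b * coringSection π γ hγ D v) ∧
          (∀ a, Φ (j a) = Env.base k A g a) ∧
          IsRightComoduleAlgebra j (CrossedProduct.coaction P) ∧
          IsRightComoduleAlgebra (Env.base k A g) (envCoaction π) ∧
          ∀ (x : CrossedProduct P) (S : TensorRep (CrossedProduct.coaction P x)),
            envCoaction π (Φ x) = ∑ i, Φ (S.fst i) ⊗ₜ[A] S.snd i := by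
  obtain ⟨γ₀, hγ₀⟩ : ∃ γ : h →ₗ[A] g, ∀ X, homLin π (γ X) = X := by
    obtain ⟨γ, hγ⟩ := Module.projective_lifting_property (homLin π) LinearMap.id hπ
    exact ⟨γ, LinearMap.congr_fun hγ⟩
  obtain ⟨D₀⟩ := nonempty_dualBasis A g
  -- The kernel statements do not mention `Γ`, so they may be read off from one arbitrary choice of
  -- section and dual basis.
  let C₀ := cleftExtension ι π γ₀ hγ₀ D₀ hι hex
  refine ⟨⟨γ₀, hγ₀⟩, ⟨D₀⟩, Env.galois_bijective, C₀.map_injective, C₀.range_map,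
    fun γ hγ D => ⟨symmetrisation_bijective _, isCoringSection_coringSection π γ hγ D, ?_⟩⟩
  let C := cleftExtension ι π γ hγ D hι hex
  have : Module.Projective A (Env k A g) := projective_env
  exact ⟨C.act, C.cocycle, C.isWeakAdjoint, C.isSectionCocycle, C.isMeasuring, C.isCocycle,
    C.isTwistedModule, C.crossedProductMul, C.crossedBase, C.crossedEquiv, C.crossedBase_apply,
    C.crossedEquiv_tmul, C.crossedEquiv_base, C.isRightComoduleAlgebra_crossedProduct,
    isRightComoduleAlgebra_envCoaction π, C.coaction_crossedEquiv_eq_sum⟩
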